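/- **Notation.** Let $\epsilon=1/100$, $e(x)=e^{2\pi i x}$, $\Gamma_{\mathbb R}(z)=\pi^{-z/2}\Gamma(z/2)$, and let $\int_{(c)}$ denote integration along the upward vertical line of real part $c$. **The form.** Let $\Phi$ be a Maass cusp form of $SL_3(\mathbb Z)$ on $\mathfrak h^3=GL_3(\mathbb R)/(O_3(\mathbb R)\mathbb R^\times)$ with Langlands parameters $\alpha=(\alpha_1,\alpha_2,\alpha_3)\in(i\mathbb R)^3$, $\alpha_1+\alpha_2+\alpha_3=0$; that is, $\Phi$ has the same eigenvalues under the centre of the universal enveloping algebra of $\mathfrak{gl}_3$ as $I_\alpha(y_0,y_1)=y_0^{1-\alpha_3}y_1^{1+\alpha_1}$, a function of the Iwasawa coordinates $\mathrm{diag}(y_0y_1,y_0,1)$. Write $n(u)$ for the upper triangular unipotent matrix with entries $u_{1,2},u_{1,3},u_{2,3}$, and $w=\begin{pmatrix}&&1\\&-1&\\1&&\end{pmatrix}$. The Whittaker function $W_\alpha(y_0,y_1)$ is the analytic continuation in $\alpha$ of Jacquet's integral $$\prod_{j<k}\Gamma_{\mathbb R}(1+\alpha_j-\alpha_k)\int_{\mathbb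 R^3} I_\alpha\bigl(w\,n(u)\,\mathrm{diag}(y_0y_1,y_0,1)\bigr)\,e(-u_{1,2}-u_{2,3})\,du ,$$ which converges absolutely for $\Re\alpha_1>\Re\alpha_2>\Re\alpha_3$. The Fourier coefficients $\mathcal B_\Phi(m_1,m_2)$ ($m_1m_2\ne0$) are defined by $$\int_{[0,1]^3}\Phi\bigl(n(u)\,\mathrm{diag}(y_0y_1,y_0,1)\bigr)\,e(-m_1u_{2,3}-m_2u_{1,2})\,du=\frac{\mathcal B_\Phi(m_1,m_2)}{|m_1m_2|}\,W_\alpha(|m_1|y_0,|m_2|y_1)\qquad(y_0,y_1>0),$$ and $L(s,\Phi)=\sum_{n\ge1}\mathcal B_\Phi(1,n)n^{-s}$. Let $\theta\ge0$ be an exponent towards the Ramanujan conjecture for $\Phi$: $\mathcal B_\Phi(1,n)\ll_\kappa n^{\theta+\kappa}$ for every $\kappa>0$. **The test function.** Let $\eta>40$ and let $H$ be holomorphic on $|\Re\mu|<2\eta$, even, with $H(\mu)\ll e^{-2\pi|\mu|}$ there. Put $W_\mu(y)=2\sqrt y\,K_\mu(2\pi y)$, $$h(y)=H^\flat(y)=\frac1{4\pi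 i}\int_{(0)}H(\mu)W_\mu(y)\frac{d\mu}{|\Gamma(\mu)|^2},\qquad \widetilde h(w)=\int_0^\infty h(y)y^w\,\frac{dy}y .$$ **The perturbed off-diagonal.** For $0<\phi<\pi/2$ and real $x\ne0$ let $e(x;\phi)=\int_{(\epsilon)}|2\pi x|^{-u}e^{iu\phi\,\mathrm{sgn}(x)}\Gamma(u)\,\frac{du}{2\pi i}$, and let $$OD_\Phi(s;\phi)=\sum_{a_0\ne0}\sum_{a_1\ne0}\frac{\mathcal B_\Phi(1,a_1)}{|a_0|^{2s-1}|a_1|}\int_0^\infty\!\!\int_0^\infty h(y_1)(y_0^2y_1)^{s-\frac12}\,W_{-\alpha}\Bigl(\Bigl|\frac{a_1}{a_0}\Bigr|\frac{y_0}{1+y_0^2},\,y_1\sqrt{1+y_0^2}\Bigr)\,e\Bigl(\frac{a_1}{a_0}\frac{y_0^2}{1+y_0^2};\phi\Bigr)\frac{dy_0\,dy_1}{y_0y_1^2},$$ the sums being over nonzero integers. **The transform.** For $\delta=\pm$ let $$(\mathcal F_\Phi^{(\delta)}H)(s_0,s;\phi)=\int_{(15)}\int_{(\epsilon)}\widetilde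 h\bigl(s-s_1-\tfrac12\bigr)\,\mathcal G_\Phi^{(\delta)}(s_1,u;s_0,s;\phi)\,\frac{du}{2\pi i}\frac{ds_1}{2\pi i},$$ $$\mathcal G_\Phi^{(\delta)}(s_1,u;s_0,s;\phi)=G_\alpha(s_0-u,s_1)\,(2\pi)^{-u}e^{i\delta\phi u}\,\Gamma(u)\,\frac{\Gamma\bigl(\frac{u+1-2s+s_1-s_0}2\bigr)\Gamma\bigl(\frac{2s-s_0-u}2\bigr)}{\Gamma\bigl(\frac{1+s_1}2-s_0\bigr)},$$ $$G_\alpha(s_0,s_1)=\frac{\prod_{i=1}^3\Gamma_{\mathbb R}(s_0+\alpha_i)\Gamma_{\mathbb R}(s_1-\alpha_i)}{\Gamma_{\mathbb R}(s_0+s_1)} .$$ **Proposition (Dual Moment).** Let $0<\phi<\pi/2$ and $1+\frac\theta2+\epsilon<\Re s<4$. Then the sums and integrals defining $OD_\Phi(s;\phi)$ converge absolutely, the double integrals defining $(\mathcal F_\Phi^{(\pm)}H)(s_0,s;\phi)$ converge absolutely for $\Re s_0=1+\theta+2\epsilon$, the $s_0$-integral below converges absolutely, and $$OD_\Phi(s;\phi)=\frac14\int_{(1+\theta+2\epsilon)}\zeta(2s-s_0)\,L(s_0,\Phi)\sum_{\delta=\pm}(\mathcal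 F_\Phi^{(\delta)}H)(s_0,s;\phi)\,\frac{ds_0}{2\pi i}.$$ -/

import Mathlib

open Real Set MeasureTheory
open scoped ContDiff Matrix

noncomputable section

namespace DualMoment

/-! ## Coordinates on `GL₃(ℝ)` and on `𝔥³ = GL₃(ℝ) / (O₃(ℝ) · ℝˣ)` -/

/-- Functions on `GL₃(ℝ)` are written as functions on all real `3 × 3` matrices;
only their values at invertible matrices are ever used. -/
abbrev Mat3 : Type := Matrix (Fin 3) (Fin 3) ℝ

/-- The upper triangular unipotent matrix with entries `u₁₂, u₁₃, u₂₃`. -/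
def unip (u₁₂ u₁₃ u₂₃ : ℝ) : Mat3 := !![1, u₁₂, u₁₃; 0, 1, u₂₃; 0, 0, 1]

/-- The diagonal matrix `diag(y₀ y₁, y₀, 1)`. -/
def torus (y₀ y₁ : ℝ) : Mat3 := !![y₀ * y₁, 0, 0; 0, y₀, 0; 0, 0, 1]

/-- The long Weyl element used in Jacquet's integral. -/
def weyl : Mat3 := !![0, 0, 1; 0, -1, 0; 1, 0, 0]

/-- Euclidean length of a vector of `ℝ³`. -/
def len (v : Fin 3 → ℝ) : ℝ := √(v ⬝ᵥ v)

/-- The Iwasawa coordinate `y₀` of `g`, that is, the `y₀ > 0` in the decomposition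
`g = c · unip u₁₂ u₁₃ u₂₃ * torus y₀ y₁ * k`, `c > 0`, `k` orthogonal. -/
def iwY₀ (g : Mat3) : ℝ := len (g 1 ⨯₃ g 2) / len (g 2) ^ 2

/-- The Iwasawa coordinate `y₁` of `g`. -/
def iwY₁ (g : Mat3) : ℝ := |g.det| * len (g 2) / len (g 1 ⨯₃ g 2) ^ 2

/-- `I_α (g) = y₀ ^ (1 - α₃) * y₁ ^ (1 + α₁)` in the Iwasawa coordinates of `g`. -/
def powerFn (α : Fin 3 → ℂ) (g : Mat3) : ℂ :=
  (iwY₀ g : ℂ) ^ (1 - α 2) * (iwY₁ g : ℂ) ^ (1 + α 0)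

/-- `e(x) = exp(2πix)`. -/
def e (x : ℝ) : ℂ := Complex.exp (2 * π * Complex.I * x)

/-! ## Spherical Whittaker functions -/

/-- The `K`-Bessel function `K_μ(x) = ∫₀^∞ exp(-x cosh t) cosh(μ t) dt`, `x > 0`. -/
def besselK (μ : ℂ) (x : ℝ) : ℂ :=
  ∫ t : ℝ in Ioi 0, (Real.exp (-x * Real.cosh t) : ℂ) * Complex.cosh (μ * t)

/-- The Whittaker function `W_μ(y) = 2 √y K_μ(2πy)` of `GL₂(ℝ)`. -/
def whittaker₂ (μ : ℂ) (y : ℝ) : ℂ := 2 * (√y : ℂ) * besselK μ (2 * π * y)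

/-- Jacquet's integral with its normalizing factor. It converges absolutely when
`Re α₁ > Re α₂ > Re α₃`. -/
def jacquet (α : Fin 3 → ℂ) (y₀ y₁ : ℝ) : ℂ :=
  Complex.Gammaℝ (1 + α 0 - α 1) * Complex.Gammaℝ (1 + α 0 - α 2) *
      Complex.Gammaℝ (1 + α 1 - α 2) *
    ∫ u : ℝ × ℝ × ℝ, powerFn α (weyl * unip u.1 u.2.1 u.2.2 * torus y₀ y₁) * e (-u.1 - u.2.2)

/-- `α + t · (1, 0, -1)`; Jacquet's integral converges absolutely here for `Re t` large. -/
def shiftParam (α : Fin 3 → ℂ) (t : ℂ) : Fin 3 → ℂ := fun i => α i + t * ![1, 0, -1] i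

/-- `w` is the value at `α` of the analytic continuation of Jacquet's integral, continued
holomorphically along `α + t · (1, 0, -1)` from a half-plane `Re t > T`, where the integral
converges, to a half-plane containing `t = 0`. At most one `w` has this property. -/
def IsJacquetValue (α : Fin 3 → ℂ) (y₀ y₁ : ℝ) (w : ℂ) : Prop :=
  ∃ (F : ℂ → ℂ) (c T : ℝ), c < 0 ∧ DifferentiableOn ℂ F {t | c < t.re} ∧
    (∀ t : ℂ, T < t.re → F t = jacquet (shiftParam α t) y₀ y₁) ∧ F 0 = w

open Classical in
/-- The (complete, spherical) Whittaker function `W_α(y₀, y₁)` of `GL₃(ℝ)`: Jacquet's integral,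
analytically continued in `α`. (For purely imaginary `α` the integral itself
is not absolutely convergent.) -/
def whittaker₃ (α : Fin 3 → ℂ) (y₀ y₁ : ℝ) : ℂ :=
  if h : ∃ w, IsJacquetValue α y₀ y₁ w then h.choose else 0

/-! ## Maass cusp forms of `SL₃(ℤ)` -/

/-- The left-invariant derivative along the matrix unit `E_{ij}`:
`(D_{ij} f)(g) = d/dt f(g (1 + t E_{ij}))` at `t = 0`. -/
def lieDeriv (i j : Fin 3) (f : Mat3 → ℂ) (g : Mat3) : ℂ :=
  deriv (fun t : ℝ => f (g * (1 + t • Matrix.single i j (1 : ℝ)))) 0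

/-- The quadratic Casimir operator `∑ D_{ij} D_{ji}`. -/
def casimir₂ (f : Mat3 → ℂ) (g : Mat3) : ℂ :=
  ∑ i, ∑ j, lieDeriv i j (lieDeriv j i f) g

/-- The cubic Casimir operator `∑ D_{ij} D_{jk} D_{ki}`. -/
def casimir₃ (f : Mat3 → ℂ) (g : Mat3) : ℂ :=
  ∑ i, ∑ j, ∑ k, lieDeriv i j (lieDeriv j k (lieDeriv k i f)) g

/-- `f` and `I_α` are eigenfunctions of the operator `D` with the same eigenvalue. -/
def SameEigenvalue (D : (Mat3 → ℂ) → Mat3 → ℂ) (f : Mat3 → ℂ) (α : Fin 3 → ℂ) : Prop :=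
  ∃ c : ℂ, ∀ g : Mat3, g.det ≠ 0 → D f g = c * f g ∧ D (powerFn α) g = c * powerFn α g

/-- The point of `𝔥³` with coordinates `p = (u₁₂, u₁₃, u₂₃, y₀, y₁)`. -/
def point (p : ℝ × ℝ × ℝ × ℝ × ℝ) : Mat3 :=
  unip p.1 p.2.1 p.2.2.1 * torus p.2.2.2.1 p.2.2.2.2

/-- The coordinate domain `y₀, y₁ > 0`. -/
def coordDomain : Set (ℝ × ℝ × ℝ × ℝ × ℝ) := {p | 0 < p.2.2.2.1 ∧ 0 < p.2.2.2.2}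

/-- An integral matrix of determinant one as a real matrix. -/
def toReal (γ : Matrix.SpecialLinearGroup (Fin 3) ℤ) : Mat3 := γ.1.map (Int.cast : ℤ → ℝ)

/-- The set `S` of points of `𝔥³` meets every orbit of `SL₃(ℤ)` on `𝔥³`. -/
def MeetsAllOrbits (S : Set (ℝ × ℝ × ℝ × ℝ × ℝ)) : Prop :=
  ∀ p ∈ coordDomain, ∃ γ : Matrix.SpecialLinearGroup (Fin 3) ℤ, ∃ q ∈ S,
    ∃ k ∈ Matrix.orthogonalGroup (Fin 3) ℝ, ∃ c : ℝ, c ≠ 0 ∧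
      toReal γ * point p = c • (point q * k)

/-- `f ∈ L²(SL₃(ℤ)\𝔥³)` for the invariant measure `du₁₂ du₁₃ du₂₃ dy₀ dy₁ / (y₀ y₁)³`:
`|f|²` is integrable over a measurable set of representatives (possibly with repetitions)
of the orbits. -/
def SquareIntegrable (f : Mat3 → ℂ) : Prop :=
  ∃ S ⊆ coordDomain, MeasurableSet S ∧ MeetsAllOrbits S ∧
    IntegrableOn (fun p => ‖f (point p)‖ ^ 2 / (p.2.2.2.1 * p.2.2.2.2) ^ 3) S

/-- `Φ` is a Maass cusp form of `SL₃(ℤ)` with Langlands parameters `α`. The centre of the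
universal enveloping algebra of `𝔤𝔩₃` is generated by the Casimir elements of degrees `1, 2, 3`;
the one of degree `1` annihilates all functions that are invariant under the centre of `GL₃(ℝ)`,
so that only the degrees `2` and `3` have to be mentioned. -/
structure IsMaassCuspForm (Φ : Mat3 → ℂ) (α : Fin 3 → ℂ) : Prop where
  sum_param : α 0 + α 1 + α 2 = 0
  smooth : ContDiffOn ℝ ∞ (fun m : Fin 3 → Fin 3 → ℝ => Φ (Matrix.of m))
    {m | (Matrix.of m).det ≠ 0}
  left_inv : ∀ (γ : Matrix.SpecialLinearGroup (Fin 3) ℤ) (g : Mat3), g.det ≠ 0 →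
    Φ (toReal γ * g) = Φ g
  right_orth : ∀ (g k : Mat3), g.det ≠ 0 → k ∈ Matrix.orthogonalGroup (Fin 3) ℝ →
    Φ (g * k) = Φ g
  central : ∀ (g : Mat3) (c : ℝ), g.det ≠ 0 → c ≠ 0 → Φ (c • g) = Φ g
  square_integrable : SquareIntegrable Φ
  eigen₂ : SameEigenvalue casimir₂ Φ α
  eigen₃ : SameEigenvalue casimir₃ Φ α
  cusp₁₂ : ∀ g : Mat3, g.det ≠ 0 →
    ∫ u₁₂ in (0 : ℝ)..1, ∫ u₁₃ in (0 : ℝ)..1, Φ (unip u₁₂ u₁₃ 0 * g) = 0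
  cusp₂₁ : ∀ g : Mat3, g.det ≠ 0 →
    ∫ u₁₃ in (0 : ℝ)..1, ∫ u₂₃ in (0 : ℝ)..1, Φ (unip 0 u₁₃ u₂₃ * g) = 0
  cusp₁₁₁ : ∀ g : Mat3, g.det ≠ 0 →
    ∫ u₁₂ in (0 : ℝ)..1, ∫ u₁₃ in (0 : ℝ)..1, ∫ u₂₃ in (0 : ℝ)..1,
      Φ (unip u₁₂ u₁₃ u₂₃ * g) = 0

/-- The `(m₁, m₂)`-th Fourier-Whittaker period of `Φ` at `torus y₀ y₁`. -/
def fourierPeriod (Φ : Mat3 → ℂ) (m₁ m₂ : ℤ) (y₀ y₁ : ℝ) : ℂ :=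
  ∫ u₁₂ in (0 : ℝ)..1, ∫ u₁₃ in (0 : ℝ)..1, ∫ u₂₃ in (0 : ℝ)..1,
    Φ (unip u₁₂ u₁₃ u₂₃ * torus y₀ y₁) * e (-m₁ * u₂₃ - m₂ * u₁₂)

/-- `b` is the `(m₁, m₂)`-th Fourier coefficient of `Φ` (for `m₁, m₂ ≠ 0`). -/
def IsFourierCoeff (Φ : Mat3 → ℂ) (α : Fin 3 → ℂ) (m₁ m₂ : ℤ) (b : ℂ) : Prop :=
  ∀ y₀ y₁ : ℝ, 0 < y₀ → 0 < y₁ → fourierPeriod Φ m₁ m₂ y₀ y₁ =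
    b / ((|m₁ * m₂| : ℤ) : ℂ) * whittaker₃ α (|(m₁ : ℝ)| * y₀) (|(m₂ : ℝ)| * y₁)

open Classical in
/-- The Fourier coefficient `B_Φ(m₁, m₂)`. -/
def fourierCoeff (Φ : Mat3 → ℂ) (α : Fin 3 → ℂ) (m₁ m₂ : ℤ) : ℂ :=
  if h : ∃ b, IsFourierCoeff Φ α m₁ m₂ b then h.choose else 0

/-- The standard `L`-function `L(s, Φ) = ∑ B_Φ(1, n) n^{-s}`, as a Dirichlet series; it is only
used where this series converges absolutely. -/
def stdL (Φ : Mat3 → ℂ) (α : Fin 3 → ℂ) (s : ℂ) : ℂ :=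
  LSeries (fun n : ℕ => fourierCoeff Φ α 1 n) s

/-- `θ` is an admissible exponent towards the Ramanujan conjecture for `Φ`:
`B_Φ(1, n) ≪ n ^ (θ + κ)` for every `κ > 0`. -/
def IsRamanujanExponent (Φ : Mat3 → ℂ) (α : Fin 3 → ℂ) (θ : ℝ) : Prop :=
  0 ≤ θ ∧ ∀ κ : ℝ, 0 < κ → ∃ C : ℝ, ∀ n : ℕ, 1 ≤ n →
    ‖fourierCoeff Φ α 1 n‖ ≤ C * (n : ℝ) ^ (θ + κ)

/-! ## Test functions and integral transforms -/

/-- The integral of `f` along the upward vertical line `Re z = c` against `dz / (2πi)`. -/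
def vint (c : ℝ) (f : ℂ → ℂ) : ℂ := (1 / (2 * π)) * ∫ t : ℝ, f (c + t * Complex.I)

/-- The class `𝒞_η` of test functions. -/
structure IsTestFunction (η : ℝ) (H : ℂ → ℂ) : Prop where
  holo : DifferentiableOn ℂ H {μ | |μ.re| < 2 * η}
  even : ∀ μ : ℂ, |μ.re| < 2 * η → H (-μ) = H μ
  decay : ∃ C : ℝ, ∀ μ : ℂ, |μ.re| < 2 * η → ‖H μ‖ ≤ C * Real.exp (-2 * π * ‖μ‖)

/-- The inverse Kontorovich-Lebedev transform
`H^♭(y) = (4πi)⁻¹ ∫_{(0)} H(μ) W_μ(y) |Γ(μ)|⁻² dμ`. -/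
def invKL (H : ℂ → ℂ) (y : ℝ) : ℂ :=
  (1 / 2) * vint 0 (fun μ => H μ * whittaker₂ μ y / ((‖Complex.Gamma μ‖ ^ 2 : ℝ) : ℂ))

/-- The Mellin transform `∫₀^∞ h(y) y^w dy/y`. -/
def mellinT (h : ℝ → ℂ) (w : ℂ) : ℂ := ∫ y : ℝ in Ioi 0, h y * (y : ℂ) ^ w / y

/-- The fixed constant `ε = 1/100`. -/
def eps : ℝ := 1 / 100

/-- The perturbed exponential
`e(x; φ) = ∫_{(ε)} |2πx|^{-u} e^{iuφ sgn(x)} Γ(u) du/(2πi)`, `x ≠ 0`. -/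
def ePert (x φ : ℝ) : ℂ :=
  vint eps (fun u => ((|2 * π * x| : ℝ) : ℂ) ^ (-u) *
    Complex.exp (Complex.I * u * φ * (Real.sign x : ℂ)) * Complex.Gamma u)

/-- The `(a₀, a₁)`-th integrand of the perturbed off-diagonal, at `y = (y₀, y₁)`,
with `h = H^♭`. -/
def odIntegrand (Φ : Mat3 → ℂ) (α : Fin 3 → ℂ) (H : ℂ → ℂ) (s : ℂ) (φ : ℝ)
    (a₀ a₁ : ℤ) (y : ℝ × ℝ) : ℂ :=
  fourierCoeff Φ α 1 a₁ / (((|(a₀ : ℝ)| : ℝ) : ℂ) ^ (2 * s - 1) * ((|(a₁ : ℝ)| : ℝ) : ℂ)) *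
    (invKL H y.2 * ((y.1 ^ 2 * y.2 : ℝ) : ℂ) ^ (s - 1 / 2) *
      whittaker₃ (-α) (|(a₁ : ℝ) / a₀| * (y.1 / (1 + y.1 ^ 2))) (y.2 * √(1 + y.1 ^ 2)) *
      ePert ((a₁ : ℝ) / a₀ * (y.1 ^ 2 / (1 + y.1 ^ 2))) φ / ((y.1 * y.2 ^ 2 : ℝ) : ℂ))

/-- The quadrant `y₀, y₁ > 0`. -/
def quadrant : Set (ℝ × ℝ) := Ioi 0 ×ˢ Ioi 0

/-- Nonzero integers. -/
abbrev NZ : Type := {a : ℤ // a ≠ 0}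

/-- The perturbed off-diagonal `OD_Φ(s; φ)`. -/
def offDiag (Φ : Mat3 → ℂ) (α : Fin 3 → ℂ) (H : ℂ → ℂ) (s : ℂ) (φ : ℝ) : ℂ :=
  ∑' a : NZ × NZ, ∫ y in quadrant, odIntegrand Φ α H s φ a.1 a.2 y

/-- All sums and integrals in the definition of `OD_Φ(s; φ)` converge absolutely. -/
def OffDiagConverges (Φ : Mat3 → ℂ) (α : Fin 3 → ℂ) (H : ℂ → ℂ) (s : ℂ) (φ : ℝ) : Prop :=
  (∀ a : NZ × NZ, IntegrableOn (odIntegrand Φ α H s φ a.1 a.2) quadrant) ∧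
    Summable fun a : NZ × NZ => ∫ y in quadrant, ‖odIntegrand Φ α H s φ a.1 a.2 y‖

/-- The Vinogradov-Takhtadzhyan kernel `G_α(s₀, s₁)`. -/
def vtKernel (α : Fin 3 → ℂ) (s₀ s₁ : ℂ) : ℂ :=
  (∏ i, Complex.Gammaℝ (s₀ + α i) * Complex.Gammaℝ (s₁ - α i)) / Complex.Gammaℝ (s₀ + s₁)

/-- The kernel `𝒢_Φ^{(δ)}(s₁, u; s₀, s; φ)`, `δ = ±1`. -/
def bigKernel (α : Fin 3 → ℂ) (δ : ℝ) (s₁ u s₀ s : ℂ) (φ : ℝ) : ℂ :=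
  vtKernel α (s₀ - u) s₁ * (2 * π : ℂ) ^ (-u) * Complex.exp (Complex.I * δ * φ * u) *
    Complex.Gamma u *
    (Complex.Gamma ((u + 1 - 2 * s + s₁ - s₀) / 2) * Complex.Gamma ((2 * s - s₀ - u) / 2) /
      Complex.Gamma ((1 + s₁) / 2 - s₀))

/-- The integrand of `(ℱ_Φ^{(δ)} H)(s₀, s; φ)`, with `h = H^♭`. -/
def transIntegrand (α : Fin 3 → ℂ) (H : ℂ → ℂ) (δ : ℝ) (s₀ s : ℂ) (φ : ℝ) (s₁ u : ℂ) : ℂ :=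
  mellinT (invKL H) (s - s₁ - 1 / 2) * bigKernel α δ s₁ u s₀ s φ

/-- The transform `(ℱ_Φ^{(δ)} H)(s₀, s; φ)`. It depends on `Φ` only through `α`. -/
def transF (α : Fin 3 → ℂ) (H : ℂ → ℂ) (δ : ℝ) (s₀ s : ℂ) (φ : ℝ) : ℂ :=
  vint 15 (fun s₁ => vint eps (fun u => transIntegrand α H δ s₀ s φ s₁ u))

/-- The double integral defining `(ℱ_Φ^{(δ)} H)(s₀, s; φ)` converges absolutely. -/
def TransConverges (α : Fin 3 → ℂ) (H : ℂ → ℂ) (δ : ℝ) (s₀ s : ℂ) (φ : ℝ) : Prop :=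
  Integrable fun p : ℝ × ℝ =>
    transIntegrand α H δ s₀ s φ (15 + p.1 * Complex.I) (eps + p.2 * Complex.I)

/-- The integrand of the dual moment. -/
def dualIntegrand (Φ : Mat3 → ℂ) (α : Fin 3 → ℂ) (H : ℂ → ℂ) (s : ℂ) (φ : ℝ) (s₀ : ℂ) : ℂ :=
  riemannZeta (2 * s - s₀) * stdL Φ α s₀ * (transF α H 1 s₀ s φ + transF α H (-1) s₀ s φ)

end DualMoment

end

/-!
The off-diagonal is computed term by term: Mellin-Barnes integrals for its two special functions
turn the `y`-integral of the `(a₀, a₁)`-th term into Mellin and beta integrals, and the sum over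
`a₀` and `a₁` into Dirichlet series.

**The Whittaker function.** `whittaker₃` is defined by continuing Jacquet's integral. If the two
complex powers in that integral are written as Euler integrals, two Gaussian integrations, a shear
and a third Gaussian integration lead to the Vinogradov-Takhtadzhyan integral
(`integral_jacquet_eq`). This integral converges for all parameters and is entire in the direction
of continuation, so that it represents `whittaker₃` by the identity theorem (`whittaker₃_eq`).
Inserting the Cahen-Mellin integral for `Γ_ℝ` twice gives the Mellin-Barnes integral
(`vtWhittaker_neg_eq`) with kernel `G_α`. Its absolute convergence needs no asymptotics of `Γ` beyond
exponential decay: four of the six gamma factors, together with the denominator, form an absolutely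
convergent integral that is largest on the real axis (`norm_vtKernel_le`).

**The test function.** `H^♭(y)` is `√y` times an integral of `exp(-2πy cosh v)` against the Fourier
transform of the density `μ sin(πμ) H(μ)`. Since the density vanishes at the integers, the moments of
this Fourier transform against powers of `cosh v` vanish. Hence `H^♭(y) = O(√y min(1, y^15))`
(`exists_norm_invKL_le`), and the Mellin transform of `H^♭` converges at `s - s₁ - 1/2` for
`Re s₁ = 15`.

**One term.** With the Mellin-Barnes integrals for `W_{-α}` and `e(x; φ)` inserted
(`odIntegrand_eq`), the modulus of the `y`-dependence is the same at all points of the lines of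
integration (`norm_odPhase`), so that the integrand has a product majorant and Fubini's theorem
applies (`integrable_superposition`). The `y₁`-integral is the Mellin transform of `H^♭`, the
`y₀`-integral is a beta integral (`integral_odPhase`), and replacing `s₀ - u` by `s₀`, which is a shear
of Lebesgue measure, gives the dual transform (`integral_odPhase_superposition`). The condition
`φ < π / 2` makes the `u`-integral absolutely convergent.

**The sum.** Conjugation by `diag(1, -1, -1)` shows that `B(1, -n) = B(1, n)`
(`fourierCoeff_neg_right`). Apart from these coefficients and powers of `|a₀|` and `|a₁|`, a term
depends only on the sign of `a₁ / a₀`, so that the double sum is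
`2 ζ(2s - s₀) L(s₀, Φ)` times the sum of the transforms for both signs (`tsum_dual_eq`).
-/

namespace DualMoment

noncomputable section

/-! ### Contour shifts and exponential variables -/

/-- The substitution `y = exp v`. In the variable `v` complex powers of `y` become exponentials of
linear functions, and changes of variables become shears of Lebesgue measure. -/
theorem integral_Ioi_eq_integral_exp {E : Type*} [NormedAddCommGroup E] [NormedSpace ℝ E]
    (f : ℝ → E) : ∫ y in Ioi (0 : ℝ), f y = ∫ v : ℝ, Real.exp v • f (Real.exp v) := by
  rw [← Real.range_exp, ← image_univ,
    integral_image_eq_integral_abs_deriv_smul MeasurableSet.univ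
      (fun x _ => (Real.hasDerivAt_exp x).hasDerivWithinAt) Real.exp_injective.injOn]
  simp

theorem integrableOn_Ioi_iff_integrable_exp {E : Type*} [NormedAddCommGroup E] [NormedSpace ℝ E]
    (f : ℝ → E) :
    IntegrableOn f (Ioi (0 : ℝ)) ↔ Integrable fun v : ℝ => Real.exp v • f (Real.exp v) := by
  rw [← Real.range_exp, ← image_univ,
    integrableOn_image_iff_integrableOn_abs_deriv_smul MeasurableSet.univ
      (fun x _ => (Real.hasDerivAt_exp x).hasDerivWithinAt) Real.exp_injective.injOn]
  simp

/-- Cauchy's theorem on an infinite horizontal strip. -/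
theorem integral_horizontal_shift {f : ℂ → ℂ} {a b : ℝ}
    (hf : DifferentiableOn ℂ f {z | z.im ∈ uIcc a b}) {g : ℝ → ℝ}
    (hg : ∀ x : ℝ, ∀ y ∈ uIcc a b, ‖f (x + y * Complex.I)‖ ≤ g x)
    (htop : Filter.Tendsto g Filter.atTop (nhds 0)) (hbot : Filter.Tendsto g Filter.atBot (nhds 0))
    (ha : Integrable fun x : ℝ => f (x + a * Complex.I))
    (hb : Integrable fun x : ℝ => f (x + b * Complex.I)) :
    ∫ x : ℝ, f (x + a * Complex.I) = ∫ x : ℝ, f (x + b * Complex.I) := by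
  have key : ∀ T : ℝ, (∫ x in (-T)..T, f (x + a * Complex.I)) - (∫ x in (-T)..T, f (x + b * Complex.I))
      = Complex.I * (∫ y in a..b, f ((-T : ℝ) + y * Complex.I)) -
        Complex.I * (∫ y in a..b, f (T + y * Complex.I)) := by
    intro T
    have := Complex.integral_boundary_rect_eq_zero_of_differentiableOn f
      ((-T : ℝ) + a * Complex.I) (T + b * Complex.I) (hf.mono (by
        rintro z ⟨_, hz⟩
        simpa using hz))
    simp only [Complex.add_re, Complex.ofReal_re, Complex.mul_re, Complex.I_re, mul_zero,
      Complex.ofReal_im, Complex.I_im, mul_one, sub_self, add_zero, Complex.add_im,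
      Complex.mul_im, zero_add, smul_eq_mul] at this
    linear_combination this
  have hedge : ∀ (l : Filter ℝ), Filter.Tendsto g l (nhds 0) →
      Filter.Tendsto (fun T : ℝ => ∫ y in a..b, f (T + y * Complex.I)) l (nhds 0) := by
    intro l hl
    rw [tendsto_zero_iff_norm_tendsto_zero]
    have h2 : Filter.Tendsto (fun T => g T * |b - a|) l (nhds 0) := by
      simpa using hl.mul_const |b - a|
    refine squeeze_zero (fun _ => norm_nonneg _) (fun T => ?_) h2
    exact intervalIntegral.norm_integral_le_of_norm_le_const fun y hy =>
      hg T y (uIoc_subset_uIcc hy)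
  have h1 := (intervalIntegral_tendsto_integral ha Filter.tendsto_neg_atTop_atBot
    Filter.tendsto_id).sub (intervalIntegral_tendsto_integral hb Filter.tendsto_neg_atTop_atBot
    Filter.tendsto_id)
  have h2 := (((hedge _ hbot).comp Filter.tendsto_neg_atTop_atBot).const_mul Complex.I).sub
    ((hedge _ htop).const_mul Complex.I)
  have h3 := tendsto_nhds_unique (h1.congr fun T => key T) (by simpa using h2)
  exact sub_eq_zero.1 h3

theorem integrable_exp_neg_mul_abs {c : ℝ} (hc : 0 < c) :
    Integrable fun t : ℝ => Real.exp (-c * |t|) := by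
  have h1 : IntegrableOn (fun t : ℝ => Real.exp (-c * |t|)) (Ioi 0) :=
    (integrableOn_exp_mul_Ioi (neg_lt_zero.2 hc) 0).congr_fun
      (fun t ht => by simp [abs_of_pos (mem_Ioi.1 ht)]) measurableSet_Ioi
  have h2 : IntegrableOn (fun t : ℝ => Real.exp (-c * |t|)) (Iic 0) :=
    (integrableOn_exp_mul_Iic hc 0).congr_fun
      (fun t ht => by simp [abs_of_nonpos (mem_Iic.1 ht)]) measurableSet_Iic
  have := h2.union h1
  rwa [Iic_union_Ioi, integrableOn_univ] at this

/-! ### Gamma and beta integrals -/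

theorem ofReal_exp_cpow (v : ℝ) (w : ℂ) :
    ((Real.exp v : ℝ) : ℂ) ^ w = Complex.exp (w * v) := by
  rw [Complex.cpow_def_of_ne_zero (by simp), Complex.ofReal_exp, Complex.log_exp]
  · ring_nf
  all_goals simp [Real.pi_pos, Real.pi_nonneg]

theorem ofReal_cpow_eq_exp {y : ℝ} (hy : 0 < y) (w : ℂ) :
    (y : ℂ) ^ w = Complex.exp (w * Real.log y) := by
  rw [← ofReal_exp_cpow, Real.exp_log hy]

/-- Euler's integral for `Γ(s) r^{-s}` after the substitution `y = exp v`. -/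
theorem integrable_Gamma_exp {s : ℂ} (hs : 0 < s.re) {r : ℝ} (hr : 0 < r) :
    Integrable fun v : ℝ => Complex.exp (s * v - r * Real.exp v) := by
  have h1 := (integrableOn_Ioi_iff_integrable_exp _).1 (Complex.GammaIntegral_convergent hs)
  have h2 : Integrable fun v : ℝ => Complex.exp (s * v - Real.exp v) := by
    refine h1.congr (ae_of_all _ fun v => ?_)
    simp only [Complex.real_smul]
    rw [ofReal_exp_cpow, Complex.ofReal_exp, Complex.ofReal_exp, ← Complex.exp_add,
      ← Complex.exp_add]
    push_cast; ring_nf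
  have h3 := (h2.comp_add_right (Real.log r)).const_mul (Complex.exp (-s * Real.log r))
  refine h3.congr (ae_of_all _ fun v => ?_)
  simp only
  rw [← Complex.exp_add, Real.exp_add, Real.exp_log hr]
  push_cast; ring_nf

theorem integral_Gamma_exp {s : ℂ} (hs : 0 < s.re) {r : ℝ} (hr : 0 < r) :
    ∫ v : ℝ, Complex.exp (s * v - r * Real.exp v) =
      Complex.exp (-s * Real.log r) * Complex.Gamma s := by
  have h2 : ∫ v : ℝ, Complex.exp (s * v - Real.exp v) = Complex.Gamma s := by
    rw [Complex.Gamma_eq_integral hs, Complex.GammaIntegral, integral_Ioi_eq_integral_exp]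
    refine integral_congr_ae (ae_of_all _ fun v => ?_)
    simp only [Complex.real_smul]
    rw [ofReal_exp_cpow, Complex.ofReal_exp, Complex.ofReal_exp, ← Complex.exp_add,
      ← Complex.exp_add]
    push_cast; ring_nf
  rw [← h2, ← integral_const_mul, ← integral_add_right_eq_self (fun v : ℝ =>
    Complex.exp (-s * Real.log r) * Complex.exp (s * v - Real.exp v)) (Real.log r)]
  refine integral_congr_ae (ae_of_all _ fun v => ?_)
  simp only
  rw [← Complex.exp_add, Real.exp_add, Real.exp_log hr]
  push_cast; ring_nf

theorem integrable_real_Gamma_exp {s : ℝ} (hs : 0 < s) {r : ℝ} (hr : 0 < r) :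
    Integrable fun v : ℝ => Real.exp (s * v - r * Real.exp v) := by
  have := (integrable_Gamma_exp (s := s) (by simpa using hs) hr).re
  refine this.congr (ae_of_all _ fun v => ?_)
  simp only [RCLike.re_to_complex]
  rw [← Complex.exp_ofReal_re (s * v - r * Real.exp v)]
  simp only [Complex.ofReal_sub, Complex.ofReal_mul]

theorem integral_real_Gamma_exp {s : ℝ} (hs : 0 < s) {r : ℝ} (hr : 0 < r) :
    ∫ v : ℝ, Real.exp (s * v - r * Real.exp v) = Real.exp (-s * Real.log r) * Real.Gamma s := by
  have := integral_Gamma_exp (s := s) (by simpa using hs) hr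
  rw [Complex.Gamma_ofReal] at this
  apply Complex.ofReal_injective
  rw [← integral_complex_ofReal]
  push_cast
  exact_mod_cast this

/-- Exponential decay of `Γ` on vertical lines: the ray of integration in Euler's integral is
rotated by the angle `φ`. -/
theorem norm_Gamma_le {s : ℂ} (hs : 0 < s.re) {φ : ℝ} (hφ : |φ| < π / 2) :
    ‖Complex.Gamma s‖ ≤
      Real.exp (-φ * s.im) * (Real.exp (-s.re * Real.log (Real.cos φ)) * Real.Gamma s.re) := by
  have hφ' := abs_lt.1 hφ
  have hcos : 0 < Real.cos φ := Real.cos_pos_of_mem_Ioo ⟨by linarith, by linarith⟩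
  have hre : ∀ x y : ℝ, ‖Complex.exp (s * (x + y * Complex.I) -
      Complex.exp (x + y * Complex.I))‖ =
      Real.exp (-y * s.im) * Real.exp (s.re * x - Real.cos y * Real.exp x) := by
    intro x y
    rw [Complex.norm_exp, ← Real.exp_add]
    simp [Complex.exp_re]
    ring
  have hint : ∀ y : ℝ, 0 < Real.cos y → Integrable fun x : ℝ =>
      Complex.exp (s * (x + y * Complex.I) - Complex.exp (x + y * Complex.I)) := by
    intro y hy
    refine ((integrable_real_Gamma_exp hs hy).const_mul (Real.exp (-y * s.im))).mono'
      (by fun_prop) (ae_of_all _ fun x => (hre x y).le)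
  have hlim : ∀ l : Filter ℝ, l = Filter.atTop ∨ l = Filter.atBot →
      Filter.Tendsto (fun x : ℝ => Real.exp (|φ| * |s.im|) *
        Real.exp (s.re * x - Real.cos φ * Real.exp x)) l (nhds 0) := by
    rintro l (rfl | rfl)
    · have := (tendsto_rpow_mul_exp_neg_mul_atTop_nhds_zero s.re (Real.cos φ) hcos).comp
        Real.tendsto_exp_atTop
      have := this.const_mul (Real.exp (|φ| * |s.im|))
      rw [mul_zero] at this
      refine this.congr fun x => ?_
      simp only [Function.comp]
      rw [Real.rpow_def_of_pos (Real.exp_pos x), Real.log_exp, ← Real.exp_add]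
      ring_nf
    · have h0 : Filter.Tendsto (fun x : ℝ => Real.exp (|φ| * |s.im|) * Real.exp (s.re * x))
          Filter.atBot (nhds 0) := by
        have := (Real.tendsto_exp_atBot.comp (Filter.tendsto_id.const_mul_atBot hs)).const_mul
          (Real.exp (|φ| * |s.im|))
        simpa using this
      refine squeeze_zero (fun _ => by positivity) (fun x => ?_) h0
      gcongr
      have := Real.exp_pos x
      nlinarith
  have hshift := integral_horizontal_shift (f := fun z => Complex.exp (s * z - Complex.exp z))
    (a := 0) (b := φ) (by fun_prop)
    (g := fun x => Real.exp (|φ| * |s.im|) * Real.exp (s.re * x - Real.cos φ * Real.exp x))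
    (by
      intro x y hy
      rw [hre]
      have hy' : |y| ≤ |φ| := by
        rcases le_total 0 φ with h | h
        · rw [uIcc_of_le h] at hy
          rw [abs_of_nonneg hy.1, abs_of_nonneg h]; exact hy.2
        · rw [uIcc_of_ge h] at hy
          rw [abs_of_nonpos hy.2, abs_of_nonpos h]; linarith [hy.1]
      have hc : Real.cos φ ≤ Real.cos y := by
        rw [← Real.cos_abs φ, ← Real.cos_abs y]
        exact Real.cos_le_cos_of_nonneg_of_le_pi (abs_nonneg _) (by linarith) hy'
      have h1 : -y * s.im ≤ |φ| * |s.im| := by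
        calc -y * s.im ≤ |-y * s.im| := le_abs_self _
          _ = |y| * |s.im| := by rw [abs_mul, abs_neg]
          _ ≤ _ := by gcongr
      gcongr) (hlim _ (Or.inl rfl)) (hlim _ (Or.inr rfl))
    (by simpa using hint 0 (by simp)) (hint φ hcos)
  have hG : Complex.Gamma s = ∫ x : ℝ, Complex.exp (s * (x + (0 : ℝ) * Complex.I) -
      Complex.exp (x + (0 : ℝ) * Complex.I)) := by
    have := integral_Gamma_exp hs one_pos
    simp only [Real.log_one, Complex.ofReal_zero, mul_zero, Complex.exp_zero, one_mul,
      Complex.ofReal_one] at this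
    rw [← this]
    simp
  rw [hG, hshift, ← integral_real_Gamma_exp hs hcos, ← integral_const_mul]
  refine (norm_integral_le_integral_norm _).trans (le_of_eq ?_)
  exact integral_congr_ae (ae_of_all _ fun x => hre x φ)

/-- The direction of the rotation in `norm_Gamma_le` is chosen according to the sign of `Im s`. -/
theorem norm_Gamma_le_abs {s : ℂ} (hs : 0 < s.re) {φ : ℝ} (hφ₀ : 0 ≤ φ) (hφ : φ < π / 2) :
    ‖Complex.Gamma s‖ ≤
      Real.exp (-φ * |s.im|) * (Real.exp (-s.re * Real.log (Real.cos φ)) * Real.Gamma s.re) := by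
  rcases le_total 0 s.im with h | h
  · rw [abs_of_nonneg h]
    exact norm_Gamma_le hs (by rwa [abs_of_nonneg hφ₀])
  · have := norm_Gamma_le hs (φ := -φ) (by rwa [abs_neg, abs_of_nonneg hφ₀])
    rw [abs_of_nonpos h]
    simpa using this

theorem norm_Gamma_le_Gamma_re {s : ℂ} (hs : 0 < s.re) :
    ‖Complex.Gamma s‖ ≤ Real.Gamma s.re := by
  simpa using norm_Gamma_le_abs hs le_rfl (by positivity)

theorem continuous_Gamma_line {σ : ℝ} (hσ : 0 < σ) :
    Continuous fun t : ℝ => Complex.Gamma (σ + t * Complex.I) := by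
  rw [continuous_iff_continuousAt]
  intro t
  refine ContinuousAt.comp (f := fun t : ℝ => (σ + t * Complex.I : ℂ)) ?_ (by fun_prop)
  refine (Complex.differentiableAt_Gamma _ fun m h => ?_).continuousAt
  have := congrArg Complex.re h
  simp at this
  have : (0 : ℝ) ≤ m := m.cast_nonneg
  linarith

/-- `Γ` decays like `exp(-ψ|t|)` for every `ψ < π / 2`; a factor `exp(φ|t|)` with `φ < π / 2` is
therefore harmless. This is what makes the perturbed exponential converge absolutely. -/
theorem integrable_norm_Gamma_mul_exp {σ : ℝ} (hσ : 0 < σ) {φ : ℝ} (hφ₀ : 0 ≤ φ)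
    (hφ : φ < π / 2) :
    Integrable fun t : ℝ => ‖Complex.Gamma (σ + t * Complex.I)‖ * Real.exp (φ * |t|) := by
  -- The angle of rotation lies strictly between `φ` and `π / 2`.
  set ψ := (φ + π / 2) / 2 with hψ
  have h := (integrable_exp_neg_mul_abs (c := ψ - φ) (by linarith)).mul_const
    (Real.exp (-σ * Real.log (Real.cos ψ)) * Real.Gamma σ)
  refine h.mono' ((continuous_Gamma_line hσ).norm.mul (by fun_prop)).aestronglyMeasurable
    (ae_of_all _ fun t => ?_)
  have h1 := norm_Gamma_le_abs (s := σ + t * Complex.I) (by simpa using hσ) (φ := ψ)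
    (by linarith) (by linarith)
  simp only [Complex.add_re, Complex.ofReal_re, Complex.mul_re, Complex.I_re, mul_zero,
    Complex.ofReal_im, Complex.I_im, mul_one, sub_self, add_zero, Complex.add_im,
    Complex.mul_im, zero_add] at h1
  rw [Real.norm_of_nonneg (by positivity)]
  calc _ ≤ (Real.exp (-ψ * |t|) * (Real.exp (-σ * Real.log (Real.cos ψ)) * Real.Gamma σ)) *
        Real.exp (φ * |t|) := by gcongr
    _ = Real.exp (-ψ * |t|) * Real.exp (φ * |t|) *
        (Real.exp (-σ * Real.log (Real.cos ψ)) * Real.Gamma σ) := by ring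
    _ = _ := by rw [← Real.exp_add]; ring_nf

theorem integrable_Gamma_line {σ : ℝ} (hσ : 0 < σ) :
    Integrable fun t : ℝ => Complex.Gamma (σ + t * Complex.I) := by
  have := integrable_norm_Gamma_mul_exp hσ le_rfl (by positivity)
  simp only [zero_mul, Real.exp_zero, mul_one] at this
  exact (integrable_norm_iff (continuous_Gamma_line hσ).aestronglyMeasurable).1 this

/-- The Cahen-Mellin integral. -/
theorem vint_Gamma_cpow {σ : ℝ} (hσ : 0 < σ) {X : ℝ} (hX : 0 < X) :
    vint σ (fun s => Complex.Gamma s * (X : ℂ) ^ (-s)) = Complex.exp (-X) := by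
  have hm : ∀ s : ℂ, 0 < s.re → mellin (fun x : ℝ => Complex.exp (-x)) s = Complex.Gamma s := by
    intro s hs
    rw [Complex.Gamma_eq_integral hs, Complex.GammaIntegral_eq_mellin]
    simp [Complex.ofReal_exp]
  have h := mellinInv_mellin_eq σ (fun x : ℝ => Complex.exp (-x)) hX (by
      have := Complex.GammaIntegral_convergent (s := σ) (by simpa using hσ)
      refine this.congr_fun (fun x _ => ?_) measurableSet_Ioi
      simp [mul_comm]) (by
      refine (integrable_Gamma_line hσ).congr (ae_of_all _ fun t => ?_)
      exact (hm _ (by simpa using hσ)).symm) (by fun_prop)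
  rw [← h, mellinInv, vint]
  simp only [one_div, Complex.real_smul, smul_eq_mul]
  push_cast
  congr 1
  refine integral_congr_ae (ae_of_all _ fun t => ?_)
  simp only
  rw [hm _ (by simpa using hσ), mul_comm]

/-- A shear along the last coordinate preserves Lebesgue measure. All multi-dimensional changes of
variables below are compositions of such shears and permutations of the coordinates. -/
theorem measurePreserving_shear {α : Type*} [MeasurableSpace α] {μ : Measure α} [SFinite μ]
    {g : α → ℝ} (hg : Measurable g) :
    MeasurePreserving (fun p : α × ℝ => (p.1, p.2 + g p.1)) (μ.prod volume) (μ.prod volume) :=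
  (MeasurePreserving.id μ).skew_product (g := fun a x => x + g a) (by fun_prop)
    (ae_of_all _ fun a => (measurePreserving_add_right volume (g a)).map_eq)

theorem integral_comp_measurePreserving {α β E : Type*} [MeasurableSpace α] [MeasurableSpace β]
    [NormedAddCommGroup E] [NormedSpace ℝ E] {μ : Measure α} {ν : Measure β} {T : α → β}
    (hT : MeasurePreserving T μ ν) {f : β → E} (hf : AEStronglyMeasurable f ν) :
    ∫ x, f (T x) ∂μ = ∫ y, f y ∂ν := by
  rw [← hT.map_eq] at hf ⊢
  rw [integral_map hT.aemeasurable hf]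

/-- The beta integral `∫ y^{a-1} (1 + y)^{-b} dy` in the variable `v = log y`. It is obtained from
`Γ(a) Γ(b - a)` by a shear of the two Euler integrals. -/
theorem integrable_exp_beta {a b : ℂ} (ha : 0 < a.re) (hb : a.re < b.re) :
    Integrable (fun v : ℝ => Complex.exp (a * v - b * Real.log (1 + Real.exp v))) ∧
    ∫ v : ℝ, Complex.exp (a * v - b * Real.log (1 + Real.exp v)) =
      Complex.Gamma a * Complex.Gamma (b - a) / Complex.Gamma b := by
  have hb0 : 0 < b.re := ha.trans hb
  have hba : 0 < (b - a).re := by simpa using hb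
  have hG : Integrable (fun p : ℝ × ℝ => Complex.exp ((b - a) * p.1 - (1 : ℝ) * Real.exp p.1) *
      Complex.exp (a * p.2 - (1 : ℝ) * Real.exp p.2)) (volume.prod volume) :=
    (integrable_Gamma_exp hba one_pos).mul_prod (integrable_Gamma_exp ha one_pos)
  have hmp := measurePreserving_shear (μ := (volume : Measure ℝ)) (g := fun w : ℝ => w) measurable_id
  have hF := hmp.integrable_comp_of_integrable hG
  have hI := integral_comp_measurePreserving hmp hG.1
  rw [integral_prod_mul (fun w : ℝ => Complex.exp ((b - a) * w - (1 : ℝ) * Real.exp w))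
      (fun w : ℝ => Complex.exp (a * w - (1 : ℝ) * Real.exp w)),
    integral_Gamma_exp hba one_pos, integral_Gamma_exp ha one_pos] at hI
  have hI := (integral_prod_symm _ hF).symm.trans hI
  have hin := hF.integral_prod_right
  have hinner : ∀ v : ℝ, (∫ w : ℝ, Complex.exp ((b - a) * w - (1 : ℝ) * Real.exp w) *
      Complex.exp (a * (v + w : ℝ) - (1 : ℝ) * Real.exp (v + w))) =
      Complex.exp (a * v - b * Real.log (1 + Real.exp v)) * Complex.Gamma b := by
    intro v
    have h1 : 0 < 1 + Real.exp v := by positivity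
    have := integral_Gamma_exp hb0 h1
    rw [sub_eq_add_neg (a * _), Complex.exp_add, mul_assoc, ← neg_mul, ← this, ← integral_const_mul]
    refine integral_congr_ae (ae_of_all _ fun w => ?_)
    simp only
    rw [← Complex.exp_add, ← Complex.exp_add, Real.exp_add]
    push_cast; ring_nf
  simp only [Function.comp, hinner] at hin hI
  have hΓ : Complex.Gamma b ≠ 0 := Complex.Gamma_ne_zero_of_re_pos hb0
  refine ⟨(integrable_mul_const_iff (IsUnit.mk0 _ hΓ) _).1 hin, ?_⟩
  rw [eq_div_iff hΓ, ← integral_mul_const, hI]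
  simp [mul_comm]

theorem integrable_real_exp_beta {a b : ℝ} (ha : 0 < a) (hb : a < b) :
    Integrable (fun v : ℝ => Real.exp (a * v - b * Real.log (1 + Real.exp v))) := by
  have := (integrable_exp_beta (a := a) (b := b) (by simpa using ha) (by simpa using hb)).1.re
  refine this.congr (ae_of_all _ fun v => ?_)
  simp only [RCLike.re_to_complex]
  rw [← Complex.exp_ofReal_re (a * v - b * Real.log (1 + Real.exp v))]
  simp only [Complex.ofReal_sub, Complex.ofReal_mul]

theorem Gammaℝ_eq_exp (z : ℂ) :
    Complex.Gammaℝ z = Complex.exp (-(z / 2) * Real.log π) * Complex.Gamma (z / 2) := by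
  rw [Complex.Gammaℝ_def, ofReal_cpow_eq_exp Real.pi_pos, neg_div]

theorem integrable_Gammaℝ_exp {s : ℂ} (hs : 0 < s.re) {r : ℝ} (hr : 0 < r) :
    Integrable fun v : ℝ => Complex.exp (s * v - (π * r : ℝ) * Real.exp v) :=
  integrable_Gamma_exp hs (by positivity)

theorem integral_Gammaℝ_exp {s : ℂ} (hs : 0 < s.re) {r : ℝ} (hr : 0 < r) :
    ∫ v : ℝ, Complex.exp (s * v - (π * r : ℝ) * Real.exp v) =
      Complex.exp (-s * Real.log r) * Complex.Gammaℝ (2 * s) := by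
  rw [integral_Gamma_exp hs (by positivity), Real.log_mul Real.pi_ne_zero hr.ne', Gammaℝ_eq_exp,
    ← mul_assoc, ← Complex.exp_add]
  push_cast
  ring_nf

theorem integral_cexp_gaussian {m : ℝ} (hm : 0 < m) (c d : ℂ) :
    ∫ w : ℝ, Complex.exp (-(π * m : ℝ) * (w : ℂ) ^ 2 + c * w + d) =
      Complex.exp (-(1 / 2) * Real.log m + d + c ^ 2 / (4 * π * m)) := by
  have h : (-((π * m : ℝ) : ℂ)).re < 0 := by
    simp only [Complex.neg_re, Complex.ofReal_re]
    have := Real.pi_pos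
    nlinarith [mul_pos this hm]
  rw [integral_cexp_quadratic h, neg_neg]
  have hm' : (m : ℂ) ≠ 0 := by exact_mod_cast hm.ne'
  have hpi : (π : ℂ) ≠ 0 := by exact_mod_cast Real.pi_ne_zero
  have h2 : (π : ℂ) / ((π * m : ℝ) : ℂ) = ((m⁻¹ : ℝ) : ℂ) := by
    push_cast
    field_simp
  rw [h2, ofReal_cpow_eq_exp (by positivity), Real.log_inv, ← Complex.exp_add]
  congr 1
  push_cast
  field_simp
  ring

/-! ### Jacquet's integral -/

/-- The squared length of the last row of `weyl * unip x z w * torus y₀ y₁`. -/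
def jacA (y₀ y₁ x z : ℝ) : ℝ := y₀ ^ 2 * (y₁ ^ 2 + x ^ 2) + z ^ 2

/-- The squared length of the cross product of the last two rows of
`weyl * unip x z w * torus y₀ y₁`, divided by `y₀ ^ 2`. -/
def jacB (y₀ y₁ x z w : ℝ) : ℝ := (x * w - z) ^ 2 + y₁ ^ 2 * w ^ 2 + y₀ ^ 2 * y₁ ^ 2

theorem jacA_pos {y₀ y₁ : ℝ} (h₀ : 0 < y₀) (h₁ : 0 < y₁) (x z : ℝ) : 0 < jacA y₀ y₁ x z := by
  unfold jacA; positivity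

theorem jacB_pos {y₀ y₁ : ℝ} (h₀ : 0 < y₀) (h₁ : 0 < y₁) (x z w : ℝ) :
    0 < jacB y₀ y₁ x z w := by
  unfold jacB; positivity

/-- The integrand of Jacquet's integral is a product of powers of `jacA` and `jacB`. -/
theorem powerFn_weyl {α : Fin 3 → ℂ} (hα : α 0 + α 1 + α 2 = 0) {y₀ y₁ : ℝ} (h₀ : 0 < y₀)
    (h₁ : 0 < y₁) (x z w : ℝ) :
    powerFn α (weyl * unip x z w * torus y₀ y₁) =
      Complex.exp ((1 - α 2) * Real.log y₀ + (1 + α 0) * Real.log y₁) *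
      (Complex.exp (-((1 + α 1 - α 2) / 2) * Real.log (jacA y₀ y₁ x z)) *
        Complex.exp (-((1 + α 0 - α 1) / 2) * Real.log (jacB y₀ y₁ x z w))) := by
  have hA := jacA_pos h₀ h₁ x z
  have hB := jacB_pos h₀ h₁ x z w
  set g := weyl * unip x z w * torus y₀ y₁ with hg
  have hg' : g = !![0, 0, 1; 0, -y₀, -w; y₀ * y₁, x * y₀, z] := by
    ext i j
    fin_cases i <;> fin_cases j <;>
      simp [hg, weyl, unip, torus]
  have hlen2 : len (g 2) = Real.sqrt (jacA y₀ y₁ x z) := by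
    rw [len]
    congr 1
    simp [hg', dotProduct, Fin.sum_univ_three, jacA]
    ring
  have hlen12 : len (g 1 ⨯₃ g 2) = Real.sqrt (y₀ ^ 2 * jacB y₀ y₁ x z w) := by
    rw [len]
    congr 1
    simp [hg', dotProduct, Fin.sum_univ_three, jacB, crossProduct]
    ring
  have hdet : |g.det| = y₀ ^ 2 * y₁ := by
    rw [hg', Matrix.det_fin_three]
    simp
    rw [abs_of_pos h₀, abs_of_pos h₁]
    ring
  have hY0 : iwY₀ g = Real.exp (Real.log y₀ + 1 / 2 * Real.log (jacB y₀ y₁ x z w) -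
      Real.log (jacA y₀ y₁ x z)) := by
    rw [iwY₀, hlen2, hlen12, Real.sq_sqrt hA.le, Real.exp_sub, Real.exp_add, Real.exp_log hA,
      Real.exp_log h₀, Real.sqrt_mul (by positivity), Real.sqrt_sq h₀.le,
      Real.sqrt_eq_rpow, Real.rpow_def_of_pos hB]
    ring_nf
  have hY1 : iwY₁ g = Real.exp (Real.log y₁ + 1 / 2 * Real.log (jacA y₀ y₁ x z) -
      Real.log (jacB y₀ y₁ x z w)) := by
    rw [iwY₁, hlen2, hlen12, hdet, Real.sq_sqrt (by positivity), Real.exp_sub, Real.exp_add,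
      Real.exp_log hB, Real.exp_log h₁, Real.sqrt_eq_rpow, Real.rpow_def_of_pos hA]
    field_simp
  have hα1 : α 1 = -α 0 - α 2 := by linear_combination hα
  rw [powerFn, hY0, hY1, ofReal_exp_cpow, ofReal_exp_cpow, ← Complex.exp_add, ← Complex.exp_add,
    ← Complex.exp_add, hα1]
  congr 1
  push_cast
  ring

theorem integrable_exp_neg_log_one_add_sq {p : ℝ} (hp : 1 < 2 * p) :
    Integrable fun x : ℝ => Real.exp (-p * Real.log (1 + x ^ 2)) := by
  have := integrable_rpow_neg_one_add_norm_sq (E := ℝ) (μ := volume) (r := 2 * p) (by simpa using hp)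
  refine this.congr (ae_of_all _ fun x => ?_)
  simp only [Real.norm_eq_abs, sq_abs]
  rw [Real.rpow_def_of_pos (by positivity)]
  ring_nf

/-- `jacA` is at least a constant times `1 + x² + z²`, hence times `((1 + x²) (1 + z²))^{1/2}`. -/
theorem log_jacA_ge {y₀ y₁ : ℝ} (h₀ : 0 < y₀) (h₁ : 0 < y₁) :
    ∃ C : ℝ, ∀ x z : ℝ, C + 1 / 2 * Real.log (1 + x ^ 2) + 1 / 2 * Real.log (1 + z ^ 2) ≤
      Real.log (jacA y₀ y₁ x z) := by
  set m := min (y₀ ^ 2 * y₁ ^ 2) (min (y₀ ^ 2) 1) with hm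
  have hm0 : 0 < m := by simp only [hm, lt_min_iff]; refine ⟨by positivity, by positivity, one_pos⟩
  have hm1 : m ≤ y₀ ^ 2 * y₁ ^ 2 := min_le_left _ _
  have hm2 : m ≤ y₀ ^ 2 := (min_le_right _ _).trans (min_le_left _ _)
  have hm3 : m ≤ 1 := (min_le_right _ _).trans (min_le_right _ _)
  refine ⟨Real.log m, fun x z => ?_⟩
  have h1 : m * (1 + x ^ 2 + z ^ 2) ≤ jacA y₀ y₁ x z := by
    unfold jacA
    nlinarith [mul_le_mul_of_nonneg_right hm2 (sq_nonneg x),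
      mul_le_mul_of_nonneg_right hm3 (sq_nonneg z)]
  have h2 : Real.log (1 + x ^ 2) + Real.log (1 + z ^ 2) ≤ 2 * Real.log (1 + x ^ 2 + z ^ 2) := by
    rw [← Real.log_mul (by positivity) (by positivity)]
    have : Real.log ((1 + x ^ 2 + z ^ 2) ^ 2) = 2 * Real.log (1 + x ^ 2 + z ^ 2) := by
      rw [Real.log_pow]; norm_num
    rw [← this]
    apply Real.log_le_log (by positivity)
    nlinarith [sq_nonneg x, sq_nonneg z, sq_nonneg (x * z), sq_nonneg (x ^ 2), sq_nonneg (z ^ 2)]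
  have h3 := Real.log_le_log (by positivity) h1
  rw [Real.log_mul hm0.ne' (by positivity)] at h3
  linarith

/-- `jacB` is at least a constant times `1 + w²`. -/
theorem log_jacB_ge {y₀ y₁ : ℝ} (h₀ : 0 < y₀) (h₁ : 0 < y₁) :
    ∃ C : ℝ, ∀ x z w : ℝ, C + Real.log (1 + w ^ 2) ≤ Real.log (jacB y₀ y₁ x z w) := by
  set m := min (y₀ ^ 2 * y₁ ^ 2) (y₁ ^ 2) with hm
  have hm0 : 0 < m := by simp only [hm, lt_min_iff]; refine ⟨by positivity, by positivity⟩
  have hm1 : m ≤ y₀ ^ 2 * y₁ ^ 2 := min_le_left _ _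
  have hm2 : m ≤ y₁ ^ 2 := min_le_right _ _
  refine ⟨Real.log m, fun x z w => ?_⟩
  have h1 : m * (1 + w ^ 2) ≤ jacB y₀ y₁ x z w := by
    unfold jacB
    nlinarith [mul_le_mul_of_nonneg_right hm2 (sq_nonneg w), sq_nonneg (x * w - z)]
  rw [← Real.log_mul hm0.ne' (by positivity)]
  exact Real.log_le_log (by positivity) h1

/-- Absolute convergence of Jacquet's integral. The lower bounds used for `jacA` and `jacB` are far
from sharp, but a half-plane of convergence suffices for the analytic continuation. -/
theorem integrable_jacquet_real {p q : ℝ} (hp : 1 < p) (hq : 1 < q) {y₀ y₁ : ℝ} (h₀ : 0 < y₀)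
    (h₁ : 0 < y₁) :
    Integrable fun u : ℝ × ℝ × ℝ => Real.exp (-p * Real.log (jacA y₀ y₁ u.1 u.2.1)) *
      Real.exp (-q * Real.log (jacB y₀ y₁ u.1 u.2.1 u.2.2)) := by
  obtain ⟨C, hC⟩ := log_jacA_ge h₀ h₁
  obtain ⟨D, hD⟩ := log_jacB_ge h₀ h₁
  have hf := integrable_exp_neg_log_one_add_sq (p := p / 2) (by linarith)
  have hg := integrable_exp_neg_log_one_add_sq (p := q) (by linarith)
  have hmaj := (hf.mul_prod (hf.mul_prod hg)).const_mul (Real.exp (-p * C) * Real.exp (-q * D))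
  refine hmaj.mono' ?_ (ae_of_all _ fun u => ?_)
  · refine Measurable.aestronglyMeasurable ?_
    unfold jacA jacB
    fun_prop
  · rw [Real.norm_of_nonneg (by positivity), ← Real.exp_add, ← Real.exp_add, ← Real.exp_add,
      ← Real.exp_add, ← Real.exp_add, Real.exp_le_exp]
    nlinarith [mul_le_mul_of_nonneg_left (hC u.1 u.2.1) (by linarith : 0 ≤ p),
      mul_le_mul_of_nonneg_left (hD u.1 u.2.1 u.2.2) (by linarith : 0 ≤ q)]

/-- The integrand obtained from Jacquet's integral by writing both complex powers as Euler
integrals, at `((x, z, w), (a, b))`. -/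
def jacKer (p q : ℂ) (y₀ y₁ : ℝ) (t : (ℝ × ℝ × ℝ) × ℝ × ℝ) : ℂ :=
  Complex.exp (p * t.2.1 - (π * jacA y₀ y₁ t.1.1 t.1.2.1 : ℝ) * Real.exp t.2.1) *
    Complex.exp (q * t.2.2 - (π * jacB y₀ y₁ t.1.1 t.1.2.1 t.1.2.2 : ℝ) * Real.exp t.2.2) *
    e (-t.1.1 - t.1.2.2)

theorem norm_e (x : ℝ) : ‖e x‖ = 1 := by
  rw [e, Complex.norm_exp]
  simp

theorem continuous_jacKer (p q : ℂ) (y₀ y₁ : ℝ) : Continuous (jacKer p q y₀ y₁) := by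
  unfold jacKer jacA jacB e
  fun_prop

theorem norm_jacKer (p q : ℂ) (y₀ y₁ : ℝ) (u : ℝ × ℝ × ℝ) (v : ℝ × ℝ) :
    ‖jacKer p q y₀ y₁ (u, v)‖ =
      Real.exp (p.re * v.1 - (π * jacA y₀ y₁ u.1 u.2.1) * Real.exp v.1) *
      Real.exp (q.re * v.2 - (π * jacB y₀ y₁ u.1 u.2.1 u.2.2) * Real.exp v.2) := by
  rw [jacKer, norm_mul, norm_mul, norm_e, mul_one, Complex.norm_exp, Complex.norm_exp]
  simp only [Complex.sub_re, Complex.mul_re, Complex.ofReal_re, Complex.ofReal_im, mul_zero,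
    sub_zero]

theorem integrable_jacKer {p q : ℂ} (hp : 1 < p.re) (hq : 1 < q.re) {y₀ y₁ : ℝ} (h₀ : 0 < y₀)
    (h₁ : 0 < y₁) : Integrable (jacKer p q y₀ y₁) := by
  have hp0 : 0 < p.re := by linarith
  have hq0 : 0 < q.re := by linarith
  refine (integrable_prod_iff (continuous_jacKer p q y₀ y₁).aestronglyMeasurable).2
    ⟨ae_of_all _ fun u => ?_, ?_⟩
  · exact ((integrable_Gammaℝ_exp hp0 (jacA_pos h₀ h₁ u.1 u.2.1)).mul_prod
      (integrable_Gammaℝ_exp hq0 (jacB_pos h₀ h₁ u.1 u.2.1 u.2.2))).mul_const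
        (e (-u.1 - u.2.2))
  · refine ((integrable_jacquet_real hp hq h₀ h₁).const_mul
      (Real.exp (-p.re * Real.log π) * Real.Gamma p.re *
        (Real.exp (-q.re * Real.log π) * Real.Gamma q.re))).congr (ae_of_all _ fun u => ?_)
    have hA := jacA_pos h₀ h₁ u.1 u.2.1
    have hB := jacB_pos h₀ h₁ u.1 u.2.1 u.2.2
    simp only [norm_jacKer]
    rw [show (volume : Measure (ℝ × ℝ)) = volume.prod volume from rfl,
      integral_prod_mul (fun v : ℝ => Real.exp (p.re * v - (π * jacA y₀ y₁ u.1 u.2.1) * Real.exp v))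
      (fun v : ℝ => Real.exp (q.re * v - (π * jacB y₀ y₁ u.1 u.2.1 u.2.2) * Real.exp v)),
      integral_real_Gamma_exp hp0 (by positivity),
      integral_real_Gamma_exp hq0 (by positivity),
      Real.log_mul Real.pi_ne_zero hA.ne', Real.log_mul Real.pi_ne_zero hB.ne', mul_add, mul_add,
      Real.exp_add, Real.exp_add]
    ring

theorem integral_jacKer {p q : ℂ} (hp : 1 < p.re) (hq : 1 < q.re) {y₀ y₁ : ℝ} (h₀ : 0 < y₀)
    (h₁ : 0 < y₁) : ∫ t, jacKer p q y₀ y₁ t =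
      Complex.Gammaℝ (2 * p) * Complex.Gammaℝ (2 * q) *
      ∫ u : ℝ × ℝ × ℝ, Complex.exp (-p * Real.log (jacA y₀ y₁ u.1 u.2.1)) *
        Complex.exp (-q * Real.log (jacB y₀ y₁ u.1 u.2.1 u.2.2)) * e (-u.1 - u.2.2) := by
  have hp0 : 0 < p.re := by linarith
  have hq0 : 0 < q.re := by linarith
  have h := integral_prod _ (integrable_jacKer hp hq h₀ h₁)
  refine h.trans ?_
  rw [← integral_const_mul]
  refine integral_congr_ae (ae_of_all _ fun u => ?_)
  simp only [jacKer]
  rw [integral_mul_const, show (volume : Measure (ℝ × ℝ)) = volume.prod volume from rfl,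
    integral_prod_mul (fun v : ℝ => Complex.exp (p * v - (π * jacA y₀ y₁ u.1 u.2.1 : ℝ) * Real.exp v))
      (fun v : ℝ => Complex.exp (q * v - (π * jacB y₀ y₁ u.1 u.2.1 u.2.2 : ℝ) * Real.exp v)),
    integral_Gammaℝ_exp hp0 (jacA_pos h₀ h₁ _ _),
    integral_Gammaℝ_exp hq0 (jacB_pos h₀ h₁ _ _ _)]
  ring

/-- The result of the two Gaussian integrations in `jacKer`, at `x` and `(a, b)`. -/
def gaussKer (p q : ℂ) (y₀ y₁ x : ℝ) (v : ℝ × ℝ) : ℂ :=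
  Complex.exp (p * v.1 + q * v.2 - 1 / 2 * (v.2 + Real.log (x ^ 2 + y₁ ^ 2)) -
    1 / 2 * Real.log (Real.exp v.1 + Real.exp v.2 * y₁ ^ 2 / (x ^ 2 + y₁ ^ 2)) -
    π * (y₀ ^ 2 * (x ^ 2 + y₁ ^ 2) *
        (Real.exp v.1 + Real.exp v.2 * y₁ ^ 2 / (x ^ 2 + y₁ ^ 2)) +
      1 / (Real.exp v.2 * (x ^ 2 + y₁ ^ 2)) +
      x ^ 2 / ((x ^ 2 + y₁ ^ 2) ^ 2 *
        (Real.exp v.1 + Real.exp v.2 * y₁ ^ 2 / (x ^ 2 + y₁ ^ 2)))) -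
    2 * π * Complex.I * x)

theorem integral_gaussian_jacKer (p q : ℂ) {y₀ y₁ : ℝ} (h₁ : 0 < y₁) (x a b : ℝ) :
    ∫ z : ℝ, ∫ w : ℝ, jacKer p q y₀ y₁ ((x, z, w), (a, b)) = gaussKer p q y₀ y₁ x (a, b) := by
  have hR : 0 < x ^ 2 + y₁ ^ 2 := by positivity
  have hC : 0 < Real.exp a + Real.exp b * y₁ ^ 2 / (x ^ 2 + y₁ ^ 2) := by positivity
  have hm : 0 < Real.exp b * (x ^ 2 + y₁ ^ 2) := by positivity
  have hRc : ((x : ℂ) ^ 2 + (y₁ : ℂ) ^ 2) ≠ 0 := by exact_mod_cast hR.ne'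
  have hbc : ((Real.exp b : ℝ) : ℂ) ≠ 0 := by exact_mod_cast (Real.exp_pos b).ne'
  have hpi : (π : ℂ) ≠ 0 := by exact_mod_cast Real.pi_ne_zero
  have hI : Complex.I ^ 2 = -1 := Complex.I_sq
  have hw : ∀ z : ℝ, ∫ w : ℝ, jacKer p q y₀ y₁ ((x, z, w), (a, b)) =
      Complex.exp (-(π * (Real.exp a + Real.exp b * y₁ ^ 2 / (x ^ 2 + y₁ ^ 2)) : ℝ) * (z : ℂ) ^ 2 +
        (-2 * π * Complex.I * x / (x ^ 2 + y₁ ^ 2)) * z +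
        (p * a + q * b - 1 / 2 * (b + Real.log (x ^ 2 + y₁ ^ 2)) -
          π * (y₀ ^ 2 * (x ^ 2 + y₁ ^ 2) * Real.exp a + Real.exp b * y₀ ^ 2 * y₁ ^ 2 +
            1 / (Real.exp b * (x ^ 2 + y₁ ^ 2))) - 2 * π * Complex.I * x)) := by
    intro z
    have h := integral_cexp_gaussian hm (2 * π * (Real.exp b * x * z - Complex.I))
      (p * a + q * b - π * (jacA y₀ y₁ x z * Real.exp a + Real.exp b * (z ^ 2 + y₀ ^ 2 * y₁ ^ 2)) -
        2 * π * Complex.I * x)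
    rw [Real.log_mul (Real.exp_ne_zero b) hR.ne', Real.log_exp] at h
    refine (integral_congr_ae (ae_of_all _ fun w => ?_)).trans (h.trans ?_)
    · simp only [jacKer, e, ← Complex.exp_add, jacA, jacB]
      congr 1
      push_cast
      ring
    · congr 1
      simp only [jacA]
      push_cast [-Complex.ofReal_exp]
      field_simp
      ring_nf
      simp only [hI]
      ring_nf
  simp only [hw]
  have hCc : ((Real.exp a : ℝ) : ℂ) + ((Real.exp b : ℝ) : ℂ) * y₁ ^ 2 / (x ^ 2 + y₁ ^ 2) ≠ 0 := by
    exact_mod_cast hC.ne'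
  rw [integral_cexp_gaussian hC, gaussKer]
  congr 1
  push_cast [-Complex.ofReal_exp]
  set D := ((Real.exp a : ℝ) : ℂ) + ((Real.exp b : ℝ) : ℂ) * y₁ ^ 2 / (x ^ 2 + y₁ ^ 2) with hD
  have hEa : ((Real.exp a : ℝ) : ℂ) = D - ((Real.exp b : ℝ) : ℂ) * y₁ ^ 2 / (x ^ 2 + y₁ ^ 2) := by
    rw [hD]; ring
  rw [hEa]
  field_simp
  ring_nf
  simp only [hI]
  ring_nf

/-- `jacKer` after the Gaussian integrations, in coordinates in which it is an exponential of
a simple function, at `x` and `(k, c)`. -/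
def shearKer (p q : ℂ) (y₀ y₁ x : ℝ) (v : ℝ × ℝ) : ℂ :=
  Complex.exp ((p + q - 1) * v.2 + (q - 1 / 2) * v.1 -
    (π * ((1 + Real.exp (-v.1)) * Real.exp (-v.2) + y₀ ^ 2 * Real.exp v.2) : ℝ)) *
    (Complex.exp (-(p + q - 1 / 2) * Real.log (x ^ 2 + y₁ ^ 2 * (1 + Real.exp v.1))) * e (-x))

/-- The shear `a = c - log (x² + y₁² (1 + exp k))`, `b = k + a` removes `x` from the exponent of
`gaussKer`, up to one power of `x² + y₁² (1 + exp k)`. -/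
theorem gaussKer_shear (p q : ℂ) {y₀ y₁ : ℝ} (h₁ : 0 < y₁) (x k c : ℝ) :
    gaussKer p q y₀ y₁ x (c - Real.log (x ^ 2 + y₁ ^ 2 * (1 + Real.exp k)),
      k + (c - Real.log (x ^ 2 + y₁ ^ 2 * (1 + Real.exp k)))) =
      shearKer p q y₀ y₁ x (k, c) := by
  have hR : 0 < x ^ 2 + y₁ ^ 2 := by positivity
  have hS : 0 < x ^ 2 + y₁ ^ 2 * (1 + Real.exp k) := by positivity
  have hC : Real.exp (c - Real.log (x ^ 2 + y₁ ^ 2 * (1 + Real.exp k))) +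
      Real.exp (k + (c - Real.log (x ^ 2 + y₁ ^ 2 * (1 + Real.exp k)))) * y₁ ^ 2 /
        (x ^ 2 + y₁ ^ 2) = Real.exp c / (x ^ 2 + y₁ ^ 2) := by
    rw [Real.exp_add, Real.exp_sub, Real.exp_log hS]
    field_simp
    ring
  have hmain : y₀ ^ 2 * (x ^ 2 + y₁ ^ 2) * (Real.exp c / (x ^ 2 + y₁ ^ 2)) +
      1 / (Real.exp (k + (c - Real.log (x ^ 2 + y₁ ^ 2 * (1 + Real.exp k)))) * (x ^ 2 + y₁ ^ 2)) +
      x ^ 2 / ((x ^ 2 + y₁ ^ 2) ^ 2 * (Real.exp c / (x ^ 2 + y₁ ^ 2))) =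
      (1 + Real.exp (-k)) * Real.exp (-c) + y₀ ^ 2 * Real.exp c := by
    rw [Real.exp_add, Real.exp_sub, Real.exp_log hS, Real.exp_neg, Real.exp_neg]
    field_simp
    ring
  have hmain' := congrArg (fun r : ℝ => (r : ℂ)) hmain
  have hC' := congrArg (fun r : ℝ => (r : ℂ)) hC
  simp only [Complex.ofReal_add, Complex.ofReal_mul, Complex.ofReal_div, Complex.ofReal_pow,
    Complex.ofReal_one] at hmain' hC'
  simp only [gaussKer, shearKer, e, ← Complex.exp_add]
  rw [hC', hmain', hC, Real.log_div (Real.exp_ne_zero c) hR.ne', Real.log_exp]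
  congr 1
  push_cast
  ring

/-- The change of variables of `gaussKer_shear` preserves Lebesgue measure. -/
theorem measurePreserving_gaussShear (x y₁ : ℝ) :
    MeasurePreserving (fun v : ℝ × ℝ =>
      ((v.2 - Real.log (x ^ 2 + y₁ ^ 2 * (1 + Real.exp v.1)),
        v.1 + (v.2 - Real.log (x ^ 2 + y₁ ^ 2 * (1 + Real.exp v.1)))) : ℝ × ℝ)) := by
  have h1 := measurePreserving_shear (μ := (volume : Measure ℝ))
    (g := fun k : ℝ => -Real.log (x ^ 2 + y₁ ^ 2 * (1 + Real.exp k))) (by fun_prop)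
  have h2 : MeasurePreserving (Prod.swap : ℝ × ℝ → ℝ × ℝ) (volume.prod volume)
    (volume.prod volume) := Measure.measurePreserving_swap
  have h3 := measurePreserving_shear (μ := (volume : Measure ℝ)) (g := fun k : ℝ => k) measurable_id
  exact h3.comp (h2.comp h1)

/-- For fixed `x`, the integral of `jacKer` over `(z, w)` and `(a, b)`. -/
theorem integral_jacKer_fibre (p q : ℂ) {y₀ y₁ : ℝ} (h₁ : 0 < y₁) {x : ℝ}
    (h : Integrable fun t : (ℝ × ℝ) × ℝ × ℝ => jacKer p q y₀ y₁ ((x, t.1), t.2)) :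
    ∫ t : (ℝ × ℝ) × ℝ × ℝ, jacKer p q y₀ y₁ ((x, t.1), t.2) =
      ∫ v : ℝ × ℝ, shearKer p q y₀ y₁ x v := by
  have h1 := integral_prod_symm _ h
  have h2 := h.integral_prod_right
  have h3 : ∀ᵐ v : ℝ × ℝ, ∫ u : ℝ × ℝ, jacKer p q y₀ y₁ ((x, u), v) =
      gaussKer p q y₀ y₁ x v := by
    filter_upwards [h.prod_left_ae] with v hv
    refine (integral_prod _ hv).trans ?_
    exact integral_gaussian_jacKer p q h₁ x v.1 v.2
  have h4 : Integrable (gaussKer p q y₀ y₁ x) := h2.congr h3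
  refine h1.trans ((integral_congr_ae h3).trans ?_)
  rw [← integral_comp_measurePreserving (measurePreserving_gaussShear x y₁) h4.1]
  exact integral_congr_ae (ae_of_all _ fun v => gaussKer_shear p q h₁ x v.1 v.2)

/-- The integrand of the Vinogradov-Takhtadzhyan integral for the Whittaker function in
exponential coordinates, at `((k, c), d)`. Integrating over `c` and `d` gives a product of two
`K`-Bessel functions. -/
def whitKer (ν μ : ℂ) (y₀ y₁ : ℝ) (t : (ℝ × ℝ) × ℝ) : ℂ :=
  Complex.exp (ν * (t.1.2 + t.2) + μ * t.1.1 -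
    (π * ((1 + Real.exp (-t.1.1)) * Real.exp (-t.1.2) + y₀ ^ 2 * Real.exp t.1.2 +
      y₁ ^ 2 * (1 + Real.exp t.1.1) * Real.exp t.2 + Real.exp (-t.2)) : ℝ))

/-- The integrand that links `shearKer` and `whitKer`, at `((k, c), d)` and `x`. -/
def linkKer (p q : ℂ) (y₀ y₁ : ℝ) (t : ((ℝ × ℝ) × ℝ) × ℝ) : ℂ :=
  Complex.exp ((p + q - 1) * t.1.1.2 + (q - 1 / 2) * t.1.1.1 -
    (π * ((1 + Real.exp (-t.1.1.1)) * Real.exp (-t.1.1.2) + y₀ ^ 2 * Real.exp t.1.1.2) : ℝ)) *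
    (Complex.exp ((p + q - 1 / 2) * t.1.2 -
      (π * (t.2 ^ 2 + y₁ ^ 2 * (1 + Real.exp t.1.1.1)) : ℝ) * Real.exp t.1.2) * e (-t.2))

theorem continuous_linkKer (p q : ℂ) (y₀ y₁ : ℝ) : Continuous (linkKer p q y₀ y₁) := by
  unfold linkKer e
  fun_prop

theorem norm_linkKer (p q : ℂ) (y₀ y₁ : ℝ) (t : (ℝ × ℝ) × ℝ) (x : ℝ) :
    ‖linkKer p q y₀ y₁ (t, x)‖ =
      Real.exp ((p.re + q.re - 1) * t.1.2 + (q.re - 1 / 2) * t.1.1 -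
        π * ((1 + Real.exp (-t.1.1)) * Real.exp (-t.1.2) + y₀ ^ 2 * Real.exp t.1.2)) *
      (Real.exp ((p.re + q.re - 1 / 2) * t.2 -
        (π * (y₁ ^ 2 * (1 + Real.exp t.1.1))) * Real.exp t.2) *
        Real.exp (-(π * Real.exp t.2) * x ^ 2)) := by
  rw [linkKer, norm_mul, norm_mul, norm_e, mul_one, Complex.norm_exp, Complex.norm_exp,
    ← Real.exp_add (_ - _) (_ * x ^ 2)]
  have h : (1 / 2 : ℂ) = ((1 / 2 : ℝ) : ℂ) := by push_cast; rfl
  congr 2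
  · rw [h]
    simp only [Complex.sub_re, Complex.add_re, Complex.re_mul_ofReal, Complex.ofReal_re,
      Complex.one_re]
  · rw [h]
    simp only [Complex.sub_re, Complex.add_re, Complex.re_mul_ofReal, Complex.ofReal_re]
    ring

/-- The integral over `x` is Gaussian; what remains is bounded by a beta integral in `k` and gamma
integrals in `c` and `d`, after the shear `d ↦ d + log (1 + exp k)`. -/
theorem integrable_linkKer {p q : ℂ} (hp : 1 < p.re) (hq : 1 < q.re) {y₀ y₁ : ℝ} (h₀ : 0 < y₀)
    (h₁ : 0 < y₁) : Integrable (linkKer p q y₀ y₁) := by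
  have hν : 0 < p.re + q.re - 1 := by linarith
  refine (integrable_prod_iff (continuous_linkKer p q y₀ y₁).aestronglyMeasurable).2
    ⟨ae_of_all _ fun t => ?_, ?_⟩
  · refine (integrable_norm_iff ((continuous_linkKer p q y₀ y₁).comp
      (by fun_prop : Continuous fun x : ℝ => (t, x))).aestronglyMeasurable).1 ?_
    simp only [Function.comp, norm_linkKer]
    exact ((integrable_exp_neg_mul_sq (by positivity)).const_mul _).const_mul _
  · have hg : Integrable (fun t : (ℝ × ℝ) × ℝ =>
        Real.exp ((p.re + q.re - 1) * t.1.2 - π * y₀ ^ 2 * Real.exp t.1.2) *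
        Real.exp ((q.re - 1 / 2) * t.1.1 - (p.re + q.re - 1) * Real.log (1 + Real.exp t.1.1)) *
        Real.exp ((p.re + q.re - 1) * t.2 - π * y₁ ^ 2 * Real.exp t.2)) := by
      have hk := integrable_real_exp_beta (a := q.re - 1 / 2) (b := p.re + q.re - 1) (by linarith)
        (by linarith)
      have hc := integrable_real_Gamma_exp hν (r := π * y₀ ^ 2) (by positivity)
      have hd := integrable_real_Gamma_exp hν (r := π * y₁ ^ 2) (by positivity)
      refine ((hk.mul_prod hc).mul_prod hd).congr (ae_of_all _ fun t => ?_)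
      simp only
      ring
    have hsh := measurePreserving_shear (μ := (volume : Measure (ℝ × ℝ)))
      (g := fun v : ℝ × ℝ => Real.log (1 + Real.exp v.1)) (by fun_prop)
    have hg' := hsh.integrable_comp_of_integrable hg
    refine hg'.mono' ?_ (ae_of_all _ fun t => ?_)
    · exact ((continuous_linkKer p q y₀ y₁).norm.aestronglyMeasurable).integral_prod_right'
    · simp only [norm_linkKer]
      rw [integral_const_mul, integral_const_mul, integral_gaussian, Real.norm_of_nonneg (by positivity)]
      have hs : Real.sqrt (π / (π * Real.exp t.2)) = Real.exp (-(1 / 2) * t.2) := by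
        rw [Real.sqrt_eq_rpow, Real.rpow_def_of_pos (by positivity), ← div_div,
          div_self Real.pi_ne_zero, one_div, ← Real.exp_neg, Real.log_exp]
        ring_nf
      rw [hs]
      simp only [Function.comp, ← Real.exp_add, Real.exp_le_exp]
      rw [Real.exp_add t.2, Real.exp_log (by positivity)]
      have : 0 ≤ π * ((1 + Real.exp (-t.1.1)) * Real.exp (-t.1.2)) := by positivity
      linarith

/-- Jacquet's integral, completed by its gamma factors, is the Vinogradov-Takhtadzhyan
integral. -/
theorem integral_jacquet_eq {p q : ℂ} (hp : 1 < p.re) (hq : 1 < q.re) {y₀ y₁ : ℝ} (h₀ : 0 < y₀)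
    (h₁ : 0 < y₁) :
    Complex.Gammaℝ (2 * (p + q - 1 / 2)) * (Complex.Gammaℝ (2 * p) * Complex.Gammaℝ (2 * q) *
      ∫ u : ℝ × ℝ × ℝ, Complex.exp (-p * Real.log (jacA y₀ y₁ u.1 u.2.1)) *
        Complex.exp (-q * Real.log (jacB y₀ y₁ u.1 u.2.1 u.2.2)) * e (-u.1 - u.2.2)) =
      ∫ t, whitKer (p + q - 1) (q - 1 / 2) y₀ y₁ t := by
  have hr : 0 < (p + q - 1 / 2).re := by
    simp only [Complex.sub_re, Complex.add_re]
    norm_num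
    linarith
  rw [← integral_jacKer hp hq h₀ h₁]
  have hassoc : MeasurePreserving (MeasurableEquiv.prodAssoc : (ℝ × ℝ × ℝ) × ℝ × ℝ ≃ᵐ _)
      ((volume.prod volume).prod volume) (volume.prod (volume.prod volume)) :=
    measurePreserving_prodAssoc (volume : Measure ℝ) (volume : Measure (ℝ × ℝ))
      (volume : Measure (ℝ × ℝ))
  have hint := integrable_jacKer hp hq h₀ h₁
  have hint' : Integrable (fun t : ℝ × (ℝ × ℝ) × ℝ × ℝ =>
      jacKer p q y₀ y₁ ((t.1, t.2.1), t.2.2)) :=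
    hassoc.symm.integrable_comp_of_integrable hint
  have h1 : ∫ t, jacKer p q y₀ y₁ t = ∫ t : ℝ × (ℝ × ℝ) × ℝ × ℝ,
      jacKer p q y₀ y₁ ((t.1, t.2.1), t.2.2) :=
    (integral_comp_measurePreserving hassoc.symm hint.1).symm
  have h2 : ∫ t, jacKer p q y₀ y₁ t = ∫ x : ℝ, ∫ v : ℝ × ℝ, shearKer p q y₀ y₁ x v := by
    refine h1.trans ((integral_prod _ hint').trans (integral_congr_ae ?_))
    filter_upwards [hint'.prod_right_ae] with x hx
    exact integral_jacKer_fibre p q h₁ hx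
  have hL := integrable_linkKer hp hq h₀ h₁
  rw [h2, ← integral_const_mul]
  have h3 : ∀ᵐ x : ℝ, Complex.Gammaℝ (2 * (p + q - 1 / 2)) * ∫ v : ℝ × ℝ, shearKer p q y₀ y₁ x v =
      ∫ t : (ℝ × ℝ) × ℝ, linkKer p q y₀ y₁ (t, x) := by
    filter_upwards [hL.prod_left_ae] with x hx
    refine Eq.trans ?_ (integral_prod _ hx).symm
    rw [← integral_const_mul]
    refine integral_congr_ae (ae_of_all _ fun v => ?_)
    simp only [shearKer, linkKer]
    rw [integral_const_mul, integral_mul_const, integral_Gammaℝ_exp hr (by have := h₁; positivity)]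
    ring
  rw [integral_congr_ae h3, ← integral_prod_symm _ hL]
  refine (integral_prod _ hL).trans (integral_congr_ae (ae_of_all _ fun t => ?_))
  have hg := integral_cexp_gaussian (Real.exp_pos t.2) (-2 * π * Complex.I)
    ((p + q - 1) * t.1.2 + (q - 1 / 2) * t.1.1 -
      (π * ((1 + Real.exp (-t.1.1)) * Real.exp (-t.1.2) + y₀ ^ 2 * Real.exp t.1.2) : ℝ) +
      ((p + q - 1 / 2) * t.2 - (π * (y₁ ^ 2 * (1 + Real.exp t.1.1)) : ℝ) * Real.exp t.2))
  refine (integral_congr_ae (ae_of_all _ fun x => ?_)).trans (hg.trans ?_)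
  · simp only [linkKer, e, ← Complex.exp_add]
    congr 1
    push_cast
    ring
  · simp only [whitKer]
    congr 1
    have hI : Complex.I ^ 2 = -1 := Complex.I_sq
    have h0 : ((Real.exp t.2 : ℝ) : ℂ) ≠ 0 := by exact_mod_cast Real.exp_ne_zero t.2
    have hpi : (π : ℂ) ≠ 0 := by exact_mod_cast Real.pi_ne_zero
    rw [Real.log_exp, Real.exp_neg t.2]
    push_cast [-Complex.ofReal_exp]
    field_simp
    ring_nf
    simp only [hI]
    ring_nf

/-! ### The Whittaker function of `GL₃(ℝ)` -/

theorem continuous_whitKer (ν μ : ℂ) (y₀ y₁ : ℝ) : Continuous (whitKer ν μ y₀ y₁) := by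
  unfold whitKer
  fun_prop

theorem norm_whitKer (ν μ : ℂ) (y₀ y₁ : ℝ) (t : (ℝ × ℝ) × ℝ) :
    ‖whitKer ν μ y₀ y₁ t‖ =
      Real.exp (ν.re * (t.1.2 + t.2) + μ.re * t.1.1 -
    (π * ((1 + Real.exp (-t.1.1)) * Real.exp (-t.1.2) + y₀ ^ 2 * Real.exp t.1.2 +
      y₁ ^ 2 * (1 + Real.exp t.1.1) * Real.exp t.2 + Real.exp (-t.2)))) := by
  rw [whitKer, Complex.norm_exp, ← Complex.ofReal_add]
  simp only [Complex.sub_re, Complex.add_re, Complex.re_mul_ofReal, Complex.ofReal_re]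

/-- `exp(-X) ≤ (r / e)^r X^{-r}`, in logarithmic form. -/
theorem neg_le_neg_mul_log {r X : ℝ} (hr : 0 < r) (hX : 0 < X) :
    -X ≤ -r * Real.log X + (r * Real.log r - r) := by
  have h := Real.log_le_sub_one_of_pos (div_pos hX hr)
  rw [Real.log_div hX.ne' hr.ne'] at h
  have h2 := mul_le_mul_of_nonneg_left h hr.le
  have h3 : r * (X / r - 1) = X - r := by field_simp
  nlinarith

theorem integrable_exp_two_sided (a : ℝ) {A B : ℝ} (hA : 0 < A) (hB : 0 < B) :
    Integrable fun c : ℝ => Real.exp (a * c - A * Real.exp (-c) - B * Real.exp c) := by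
  have hr : 0 < |a| + 1 := by positivity
  have ha : 0 < a + (|a| + 1) := by linarith [neg_abs_le a]
  refine ((integrable_real_Gamma_exp ha hB).const_mul
    (Real.exp (-(|a| + 1) * Real.log A + ((|a| + 1) * Real.log (|a| + 1) - (|a| + 1))))).mono'
    (by fun_prop) (ae_of_all _ fun c => ?_)
  rw [Real.norm_of_nonneg (by positivity), ← Real.exp_add, Real.exp_le_exp]
  have h := neg_le_neg_mul_log hr (mul_pos hA (Real.exp_pos (-c)))
  rw [Real.log_mul hA.ne' (Real.exp_ne_zero _), Real.log_exp] at h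
  linarith

theorem integrable_exp_two_sided_abs (a r : ℝ) {A B : ℝ} (hA : 0 < A) (hB : 0 < B) :
    Integrable fun c : ℝ => Real.exp (a * c + r * |c| - A * Real.exp (-c) - B * Real.exp c) := by
  refine ((integrable_exp_two_sided (a + r) hA hB).add
    (integrable_exp_two_sided (a - r) hA hB)).mono' (by fun_prop) (ae_of_all _ fun c => ?_)
  rw [Real.norm_of_nonneg (by positivity)]
  rcases le_total 0 c with h | h
  · rw [abs_of_nonneg h]
    refine le_trans (le_of_eq ?_) (le_add_of_nonneg_right (Real.exp_pos _).le)
    congr 1; ring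
  · rw [abs_of_nonpos h]
    refine le_trans (le_of_eq ?_) (le_add_of_nonneg_left (Real.exp_pos _).le)
    congr 1; ring

/-- Absolute convergence of the Vinogradov-Takhtadzhyan integral for all parameters: the four
exponentials give decay beyond any exponential rate in every direction. -/
theorem integrable_whitKer (ν μ : ℂ) {y₀ y₁ : ℝ} (h₀ : 0 < y₀) (h₁ : 0 < y₁) :
    Integrable (whitKer ν μ y₀ y₁) := by
  set r := |μ.re| + 1 with hr
  have hr0 : 0 < r := by positivity
  set K := r * Real.log r - r + |r * Real.log π| + |r * Real.log (π * y₁ ^ 2)| with hK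
  have hc := integrable_exp_two_sided_abs ν.re r Real.pi_pos (mul_pos Real.pi_pos (pow_pos h₀ 2))
  have hd := integrable_exp_two_sided_abs ν.re r Real.pi_pos (mul_pos Real.pi_pos (pow_pos h₁ 2))
  have hk := integrable_exp_neg_mul_abs one_pos
  refine (((hk.mul_prod hc).mul_prod hd).const_mul (Real.exp K)).mono'
    (continuous_whitKer ν μ y₀ y₁).aestronglyMeasurable (ae_of_all _ fun t => ?_)
  obtain ⟨⟨k, c⟩, d⟩ := t
  simp only [norm_whitKer, ← Real.exp_add, Real.exp_le_exp]
  -- Decay in `k` comes from `exp(k + d)` for `k ≥ 0` and from `exp(-k - c)` for `k ≤ 0`, at the cost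
  -- of exponential growth in `d` and `c`, which the remaining exponentials absorb.
  have e1 : 0 < π * (Real.exp (-k) * Real.exp (-c)) := by positivity
  have e2 : 0 < π * y₁ ^ 2 * (Real.exp k * Real.exp d) := by positivity
  have key : μ.re * k - π * (Real.exp (-k) * Real.exp (-c)) -
      π * y₁ ^ 2 * (Real.exp k * Real.exp d) ≤ K - |k| + r * |c| + r * |d| := by
    rcases le_total 0 k with h | h
    · have h2 := neg_le_neg_mul_log hr0 e2
      rw [Real.log_mul (by positivity) (by positivity), ← Real.exp_add, Real.log_exp] at h2
      rw [← Real.exp_add k d, abs_of_nonneg h]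
      have := le_abs_self μ.re
      have h3 := neg_abs_le (r * Real.log (π * y₁ ^ 2))
      have h4 : μ.re * k ≤ (r - 1) * k := mul_le_mul_of_nonneg_right (by rw [hr]; linarith) h
      have h5 : -(r * d) ≤ r * |d| := by
        rw [← mul_neg]; exact mul_le_mul_of_nonneg_left (neg_le_abs d) hr0.le
      have h6 : 0 ≤ r * |c| := by positivity
      have h7 := abs_nonneg (r * Real.log π)
      nlinarith
    · have h2 := neg_le_neg_mul_log hr0 e1
      rw [Real.log_mul (by positivity) (by positivity), ← Real.exp_add, Real.log_exp] at h2
      rw [← Real.exp_add (-k) (-c), abs_of_nonpos h]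
      have := neg_abs_le μ.re
      have h3 := neg_abs_le (r * Real.log π)
      have h4 : μ.re * k ≤ (-(r - 1)) * k :=
        mul_le_mul_of_nonpos_right (by rw [hr]; linarith) h
      have h5 : r * c ≤ r * |c| := mul_le_mul_of_nonneg_left (le_abs_self c) hr0.le
      have h6 : 0 ≤ r * |d| := by positivity
      have h7 := abs_nonneg (r * Real.log (π * y₁ ^ 2))
      nlinarith
  nlinarith [key]

/-- A two-sided Laplace transform that converges absolutely everywhere is entire. -/
theorem differentiable_integral_mul_exp {X : Type*} [MeasurableSpace X] {m : Measure X} {f : X → ℂ}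
    {L : X → ℝ} (hf : AEStronglyMeasurable f m) (hL : AEStronglyMeasurable L m)
    (h : ∀ r : ℝ, Integrable (fun x => Real.exp (r * L x) * ‖f x‖) m) :
    Differentiable ℂ fun t : ℂ => ∫ x, f x * Complex.exp (t * L x) ∂m := by
  intro t₀
  have hexp : ∀ t : ℂ, AEStronglyMeasurable (fun x => Complex.exp (t * L x)) m := fun t =>
    (by fun_prop : Continuous fun y : ℝ => Complex.exp (t * y)).comp_aestronglyMeasurable hL
  refine (hasDerivAt_integral_of_dominated_loc_of_deriv_le
    (F := fun (t : ℂ) x => f x * Complex.exp (t * L x))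
    (F' := fun (t : ℂ) x => f x * (Complex.exp (t * L x) * L x))
    (bound := fun x => Real.exp ((t₀.re + 2) * L x) * ‖f x‖ + Real.exp ((t₀.re - 2) * L x) * ‖f x‖)
    (Metric.ball_mem_nhds t₀ one_pos)
    (Filter.Eventually.of_forall fun t => hf.mul (hexp t)) ?_ ?_ ?_ ((h _).add (h _)) ?_).2.differentiableAt
  · refine (integrable_norm_iff (hf.mul (hexp t₀))).1 ((h t₀.re).congr (ae_of_all _ fun x => ?_))
    simp only
    rw [Pi.mul_apply, norm_mul, Complex.norm_exp, Complex.re_mul_ofReal, mul_comm]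
  · exact hf.mul ((hexp t₀).mul
      (Complex.continuous_ofReal.comp_aestronglyMeasurable hL))
  · refine ae_of_all _ fun x t ht => ?_
    have ht' : |t.re - t₀.re| ≤ 1 := by
      have h1 := Complex.abs_re_le_norm (t - t₀)
      rw [Complex.sub_re] at h1
      exact h1.trans (by simpa [dist_eq_norm] using (Metric.mem_ball.1 ht).le)
    rw [norm_mul, norm_mul, Complex.norm_exp, Complex.re_mul_ofReal, Complex.norm_real,
      Real.norm_eq_abs, ← add_mul, mul_comm ‖f x‖]
    gcongr
    have h1 : |L x| ≤ Real.exp |L x| := by linarith [Real.add_one_le_exp |L x|]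
    have h2 : t.re * L x ≤ t₀.re * L x + |L x| := by
      have : (t.re - t₀.re) * L x ≤ 1 * |L x| := by
        refine (le_abs_self _).trans ?_
        rw [abs_mul]
        gcongr
      linarith
    calc Real.exp (t.re * L x) * |L x| ≤ Real.exp (t₀.re * L x + |L x|) * Real.exp |L x| := by
          gcongr
      _ = Real.exp (t₀.re * L x + 2 * |L x|) := by rw [← Real.exp_add]; ring_nf
      _ ≤ _ := by
        rcases le_total 0 (L x) with h | h
        · rw [abs_of_nonneg h]
          refine le_trans (le_of_eq ?_) (le_add_of_nonneg_right (Real.exp_pos _).le)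
          ring_nf
        · rw [abs_of_nonpos h]
          refine le_trans (le_of_eq ?_) (le_add_of_nonneg_left (Real.exp_pos _).le)
          ring_nf
  · refine ae_of_all _ fun x t _ => ?_
    have h1 : HasDerivAt (fun t : ℂ => t * (L x : ℂ)) (L x : ℂ) t := by
      simpa using (hasDerivAt_id t).mul_const (L x : ℂ)
    exact h1.cexp.const_mul (f x)

/-- The Vinogradov-Takhtadzhyan integral for the Whittaker function; in contrast to Jacquet's
integral it converges absolutely for all `α`. -/
def vtWhittaker (α : Fin 3 → ℂ) (y₀ y₁ : ℝ) : ℂ :=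
  Complex.exp ((1 - α 2) * Real.log y₀ + (1 + α 0) * Real.log y₁) *
    ∫ t, whitKer ((α 0 - α 2) / 2) ((α 0 - α 1) / 2) y₀ y₁ t

theorem differentiable_vtWhittaker (α : Fin 3 → ℂ) {y₀ y₁ : ℝ} (h₀ : 0 < y₀) (h₁ : 0 < y₁) :
    Differentiable ℂ fun t => vtWhittaker (shiftParam α t) y₀ y₁ := by
  have h := differentiable_integral_mul_exp (m := (volume : Measure ((ℝ × ℝ) × ℝ)))
    (f := whitKer ((α 0 - α 2) / 2) ((α 0 - α 1) / 2) y₀ y₁)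
    (L := fun t => t.1.2 + t.2 + t.1.1 / 2)
    (continuous_whitKer _ _ _ _).aestronglyMeasurable
    (by fun_prop) (fun r => by
      refine (integrable_whitKer ((α 0 - α 2) / 2 + r) ((α 0 - α 1) / 2 + (r / 2 : ℝ))
        h₀ h₁).norm.congr (ae_of_all _ fun t => ?_)
      simp only [norm_whitKer, ← Real.exp_add, Complex.add_re, Complex.ofReal_re]
      congr 1
      ring)
  have h2 : ∀ t : ℂ, vtWhittaker (shiftParam α t) y₀ y₁ =
      Complex.exp ((1 - (α 2 - t)) * Real.log y₀ + (1 + (α 0 + t)) * Real.log y₁) *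
      ∫ x : (ℝ × ℝ) × ℝ, whitKer ((α 0 - α 2) / 2) ((α 0 - α 1) / 2) y₀ y₁ x *
        Complex.exp (t * (x.1.2 + x.2 + x.1.1 / 2 : ℝ)) := by
    intro t
    simp only [vtWhittaker, shiftParam]
    congr 1
    · simp only [Matrix.cons_val]
      ring_nf
    · refine integral_congr_ae (ae_of_all _ fun x => ?_)
      simp only [whitKer, ← Complex.exp_add]
      congr 1
      simp
      ring
  simp only [h2]
  exact (by fun_prop : Differentiable ℂ fun t : ℂ =>
    Complex.exp ((1 - (α 2 - t)) * Real.log y₀ + (1 + (α 0 + t)) * Real.log y₁)).mul h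

theorem jacquet_eq_vtWhittaker {α : Fin 3 → ℂ} (hα : α 0 + α 1 + α 2 = 0)
    (h01 : 1 < (α 0 - α 1).re) (h12 : 1 < (α 1 - α 2).re) {y₀ y₁ : ℝ} (h₀ : 0 < y₀) (h₁ : 0 < y₁) :
    jacquet α y₀ y₁ = vtWhittaker α y₀ y₁ := by
  have hp : 1 < ((1 + α 1 - α 2) / 2).re := by
    simp at h12 ⊢
    linarith
  have hq : 1 < ((1 + α 0 - α 1) / 2).re := by
    simp at h01 ⊢
    linarith
  have h := integral_jacquet_eq hp hq h₀ h₁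
  rw [show (1 + α 1 - α 2) / 2 + (1 + α 0 - α 1) / 2 - 1 = (α 0 - α 2) / 2 by ring,
    show (1 + α 0 - α 1) / 2 - 1 / 2 = (α 0 - α 1) / 2 by ring] at h
  rw [vtWhittaker, ← h, jacquet]
  simp only [powerFn_weyl hα h₀ h₁, mul_assoc (Complex.exp (_ + _)), integral_const_mul]
  rw [show 2 * ((1 + α 1 - α 2) / 2 + (1 + α 0 - α 1) / 2 - 1 / 2) = 1 + α 0 - α 2 by ring,
    show 2 * ((1 + α 1 - α 2) / 2) = 1 + α 1 - α 2 by ring,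
    show 2 * ((1 + α 0 - α 1) / 2) = 1 + α 0 - α 1 by ring]
  ring

/-- The Vinogradov-Takhtadzhyan integral continues Jacquet's integral. -/
theorem isJacquetValue_vtWhittaker {α : Fin 3 → ℂ} (hα : α 0 + α 1 + α 2 = 0) {y₀ y₁ : ℝ}
    (h₀ : 0 < y₀) (h₁ : 0 < y₁) : IsJacquetValue α y₀ y₁ (vtWhittaker α y₀ y₁) := by
  refine ⟨fun t => vtWhittaker (shiftParam α t) y₀ y₁, -1,
    1 + |(α 0 - α 1).re| + |(α 1 - α 2).re|, by norm_num,
    (differentiable_vtWhittaker α h₀ h₁).differentiableOn, fun t ht => ?_, ?_⟩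
  · refine (jacquet_eq_vtWhittaker ?_ ?_ ?_ h₀ h₁).symm
    · simp [shiftParam]
      linear_combination hα
    · have h1 := neg_abs_le (α 0 - α 1).re
      have h2 := abs_nonneg (α 1 - α 2).re
      have h3 : shiftParam α t 0 - shiftParam α t 1 = α 0 - α 1 + t := by
        simp [shiftParam]
        ring
      rw [h3, Complex.add_re]
      linarith
    · have h1 := neg_abs_le (α 1 - α 2).re
      have h2 := abs_nonneg (α 0 - α 1).re
      have h3 : shiftParam α t 1 - shiftParam α t 2 = α 1 - α 2 + t := by
        simp [shiftParam]
        ring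
      rw [h3, Complex.add_re]
      linarith
  · have h3 : shiftParam α 0 = α := by
      funext i
      simp [shiftParam]
    simp only [h3]

/-- Uniqueness of analytic continuation, on a half-plane on which both continuations are defined. -/
theorem IsJacquetValue.unique {α : Fin 3 → ℂ} {y₀ y₁ : ℝ} {w w' : ℂ}
    (h : IsJacquetValue α y₀ y₁ w) (h' : IsJacquetValue α y₀ y₁ w') : w = w' := by
  obtain ⟨F, c, T, hc, hF, hT, rfl⟩ := h
  obtain ⟨F', c', T', hc', hF', hT', rfl⟩ := h'
  have hopen : ∀ r : ℝ, IsOpen {t : ℂ | r < t.re} := fun r =>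
    isOpen_lt continuous_const Complex.continuous_re
  -- Both continuations are holomorphic on `Re t > max c c'`, a half-plane that contains `0`.
  set m := max c c' with hm
  have hm0 : m < 0 := max_lt hc hc'
  have h1 : AnalyticOnNhd ℂ F {t | m < t.re} :=
    (hF.mono fun t (ht : m < t.re) => lt_of_le_of_lt (le_max_left _ _) ht).analyticOnNhd (hopen m)
  have h2 : AnalyticOnNhd ℂ F' {t | m < t.re} :=
    (hF'.mono fun t (ht : m < t.re) => lt_of_le_of_lt (le_max_right _ _) ht).analyticOnNhd (hopen m)
  -- Near the real point `z` both continuations coincide with Jacquet's integral.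
  set z : ℂ := ((max (max T T') 0 + 1 : ℝ) : ℂ) with hz
  have hzre : z.re = max (max T T') 0 + 1 := by rw [hz, Complex.ofReal_re]
  have hz1 : max T T' < z.re := by
    rw [hzre]; exact lt_of_le_of_lt (le_max_left _ _) (lt_add_one _)
  have hz2 : m < z.re := by
    rw [hzre]
    have := le_max_right (max T T') 0
    linarith
  refine h1.eqOn_of_preconnected_of_eventuallyEq h2 (convex_halfSpace_re_gt m).isPreconnected hz2 ?_
    (by simpa using hm0)
  filter_upwards [(hopen (max T T')).mem_nhds hz1] with t ht
  rw [hT t (lt_of_le_of_lt (le_max_left _ _) ht), hT' t (lt_of_le_of_lt (le_max_right _ _) ht)]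

/-- The Whittaker function is given by the Vinogradov-Takhtadzhyan integral for all `α`, in
particular on the tempered axis, where Jacquet's integral does not converge absolutely. -/
theorem whittaker₃_eq {α : Fin 3 → ℂ} (hα : α 0 + α 1 + α 2 = 0) {y₀ y₁ : ℝ}
    (h₀ : 0 < y₀) (h₁ : 0 < y₁) : whittaker₃ α y₀ y₁ = vtWhittaker α y₀ y₁ := by
  have h := isJacquetValue_vtWhittaker hα h₀ h₁
  have hex : ∃ w, IsJacquetValue α y₀ y₁ w := ⟨_, h⟩
  rw [whittaker₃, dif_pos hex]
  exact hex.choose_spec.unique h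

/-! ### The Mellin-Barnes integral for the Whittaker function -/

theorem line_add_eq {β : ℂ} (hβ : β.re = 0) (σ t : ℝ) :
    (σ + t * Complex.I + β : ℂ) = 2 * ((σ / 2 : ℝ) + ((t + β.im) / 2 : ℝ) * Complex.I) := by
  apply Complex.ext
  · simp [hβ]; ring
  · simp; ring

theorem continuous_Gammaℝ_line {σ : ℝ} (hσ : 0 < σ) {β : ℂ} (hβ : β.re = 0) :
    Continuous fun t : ℝ => Complex.Gammaℝ (σ + t * Complex.I + β) := by
  have h := (continuous_Gamma_line (half_pos hσ)).comp
    (by fun_prop : Continuous fun t : ℝ => (t + β.im) / 2)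
  simp only [line_add_eq hβ, Gammaℝ_eq_exp]
  refine Continuous.mul (by fun_prop) (h.congr fun t => ?_)
  simp only [Function.comp]
  congr 1
  ring

theorem integrable_Gammaℝ_line {σ : ℝ} (hσ : 0 < σ) {β : ℂ} (hβ : β.re = 0) :
    Integrable fun t : ℝ => Complex.Gammaℝ (σ + t * Complex.I + β) := by
  have h := (((integrable_Gamma_line (half_pos hσ)).comp_div (R := 2) two_ne_zero).comp_add_right
    β.im).norm.const_mul (Real.exp (-(σ / 2) * Real.log π))
  refine h.mono' (continuous_Gammaℝ_line hσ hβ).aestronglyMeasurable (ae_of_all _ fun t => ?_)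
  rw [line_add_eq hβ, Gammaℝ_eq_exp, norm_mul, Complex.norm_exp, Complex.re_mul_ofReal,
    mul_div_cancel_left₀ _ (two_ne_zero)]
  simp

/-- The Cahen-Mellin integral in terms of `Γ_ℝ`. -/
theorem integral_Gammaℝ_line {σ : ℝ} (hσ : 0 < σ) {β : ℂ} (hβ : β.re = 0) (x : ℝ) :
    ∫ t : ℝ, Complex.Gammaℝ (σ + t * Complex.I + β) *
      Complex.exp (-(σ + t * Complex.I + β) * x) =
      4 * π * Complex.exp (-(π * Real.exp (2 * x) : ℝ)) := by
  have hX : 0 < π * Real.exp (2 * x) := by positivity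
  have h := vint_Gamma_cpow (half_pos hσ) hX
  rw [vint] at h
  have h2 : ∫ t : ℝ, Complex.Gammaℝ (σ + t * Complex.I + β) *
      Complex.exp (-(σ + t * Complex.I + β) * x) =
      2 * ∫ t : ℝ, Complex.Gamma ((σ / 2 : ℝ) + t * Complex.I) *
        ((π * Real.exp (2 * x) : ℝ) : ℂ) ^ (-((σ / 2 : ℝ) + t * Complex.I : ℂ)) := by
    have e1 := integral_add_right_eq_self (μ := volume) (fun t : ℝ =>
      Complex.Gamma ((σ / 2 : ℝ) + (t / 2 : ℝ) * Complex.I) *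
        ((π * Real.exp (2 * x) : ℝ) : ℂ) ^ (-((σ / 2 : ℝ) + (t / 2 : ℝ) * Complex.I : ℂ))) β.im
    rw [Measure.integral_comp_div (fun t : ℝ => Complex.Gamma ((σ / 2 : ℝ) + t * Complex.I) *
        ((π * Real.exp (2 * x) : ℝ) : ℂ) ^ (-((σ / 2 : ℝ) + t * Complex.I : ℂ)))] at e1
    simp only [Nat.abs_ofNat, Complex.real_smul, Complex.ofReal_ofNat] at e1
    rw [← e1]
    refine integral_congr_ae (ae_of_all _ fun t => ?_)
    simp only
    rw [line_add_eq hβ, Gammaℝ_eq_exp, mul_div_cancel_left₀ _ (two_ne_zero),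
      ofReal_cpow_eq_exp hX, Real.log_mul Real.pi_ne_zero (Real.exp_ne_zero _), Real.log_exp,
      mul_comm (Complex.exp _) (Complex.Gamma _), mul_assoc, ← Complex.exp_add]
    congr 2
    push_cast
    ring
  have hpi : (2 * π : ℂ) ≠ 0 := by simp [Real.pi_ne_zero]
  rw [h2, ← h, show (4 * π : ℂ) = 2 * (2 * π) by ring, mul_assoc, ← mul_assoc (2 * (π : ℂ)) (1 / _),
    mul_one_div_cancel hpi, one_mul]

/-- The integral over `c` is a gamma integral that contributes a further power of `1 + exp k`, and
the remaining integral over `k` is a beta integral. -/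
theorem integrable_mellinBarnes_inner {z a b : ℂ} (hz : 0 < z.re) (ha : 0 < a.re)
    (hb : a.re < b.re) :
    Integrable (fun v : ℝ × ℝ =>
      Complex.exp (-z * v.2 - (π * ((1 + Real.exp (-v.1)) * Real.exp (-v.2)) : ℝ)) *
        Complex.exp ((a - z) * v.1 - (b - z) * Real.log (1 + Real.exp v.1))) ∧
    ∫ v : ℝ × ℝ,
      Complex.exp (-z * v.2 - (π * ((1 + Real.exp (-v.1)) * Real.exp (-v.2)) : ℝ)) *
        Complex.exp ((a - z) * v.1 - (b - z) * Real.log (1 + Real.exp v.1)) =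
      Complex.Gammaℝ (2 * z) * (Complex.Gamma a * Complex.Gamma (b - a) / Complex.Gamma b) := by
  have hβ := integrable_exp_beta ha hb
  have hγ := integrable_Gammaℝ_exp hz one_pos
  have hG := hβ.1.mul_prod hγ
  have hneg : MeasurePreserving (fun v : ℝ × ℝ => ((v.1, -v.2) : ℝ × ℝ))
      (volume.prod volume) (volume.prod volume) :=
    (MeasurePreserving.id (volume : Measure ℝ)).prod (Measure.measurePreserving_neg volume)
  have hT := (measurePreserving_shear (μ := (volume : Measure ℝ))
    (g := fun k : ℝ => Real.log (1 + Real.exp (-k))) (by fun_prop)).comp hneg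
  have hpt : ∀ v : ℝ × ℝ,
      Complex.exp (a * v.1 - b * Real.log (1 + Real.exp v.1)) *
        Complex.exp (z * (-v.2 + Real.log (1 + Real.exp (-v.1)) : ℝ) -
          (π * 1 : ℝ) * Real.exp (-v.2 + Real.log (1 + Real.exp (-v.1)))) =
      Complex.exp (-z * v.2 - (π * ((1 + Real.exp (-v.1)) * Real.exp (-v.2)) : ℝ)) *
        Complex.exp ((a - z) * v.1 - (b - z) * Real.log (1 + Real.exp v.1)) := by
    intro v
    have h1 : Real.log (1 + Real.exp (-v.1)) = Real.log (1 + Real.exp v.1) - v.1 := by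
      rw [← Real.log_exp v.1, ← Real.log_div (by positivity) (by positivity), Real.log_exp,
        Real.exp_neg]
      congr 1
      field_simp
      ring
    rw [Real.exp_add, Real.exp_log (by positivity), h1, ← Complex.exp_add, ← Complex.exp_add]
    congr 1
    push_cast
    ring
  have hI := hT.integrable_comp_of_integrable hG
  have hE := integral_comp_measurePreserving hT hG.1
  simp only [Function.comp_def] at hI hE
  simp only [hpt] at hI hE
  refine ⟨hI, hE.trans ?_⟩
  refine (integral_prod_mul (fun v : ℝ => Complex.exp (a * v - b * Real.log (1 + Real.exp v)))
    (fun v : ℝ => Complex.exp (z * v - (π * 1 : ℝ) * Real.exp v))).trans ?_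
  rw [hβ.2, integral_Gammaℝ_exp hz one_pos]
  simp [mul_comm]

theorem integrable_exp_neg_neg {z : ℂ} (hz : 0 < z.re) :
    Integrable (fun d : ℝ => Complex.exp (-z * d - (π * Real.exp (-d) : ℝ))) ∧
    ∫ d : ℝ, Complex.exp (-z * d - (π * Real.exp (-d) : ℝ)) = Complex.Gammaℝ (2 * z) := by
  have h1 := (integrable_Gammaℝ_exp hz one_pos).comp_neg
  have h2 := (integral_neg_eq_self (fun v : ℝ => Complex.exp (z * v - (π * 1 : ℝ) * Real.exp v))
    volume).trans (integral_Gammaℝ_exp hz one_pos)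
  have hpt : ∀ d : ℝ, Complex.exp (z * (-d : ℝ) - (π * 1 : ℝ) * Real.exp (-d)) =
      Complex.exp (-z * d - (π * Real.exp (-d) : ℝ)) := by
    intro d
    congr 1
    push_cast
    ring
  simp only [hpt] at h1 h2
  exact ⟨h1, by simpa using h2⟩

/-- The part of the Mellin-Barnes integrand that depends on `((k, c), d)`. -/
def mbInner (α : Fin 3 → ℂ) (s₀ s₁ : ℂ) (p : (ℝ × ℝ) × ℝ) : ℂ :=
  Complex.exp (-((s₀ + α 0) / 2) * p.1.2 -
      (π * ((1 + Real.exp (-p.1.1)) * Real.exp (-p.1.2)) : ℝ)) *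
    Complex.exp (((s₀ + α 1) / 2 - (s₀ + α 0) / 2) * p.1.1 -
      ((s₀ + s₁) / 2 - (s₀ + α 0) / 2) * Real.log (1 + Real.exp p.1.1)) *
    Complex.exp (-((s₁ - α 2) / 2) * p.2 - (π * Real.exp (-p.2) : ℝ))

theorem half_re {z : ℂ} : (z / 2).re = z.re / 2 := by
  rw [← Complex.ofReal_ofNat, Complex.div_ofReal_re]

/-- The integral of `mbInner`, together with two further gamma factors, is `G_α`. -/
theorem integrable_mbInner {α : Fin 3 → ℂ} (hα : ∀ i, (α i).re = 0) {s₀ s₁ : ℂ}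
    (h₀ : 0 < s₀.re) (h₁ : 0 < s₁.re) :
    Integrable (mbInner α s₀ s₁) ∧
    Complex.Gammaℝ (s₀ + α 2) * Complex.Gammaℝ (s₁ - α 0) * ∫ p, mbInner α s₀ s₁ p =
      vtKernel α s₀ s₁ := by
  have e1 : 0 < ((s₀ + α 0) / 2).re := by rw [half_re]; simp [hα]; exact h₀
  have e2 : 0 < ((s₀ + α 1) / 2).re := by rw [half_re]; simp [hα]; exact h₀
  have e3 : ((s₀ + α 1) / 2).re < ((s₀ + s₁) / 2).re := by
    rw [half_re, half_re]; simp [hα]; linarith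
  have e4 : 0 < ((s₁ - α 2) / 2).re := by rw [half_re]; simp [hα]; exact h₁
  have hA := integrable_mellinBarnes_inner e1 e2 e3
  have hB := integrable_exp_neg_neg e4
  have hi := hA.1.mul_prod hB.1
  refine ⟨by unfold mbInner; exact hi, ?_⟩
  have hE := integral_prod_mul (μ := (volume : Measure (ℝ × ℝ))) (ν := (volume : Measure ℝ))
    (fun v : ℝ × ℝ => Complex.exp (-((s₀ + α 0) / 2) * v.2 -
      (π * ((1 + Real.exp (-v.1)) * Real.exp (-v.2)) : ℝ)) *
    Complex.exp (((s₀ + α 1) / 2 - (s₀ + α 0) / 2) * v.1 -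
      ((s₀ + s₁) / 2 - (s₀ + α 0) / 2) * Real.log (1 + Real.exp v.1)))
    (fun d : ℝ => Complex.exp (-((s₁ - α 2) / 2) * d - (π * Real.exp (-d) : ℝ)))
  rw [hA.2, hB.2] at hE
  have hr : Complex.Gamma ((s₀ + α 1) / 2) * Complex.Gamma ((s₀ + s₁) / 2 - (s₀ + α 1) / 2) /
      Complex.Gamma ((s₀ + s₁) / 2) =
      Complex.Gammaℝ (s₀ + α 1) * Complex.Gammaℝ (s₁ - α 1) / Complex.Gammaℝ (s₀ + s₁) := by
    rw [Gammaℝ_eq_exp, Gammaℝ_eq_exp, Gammaℝ_eq_exp,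
      show (s₀ + s₁) / 2 - (s₀ + α 1) / 2 = (s₁ - α 1) / 2 by ring,
      show -((s₀ + s₁) / 2) * ((Real.log π : ℝ) : ℂ) = -((s₀ + α 1) / 2) * (Real.log π : ℝ) +
        -((s₁ - α 1) / 2) * (Real.log π : ℝ) by ring, Complex.exp_add]
    have := Complex.exp_ne_zero (-((s₀ + α 1) / 2) * (Real.log π : ℝ))
    have := Complex.exp_ne_zero (-((s₁ - α 1) / 2) * (Real.log π : ℝ))
    field_simp
  rw [show 2 * ((s₀ + α 0) / 2) = s₀ + α 0 by ring, show 2 * ((s₁ - α 2) / 2) = s₁ - α 2 by ring,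
    hr] at hE
  rw [vtKernel, Fin.prod_univ_three]
  unfold mbInner
  refine (congrArg (fun w => Complex.Gammaℝ (s₀ + α 2) * Complex.Gammaℝ (s₁ - α 0) * w) hE).trans ?_
  ring

/-- The modulus of `mbInner` only depends on the real parts of `s₀` and `s₁`. -/
theorem norm_mbInner {α : Fin 3 → ℂ} (hα : ∀ i, (α i).re = 0) (s₀ s₁ : ℂ) (p : (ℝ × ℝ) × ℝ) :
    ‖mbInner α s₀ s₁ p‖ = ‖mbInner α s₀.re s₁.re p‖ := by
  simp only [mbInner, norm_mul, Complex.norm_exp, Complex.sub_re, Complex.neg_re, neg_mul,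
    Complex.re_mul_ofReal, Complex.ofReal_re, half_re, Complex.add_re, hα]

/-- The kernel is bounded by two of its six gamma factors: the others are a beta integral and
gamma integrals, which are largest on the real axis. -/
theorem norm_vtKernel_le {α : Fin 3 → ℂ} (hα : ∀ i, (α i).re = 0) {s₀ s₁ : ℂ}
    (h₀ : 0 < s₀.re) (h₁ : 0 < s₁.re) :
    ‖vtKernel α s₀ s₁‖ ≤ ‖Complex.Gammaℝ (s₀ + α 2)‖ * ‖Complex.Gammaℝ (s₁ - α 0)‖ *
      ∫ p, ‖mbInner α s₀.re s₁.re p‖ := by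
  rw [← (integrable_mbInner hα h₀ h₁).2, norm_mul, norm_mul]
  gcongr
  refine (norm_integral_le_integral_norm _).trans (le_of_eq ?_)
  exact integral_congr_ae (ae_of_all _ fun p => norm_mbInner hα s₀ s₁ p)

theorem measurable_mbInner (α : Fin 3 → ℂ) :
    Measurable fun q : (ℂ × ℂ) × (ℝ × ℝ) × ℝ => mbInner α q.1.1 q.1.2 q.2 := by
  unfold mbInner
  fun_prop

/-- The Mellin-Barnes integral for `W_{-α}`. -/
theorem vtWhittaker_neg_eq {α : Fin 3 → ℂ} (hα : ∀ i, (α i).re = 0) {σ₀ σ₁ : ℝ}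
    (hσ₀ : 0 < σ₀) (hσ₁ : 0 < σ₁) {y₀ y₁ : ℝ} (h₀ : 0 < y₀) (h₁ : 0 < y₁) :
    vtWhittaker (-α) y₀ y₁ = 1 / (4 * π) ^ 2 * ∫ t : ℝ × ℝ,
      vtKernel α (σ₀ + t.1 * Complex.I) (σ₁ + t.2 * Complex.I) *
        (Complex.exp ((1 - (σ₀ + t.1 * Complex.I)) * Real.log y₀) *
          Complex.exp ((1 - (σ₁ + t.2 * Complex.I)) * Real.log y₁)) := by
  have hα0 : (-α 0).re = 0 := by simp [hα]
  have hpi : (π : ℂ) ≠ 0 := by exact_mod_cast Real.pi_ne_zero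
  set E : ℝ × ℝ → ℂ := fun t => Complex.exp ((1 - (σ₀ + t.1 * Complex.I)) * Real.log y₀) *
          Complex.exp ((1 - (σ₁ + t.2 * Complex.I)) * Real.log y₁) with hE
  set G : ℝ × ℝ → ℂ := fun t => Complex.Gammaℝ (σ₀ + t.1 * Complex.I + α 2) *
    Complex.Gammaℝ (σ₁ + t.2 * Complex.I + -α 0) with hG
  set M : (ℝ × ℝ) × (ℝ × ℝ) × ℝ → ℂ := fun q => E q.1 * (G q.1 *
    mbInner α (σ₀ + q.1.1 * Complex.I) (σ₁ + q.1.2 * Complex.I) q.2) with hM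
  have hGi : Integrable G :=
    (integrable_Gammaℝ_line hσ₀ (hα 2)).mul_prod (integrable_Gammaℝ_line hσ₁ hα0)
  have hGc : Continuous G := ((continuous_Gammaℝ_line hσ₀ (hα 2)).comp continuous_fst).mul
    ((continuous_Gammaℝ_line hσ₁ hα0).comp continuous_snd)
  have hre : ∀ σ t : ℝ, (σ + t * Complex.I : ℂ).re = σ := by intro σ t; simp
  have hMi : Integrable M := by
    have hin := (integrable_mbInner (s₀ := σ₀) (s₁ := σ₁) hα (by simpa) (by simpa)).1
    refine ((hGi.norm.mul_prod hin.norm).const_mul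
      (Real.exp ((1 - σ₀) * Real.log y₀) * Real.exp ((1 - σ₁) * Real.log y₁))).mono' ?_
      (ae_of_all _ fun q => ?_)
    · have h1 : Measurable fun q : (ℝ × ℝ) × (ℝ × ℝ) × ℝ =>
          (((σ₀ + q.1.1 * Complex.I : ℂ), (σ₁ + q.1.2 * Complex.I : ℂ)), q.2) := by fun_prop
      have h2 := (measurable_mbInner α).comp h1
      simp only [Function.comp_def] at h2
      have h3 : Measurable fun q : (ℝ × ℝ) × (ℝ × ℝ) × ℝ => G q.1 :=
        hGc.measurable.comp measurable_fst
      have h4 : Measurable fun q : (ℝ × ℝ) × (ℝ × ℝ) × ℝ => E q.1 := by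
        simp only [hE]
        fun_prop
      exact (h4.mul (h3.mul h2)).aestronglyMeasurable
    · simp only [hM, hE, norm_mul]
      rw [norm_mbInner hα, hre, hre, Complex.norm_exp, Complex.norm_exp, Complex.re_mul_ofReal,
        Complex.re_mul_ofReal, Complex.sub_re, Complex.sub_re, hre, hre, Complex.one_re]
  have hL : ∀ p : (ℝ × ℝ) × ℝ, ∫ t, M (t, p) = (4 * π) ^ 2 *
      (Complex.exp ((1 + α 2) * Real.log y₀ + (1 - α 0) * Real.log y₁) *
        whitKer ((-α 0 + α 2) / 2) ((-α 0 + α 1) / 2) y₀ y₁ p) := by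
    rintro ⟨⟨k, c⟩, d⟩
    set l := Real.log (1 + Real.exp k) with hl
    have hel : Real.exp l = 1 + Real.exp k := Real.exp_log (by positivity)
    have hA := integral_Gammaℝ_line hσ₀ (hα 2) (Real.log y₀ + c / 2)
    have hB := integral_Gammaℝ_line hσ₁ hα0 (Real.log y₁ + l / 2 + d / 2)
    have hprod := integral_prod_mul (μ := (volume : Measure ℝ)) (ν := (volume : Measure ℝ))
      (fun t : ℝ => Complex.Gammaℝ (σ₀ + t * Complex.I + α 2) *
        Complex.exp (-(σ₀ + t * Complex.I + α 2) * (Real.log y₀ + c / 2 : ℝ)))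
      (fun t : ℝ => Complex.Gammaℝ (σ₁ + t * Complex.I + -α 0) *
        Complex.exp (-(σ₁ + t * Complex.I + -α 0) * (Real.log y₁ + l / 2 + d / 2 : ℝ)))
    rw [hA, hB] at hprod
    have hx : Real.exp (2 * (Real.log y₀ + c / 2)) = y₀ ^ 2 * Real.exp c := by
      rw [show 2 * (Real.log y₀ + c / 2) = Real.log y₀ + Real.log y₀ + c by ring, Real.exp_add,
        Real.exp_add, Real.exp_log h₀]
      ring
    have hx' : Real.exp (2 * (Real.log y₁ + l / 2 + d / 2)) =
        y₁ ^ 2 * (1 + Real.exp k) * Real.exp d := by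
      rw [show 2 * (Real.log y₁ + l / 2 + d / 2) = Real.log y₁ + Real.log y₁ + l + d by ring,
        Real.exp_add, Real.exp_add, Real.exp_add, Real.exp_log h₁, hel]
      ring
    rw [hx, hx'] at hprod
    set P : ℂ := Complex.exp ((1 + α 2) * Real.log y₀ + (1 - α 0) * Real.log y₁ +
      ((-α 0 + α 2) / 2) * (c + d) + ((-α 0 + α 1) / 2) * k -
      (π * ((1 + Real.exp (-k)) * Real.exp (-c) + Real.exp (-d)) : ℝ)) with hP
    have h3 : ∫ t, M (t, ((k, c), d)) = P * ((4 * π * Complex.exp (-(π * (y₀ ^ 2 * Real.exp c) : ℝ))) *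
        (4 * π * Complex.exp (-(π * (y₁ ^ 2 * (1 + Real.exp k) * Real.exp d) : ℝ)))) := by
      rw [← hprod, ← integral_const_mul]
      refine integral_congr_ae (ae_of_all _ fun t => ?_)
      simp only [hM, hE, hG, mbInner, hP, ← hl]
      rw [show ∀ a b c d e f g : ℂ, a * b * (c * d * (e * f * g)) = c * d * (a * b * e * f * g)
        from fun a b c d e f g => by ring,
        show ∀ a b c d e : ℂ, a * (b * c * (d * e)) = b * d * (a * c * e)
        from fun a b c d e => by ring]
      simp only [← Complex.exp_add]
      congr 2
      push_cast
      ring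
    rw [h3, hP, whitKer]
    rw [show ∀ p a b : ℂ, p * (4 * π * a * (4 * π * b)) = (4 * π) ^ 2 * (p * a * b)
      from fun p a b => by ring]
    simp only [← Complex.exp_add]
    congr 2
    push_cast
    ring
  have hR : ∀ t : ℝ × ℝ, ∫ p, M (t, p) =
      vtKernel α (σ₀ + t.1 * Complex.I) (σ₁ + t.2 * Complex.I) * E t := by
    intro t
    rw [← (integrable_mbInner hα (s₀ := σ₀ + t.1 * Complex.I) (s₁ := σ₁ + t.2 * Complex.I)
      (by rwa [hre]) (by rwa [hre])).2]
    simp only [hM]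
    rw [integral_const_mul, integral_const_mul, sub_eq_add_neg]
    ring
  have hF := (integral_prod M hMi).symm.trans (integral_prod_symm M hMi)
  simp only [hR, hL] at hF
  rw [hF, integral_const_mul, integral_const_mul, vtWhittaker]
  simp only [Pi.neg_apply, sub_neg_eq_add]
  rw [← sub_eq_add_neg 1 (α 0)]
  field_simp

theorem continuous_vtKernel_line {α : Fin 3 → ℂ} (hα : ∀ i, (α i).re = 0) {σ₀ σ₁ : ℝ}
    (hσ₀ : 0 < σ₀) (hσ₁ : 0 < σ₁) :
    Continuous fun t : ℝ × ℝ =>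
      vtKernel α (σ₀ + t.1 * Complex.I) (σ₁ + t.2 * Complex.I) := by
  have hα' : ∀ i, (-α i).re = 0 := fun i => by simp [hα]
  unfold vtKernel
  refine Continuous.div (continuous_finsetProd _ fun i _ => ?_) ?_ fun t => ?_
  · exact ((continuous_Gammaℝ_line hσ₀ (hα i)).comp continuous_fst).mul
      (((continuous_Gammaℝ_line hσ₁ (hα' i)).comp continuous_snd).congr fun t => by
        simp [sub_eq_add_neg])
  · refine ((continuous_Gammaℝ_line (add_pos hσ₀ hσ₁) (β := 0) (by simp)).comp
      (by fun_prop : Continuous fun t : ℝ × ℝ => t.1 + t.2)).congr fun t => ?_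
    simp only [Function.comp]
    congr 1
    push_cast
    ring
  · refine Complex.Gammaℝ_ne_zero_of_re_pos ?_
    simp
    linarith

theorem exists_norm_vtKernel_line_le {α : Fin 3 → ℂ} (hα : ∀ i, (α i).re = 0) {σ₀ σ₁ : ℝ}
    (hσ₀ : 0 < σ₀) (hσ₁ : 0 < σ₁) :
    ∃ C : ℝ, ∀ t₀ t₁ : ℝ, ‖vtKernel α (σ₀ + t₀ * Complex.I) (σ₁ + t₁ * Complex.I)‖ ≤
      C * (‖Complex.Gammaℝ (σ₀ + t₀ * Complex.I + α 2)‖ *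
        ‖Complex.Gammaℝ (σ₁ + t₁ * Complex.I + -α 0)‖) := by
  refine ⟨∫ p, ‖mbInner α σ₀ σ₁ p‖, fun t₀ t₁ => ?_⟩
  have h := norm_vtKernel_le hα (s₀ := σ₀ + t₀ * Complex.I) (s₁ := σ₁ + t₁ * Complex.I)
    (by simpa using hσ₀) (by simpa using hσ₁)
  rw [show (σ₀ + t₀ * Complex.I : ℂ).re = σ₀ by simp,
    show (σ₁ + t₁ * Complex.I : ℂ).re = σ₁ by simp, sub_eq_add_neg] at h
  exact h.trans (le_of_eq (mul_comm _ _))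

theorem integrable_vtKernel_line {α : Fin 3 → ℂ} (hα : ∀ i, (α i).re = 0) {σ₀ σ₁ : ℝ}
    (hσ₀ : 0 < σ₀) (hσ₁ : 0 < σ₁) :
    Integrable fun t : ℝ × ℝ =>
      vtKernel α (σ₀ + t.1 * Complex.I) (σ₁ + t.2 * Complex.I) := by
  have hα0 : (-α 0).re = 0 := by simp [hα]
  obtain ⟨C, hC⟩ := exists_norm_vtKernel_line_le hα hσ₀ hσ₁
  exact (((integrable_Gammaℝ_line hσ₀ (hα 2)).norm.mul_prod
    (integrable_Gammaℝ_line hσ₁ hα0).norm).const_mul C).mono'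
    (continuous_vtKernel_line hα hσ₀ hσ₁).aestronglyMeasurable (ae_of_all _ fun t => hC t.1 t.2)

/-! ### The inverse Kontorovich-Lebedev transform -/

theorem abs_le_two_mul_cosh (v : ℝ) : |v| ≤ 2 * Real.cosh v := by
  rw [← Real.cosh_abs, Real.cosh_eq]
  have := Real.add_one_le_exp |v|
  have := Real.exp_pos (-|v|)
  linarith

theorem integrable_exp_neg_mul_cosh {x : ℝ} (hx : 0 < x) :
    Integrable fun v : ℝ => Real.exp (-x * Real.cosh v) := by
  refine (integrable_exp_neg_mul_abs (half_pos hx)).mono' (by fun_prop) (ae_of_all _ fun v => ?_)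
  rw [Real.norm_of_nonneg (by positivity), Real.exp_le_exp]
  nlinarith [abs_le_two_mul_cosh v]

/-- The Bessel function on the imaginary axis as a Fourier transform. -/
theorem besselK_line {x : ℝ} (hx : 0 < x) (t : ℝ) :
    besselK (t * Complex.I) x =
      1 / 2 * ∫ v : ℝ, (Real.exp (-x * Real.cosh v) : ℂ) * Complex.exp (t * Complex.I * v) := by
  have hi : Integrable fun v : ℝ =>
      (Real.exp (-x * Real.cosh v) : ℂ) * Complex.exp (t * Complex.I * v) := by
    refine (integrable_exp_neg_mul_cosh hx).mono' (by fun_prop) (ae_of_all _ fun v => ?_)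
    rw [norm_mul, Complex.norm_exp, Complex.norm_real]
    simp
  have hneg := integral_neg_eq_self (fun v : ℝ =>
      (Real.exp (-x * Real.cosh v) : ℂ) * Complex.exp (t * Complex.I * v)) volume
  have hi2 := hi.comp_neg
  set F : ℝ → ℂ := fun v => (Real.exp (-x * Real.cosh v) : ℂ) * Complex.cosh (t * Complex.I * v)
    with hF
  have hFe : ∀ v, F v = 1 / 2 * (((Real.exp (-x * Real.cosh v) : ℂ) * Complex.exp (t * Complex.I * v)) +
      ((Real.exp (-x * Real.cosh (-v)) : ℂ) * Complex.exp (t * Complex.I * (-v : ℝ)))) := by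
    intro v
    simp only [hF, Complex.cosh, Real.cosh_neg]
    push_cast
    ring_nf
  have hFi : Integrable F := ((hi.add hi2).const_mul (1 / 2)).congr (ae_of_all _ fun v => (hFe v).symm)
  have h1 : ∫ v, F v = ∫ v : ℝ, (Real.exp (-x * Real.cosh v) : ℂ) * Complex.exp (t * Complex.I * v) := by
    simp only [hFe]
    rw [integral_const_mul, integral_add hi hi2, hneg]
    ring
  have h2 : ∫ v, F v = 2 * ∫ v in Ioi (0 : ℝ), F v := by
    have hsym : ∫ v in Iic (0 : ℝ), F v = ∫ v in Ioi (0 : ℝ), F v := by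
      have := integral_comp_neg_Iic (0 : ℝ) F
      rw [neg_zero] at this
      rw [← this]
      refine setIntegral_congr_fun measurableSet_Iic fun v _ => ?_
      simp [hF, Complex.cosh_neg]
    rw [← setIntegral_univ, ← Iic_union_Ioi (a := (0 : ℝ)), setIntegral_union (Iic_disjoint_Ioi le_rfl)
      measurableSet_Ioi hFi.integrableOn hFi.integrableOn, hsym]
    ring
  rw [← h1, h2, besselK]
  ring

/-- The density in the inverse Kontorovich-Lebedev transform, up to a constant:
`1 / |Γ(μ)|² = -μ sin(πμ) / π` on the imaginary axis. -/
def klWeight (H : ℂ → ℂ) (μ : ℂ) : ℂ := H μ * (μ * Complex.sin (π * μ))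

/-- The reflection formula on the imaginary axis. It remains true at `t = 0`, where both sides
vanish because of the conventions `Γ(0) = 0` and `1 / 0 = 0`, in agreement with the limit `t → 0`. -/
theorem inv_norm_Gamma_sq (t : ℝ) :
    1 / ((‖Complex.Gamma (t * Complex.I)‖ ^ 2 : ℝ) : ℂ) =
      -((t * Complex.I) * Complex.sin (π * (t * Complex.I))) / π := by
  by_cases ht : t = 0
  · simp [ht, Complex.Gamma_zero]
  have hz : (t * Complex.I : ℂ) ≠ 0 := by simp [ht]
  have h1 := Complex.Gamma_mul_Gamma_one_sub (t * Complex.I)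
  rw [show (1 - t * Complex.I : ℂ) = -(t * Complex.I) + 1 by ring,
    Complex.Gamma_add_one _ (neg_ne_zero.2 hz)] at h1
  have hconj : (starRingEnd ℂ) (t * Complex.I) = -(t * Complex.I) := by simp
  have h2 := Complex.Gamma_conj (t * Complex.I)
  rw [hconj] at h2
  rw [h2] at h1
  have h3 : ((‖Complex.Gamma (t * Complex.I)‖ ^ 2 : ℝ) : ℂ) =
      Complex.Gamma (t * Complex.I) * (starRingEnd ℂ) (Complex.Gamma (t * Complex.I)) := by
    rw [Complex.mul_conj, Complex.normSq_eq_norm_sq]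
  have h4 : ((‖Complex.Gamma (t * Complex.I)‖ ^ 2 : ℝ) : ℂ) * -(t * Complex.I) =
      π / Complex.sin (π * (t * Complex.I)) := by
    rw [h3, ← h1]; ring
  have hpi : (π : ℂ) ≠ 0 := by exact_mod_cast Real.pi_ne_zero
  have hΓ : ((‖Complex.Gamma (t * Complex.I)‖ ^ 2 : ℝ) : ℂ) ≠ 0 := by
    have : Complex.Gamma (t * Complex.I) ≠ 0 := by
      refine Complex.Gamma_ne_zero fun m hm => ?_
      have := congrArg Complex.im hm
      simp at this
      exact ht this
    exact_mod_cast (by positivity : ‖Complex.Gamma (t * Complex.I)‖ ^ 2 ≠ 0)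
  have hs : Complex.sin (π * (t * Complex.I)) ≠ 0 := by
    intro h0
    rw [h0, div_zero] at h4
    exact (mul_ne_zero hΓ (neg_ne_zero.2 hz)) h4
  rw [eq_div_iff hs] at h4
  rw [div_eq_div_iff hΓ hpi, one_mul]
  linear_combination -h4

theorem norm_sin_le (z : ℂ) : ‖Complex.sin z‖ ≤ Real.exp ‖z‖ := by
  rw [Complex.sin, norm_div, norm_mul, Complex.norm_I, mul_one]
  have h1 : ‖Complex.exp (-z * Complex.I)‖ ≤ Real.exp ‖z‖ := by
    refine (Complex.norm_exp_le_exp_norm _).trans ?_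
    simp
  have h2 : ‖Complex.exp (z * Complex.I)‖ ≤ Real.exp ‖z‖ := by
    refine (Complex.norm_exp_le_exp_norm _).trans ?_
    simp
  have := norm_sub_le (Complex.exp (-z * Complex.I)) (Complex.exp (z * Complex.I))
  simp only [Complex.norm_ofNat]
  linarith

/-- The decay of `H` outweighs the growth of `sin(πμ)`, uniformly in the strip. -/
theorem exists_norm_klWeight_le {η : ℝ} {H : ℂ → ℂ} (hH : IsTestFunction η H) :
    ∃ C : ℝ, 0 ≤ C ∧ ∀ μ : ℂ, |μ.re| < 2 * η → ‖klWeight H μ‖ ≤ C * Real.exp (-1 * |μ.im|) := by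
  obtain ⟨C, hC⟩ := hH.decay
  refine ⟨|C|, abs_nonneg _, fun μ hμ => ?_⟩
  have h1 := hC μ hμ
  have h2 := norm_sin_le (π * μ)
  rw [norm_mul, Complex.norm_real, Real.norm_of_nonneg Real.pi_nonneg] at h2
  have h3 : ‖μ‖ ≤ Real.exp ‖μ‖ := by linarith [Real.add_one_le_exp ‖μ‖]
  rw [klWeight, norm_mul, norm_mul]
  calc ‖H μ‖ * (‖μ‖ * ‖Complex.sin (π * μ)‖)
      ≤ (|C| * Real.exp (-2 * π * ‖μ‖)) * (Real.exp ‖μ‖ * Real.exp (π * ‖μ‖)) := by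
        gcongr
        exact h1.trans (by gcongr; exact le_abs_self C)
    _ = |C| * Real.exp (-(π - 1) * ‖μ‖) := by
        rw [mul_assoc, ← Real.exp_add, ← Real.exp_add]
        congr 2; ring
    _ ≤ _ := by
        refine mul_le_mul_of_nonneg_left (Real.exp_le_exp.2 ?_) (abs_nonneg _)
        have := Real.pi_gt_three
        have := Complex.abs_im_le_norm μ
        nlinarith [norm_nonneg μ]

theorem continuous_klWeight_line {η : ℝ} {H : ℂ → ℂ} (hH : IsTestFunction η H) {σ : ℝ}
    (hσ : |σ| < 2 * η) : Continuous fun t : ℝ => klWeight H (σ + t * Complex.I) := by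
  have hc : ContinuousOn (klWeight H) {μ | |μ.re| < 2 * η} := by
    unfold klWeight
    exact hH.holo.continuousOn.mul (by fun_prop)
  refine hc.comp_continuous (by fun_prop) fun t => ?_
  simpa using hσ

theorem integrable_klWeight_line {η : ℝ} {H : ℂ → ℂ} (hH : IsTestFunction η H) {σ : ℝ}
    (hσ : |σ| < 2 * η) : Integrable fun t : ℝ => klWeight H (σ + t * Complex.I) := by
  obtain ⟨C, _, hC⟩ := exists_norm_klWeight_le hH
  refine ((integrable_exp_neg_mul_abs one_pos).const_mul C).mono'
    (continuous_klWeight_line hH hσ).aestronglyMeasurable (ae_of_all _ fun t => ?_)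
  simpa using hC (σ + t * Complex.I) (by simpa using hσ)

/-- The Fourier transform of the density on the imaginary axis. -/
def klDual (H : ℂ → ℂ) (v : ℝ) : ℂ :=
  ∫ t : ℝ, klWeight H (t * Complex.I) * Complex.exp (t * Complex.I * v)

/-- The line of integration in `klDual` is moved to `Re μ = σ`. -/
theorem klDual_eq {η : ℝ} {H : ℂ → ℂ} (hH : IsTestFunction η H) {σ : ℝ}
    (hσ : |σ| < 2 * η) (v : ℝ) :
    klDual H v = Complex.exp (σ * v) *
      ∫ t : ℝ, klWeight H (σ + t * Complex.I) * Complex.exp (t * Complex.I * v) := by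
  obtain ⟨C, hC0, hC⟩ := exists_norm_klWeight_le hH
  have hη : 0 < 2 * η := (abs_nonneg σ).trans_lt hσ
  have hu : ∀ y ∈ uIcc 0 (-σ), |y| ≤ |σ| := by
    intro y hy
    rcases le_total 0 σ with h | h
    · rw [uIcc_of_ge (by linarith)] at hy
      rw [abs_of_nonpos hy.2, abs_of_nonneg h]; linarith [hy.1]
    · rw [uIcc_of_le (by linarith)] at hy
      rw [abs_of_nonneg hy.1, abs_of_nonpos h]; exact hy.2
  have hb : ∀ x y : ℝ, y ∈ uIcc 0 (-σ) →
      ‖klWeight H (Complex.I * (x + y * Complex.I)) *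
        Complex.exp (Complex.I * (x + y * Complex.I) * v)‖ ≤
      (C * Real.exp (|σ| * |v|)) * Real.exp (-1 * |x|) := by
    intro x y hy
    have hre : (Complex.I * (x + y * Complex.I)).re = -y := by simp
    have him : (Complex.I * (x + y * Complex.I)).im = x := by simp
    have h1 := hC (Complex.I * (x + y * Complex.I))
      (by rw [hre, abs_neg]; exact (hu y hy).trans_lt hσ)
    rw [him] at h1
    rw [norm_mul, Complex.norm_exp, Complex.re_mul_ofReal, hre]
    have h2 : -y * v ≤ |σ| * |v| := by
      refine (le_abs_self _).trans ?_
      rw [abs_mul, abs_neg]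
      exact mul_le_mul_of_nonneg_right (hu y hy) (abs_nonneg _)
    calc _ ≤ (C * Real.exp (-1 * |x|)) * Real.exp (|σ| * |v|) := by gcongr
      _ = _ := by ring
  have hlim : ∀ l : Filter ℝ, Filter.Tendsto (fun x : ℝ => |x|) l Filter.atTop →
      Filter.Tendsto (fun x : ℝ => (C * Real.exp (|σ| * |v|)) * Real.exp (-1 * |x|)) l (nhds 0) := by
    intro l hl
    have := (Real.tendsto_exp_atBot.comp
      (Filter.Tendsto.const_mul_atTop_of_neg (by norm_num : (-1 : ℝ) < 0) hl)).const_mul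
        (C * Real.exp (|σ| * |v|))
    simpa using this
  have hdiff : DifferentiableOn ℂ (fun z : ℂ => klWeight H (Complex.I * z) *
      Complex.exp (Complex.I * z * v)) {z | z.im ∈ uIcc 0 (-σ)} := by
    have hK : DifferentiableOn ℂ (klWeight H) {μ | |μ.re| < 2 * η} := by
      unfold klWeight
      exact hH.holo.mul (by fun_prop)
    refine (hK.comp (by fun_prop) fun z hz => ?_).mul (by fun_prop)
    simpa using (hu _ hz).trans_lt hσ
  have hint : ∀ y ∈ uIcc 0 (-σ), Integrable fun x : ℝ =>
      klWeight H (Complex.I * (x + y * Complex.I)) *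
        Complex.exp (Complex.I * (x + y * Complex.I) * v) := by
    intro y hy
    refine ((integrable_exp_neg_mul_abs one_pos).const_mul (C * Real.exp (|σ| * |v|))).mono' ?_
      (ae_of_all _ fun x => hb x y hy)
    have := continuous_klWeight_line hH (σ := -y) (by rw [abs_neg]; exact (hu y hy).trans_lt hσ)
    refine Continuous.aestronglyMeasurable ((this.congr fun x => ?_).mul (by fun_prop))
    congr 1
    push_cast
    linear_combination (-(y : ℂ)) * Complex.I_mul_I
  have h := integral_horizontal_shift hdiff hb (hlim _ Filter.tendsto_abs_atTop_atTop)
    (hlim _ Filter.tendsto_abs_atBot_atTop) (hint 0 left_mem_uIcc) (hint (-σ) right_mem_uIcc)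
  rw [klDual, ← integral_const_mul]
  refine Eq.trans (integral_congr_ae (ae_of_all _ fun t => ?_)) (h.trans
    (integral_congr_ae (ae_of_all _ fun t => ?_)))
  · simp [mul_comm]
  · simp only
    have e1 : Complex.I * (t + ((-σ : ℝ) : ℂ) * Complex.I) = σ + t * Complex.I := by
      push_cast
      linear_combination (-(σ : ℂ)) * Complex.I_mul_I
    rw [e1, add_mul, Complex.exp_add]
    ring

/-- The lines of integration `Re μ = ±16` show that `klDual` decays fast enough to be integrated
against `cosh^j` for `j ≤ 15`. -/
theorem exists_norm_klDual_le {η : ℝ} {H : ℂ → ℂ} (hH : IsTestFunction η H) (hη : 40 < η) :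
    ∃ C : ℝ, 0 ≤ C ∧ ∀ v : ℝ, ‖klDual H v‖ ≤ C * Real.exp (-16 * |v|) := by
  have hb : ∀ σ : ℝ, |σ| = 16 → ∀ v : ℝ, ‖klDual H v‖ ≤ Real.exp (σ * v) *
      ∫ t : ℝ, ‖klWeight H (σ + t * Complex.I)‖ := by
    intro σ hσ v
    rw [klDual_eq hH (by rw [hσ]; linarith) v, norm_mul, Complex.norm_exp, Complex.re_mul_ofReal,
      Complex.ofReal_re]
    gcongr
    refine (norm_integral_le_integral_norm _).trans (le_of_eq ?_)
    refine integral_congr_ae (ae_of_all _ fun t => ?_)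
    simp only
    rw [norm_mul, Complex.norm_exp]
    simp
  refine ⟨(∫ t : ℝ, ‖klWeight H ((16 : ℝ) + t * Complex.I)‖) +
    ∫ t : ℝ, ‖klWeight H ((-16 : ℝ) + t * Complex.I)‖, by positivity, fun v => ?_⟩
  have p1 : 0 ≤ ∫ t : ℝ, ‖klWeight H ((16 : ℝ) + t * Complex.I)‖ := by positivity
  have p2 : 0 ≤ ∫ t : ℝ, ‖klWeight H ((-16 : ℝ) + t * Complex.I)‖ := by positivity
  rcases le_total 0 v with h | h
  · refine (hb (-16) (by norm_num) v).trans ?_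
    rw [abs_of_nonneg h, mul_comm]
    gcongr
    linarith
  · refine (hb 16 (by norm_num) v).trans ?_
    rw [abs_of_nonpos h, mul_comm, neg_mul_neg]
    gcongr
    linarith

theorem stronglyMeasurable_klDual {η : ℝ} {H : ℂ → ℂ} (hH : IsTestFunction η H) (hη : 40 < η) :
    StronglyMeasurable (klDual H) := by
  have hc := continuous_klWeight_line hH (σ := 0) (by rw [abs_zero]; linarith)
  simp only [Complex.ofReal_zero, zero_add] at hc
  have h2 : Continuous fun p : ℝ × ℝ => klWeight H (p.2 * Complex.I) *
      Complex.exp (p.2 * Complex.I * p.1) := (hc.comp continuous_snd).mul (by fun_prop)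
  exact h2.stronglyMeasurable.integral_prod_right

/-- `H^♭(y)` as an integral of `exp(-2πy cosh v)` against `klDual H`. -/
theorem invKL_eq {η : ℝ} {H : ℂ → ℂ} (hH : IsTestFunction η H) (hη : 40 < η) {y : ℝ} (hy : 0 < y) :
    invKL H y = -(√y / (4 * π ^ 2) : ℝ) *
      ∫ v : ℝ, (Real.exp (-(2 * π * y) * Real.cosh v) : ℂ) * klDual H v := by
  have hx : 0 < 2 * π * y := by positivity
  have hpi : (π : ℂ) ≠ 0 := by exact_mod_cast Real.pi_ne_zero
  have h0 : |(0 : ℝ)| < 2 * η := by rw [abs_zero]; linarith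
  have hi := integrable_klWeight_line hH h0
  have hc := continuous_klWeight_line hH h0
  simp only [Complex.ofReal_zero, zero_add] at hi hc
  set M : ℝ × ℝ → ℂ := fun p => klWeight H (p.1 * Complex.I) *
    ((Real.exp (-(2 * π * y) * Real.cosh p.2) : ℂ) * Complex.exp (p.1 * Complex.I * p.2)) with hM
  have hMi : Integrable M := by
    refine (hi.norm.mul_prod (integrable_exp_neg_mul_cosh hx)).mono' ?_ (ae_of_all _ fun p => ?_)
    · exact ((hc.comp continuous_fst).mul (by fun_prop)).aestronglyMeasurable
    · rw [hM, norm_mul, norm_mul, Complex.norm_real, Complex.norm_exp]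
      simp
  have hF := (integral_prod M hMi).symm.trans (integral_prod_symm M hMi)
  have hv : ∀ v : ℝ, ∫ t : ℝ, M (t, v) =
      (Real.exp (-(2 * π * y) * Real.cosh v) : ℂ) * klDual H v := by
    intro v
    rw [klDual, ← integral_const_mul]
    refine integral_congr_ae (ae_of_all _ fun t => ?_)
    simp only [hM]
    ring
  simp only [hv] at hF
  rw [← hF, invKL, vint, ← integral_const_mul, ← integral_const_mul, ← integral_const_mul]
  refine integral_congr_ae (ae_of_all _ fun t => ?_)
  simp only [hM, Complex.ofReal_zero, zero_add]
  rw [integral_const_mul, whittaker₂, besselK_line hx t, div_eq_mul_one_div _ ((_ : ℝ) : ℂ),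
    inv_norm_Gamma_sq, klWeight]
  push_cast
  field_simp
  ring

open FourierTransform in
/-- The exponential moments of `klDual H` are values of the density, by Fourier inversion. -/
theorem integral_klDual_mul_exp {η : ℝ} {H : ℂ → ℂ} (hH : IsTestFunction η H) (hη : 40 < η)
    {σ : ℝ} (hσ : |σ| < 16) :
    Integrable (fun v : ℝ => klDual H v * Complex.exp (σ * v)) ∧
    ∫ v : ℝ, klDual H v * Complex.exp (σ * v) = 2 * π * klWeight H (-σ) := by
  have hσ' : |-σ| < 2 * η := by rw [abs_neg]; linarith
  obtain ⟨C, hC0, hC⟩ := exists_norm_klDual_le hH hη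
  have hint : Integrable (fun v : ℝ => klDual H v * Complex.exp (σ * v)) := by
    refine ((integrable_exp_neg_mul_abs (c := 16 - |σ|) (by linarith)).const_mul C).mono'
      ((stronglyMeasurable_klDual hH hη).aestronglyMeasurable.mul (by fun_prop))
      (ae_of_all _ fun v => ?_)
    rw [norm_mul, Complex.norm_exp, Complex.re_mul_ofReal, Complex.ofReal_re]
    have h1 : σ * v ≤ |σ| * |v| := (le_abs_self _).trans (abs_mul σ v).le
    calc _ ≤ (C * Real.exp (-16 * |v|)) * Real.exp (|σ| * |v|) := by gcongr; exact hC v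
      _ = _ := by rw [mul_assoc, ← Real.exp_add]; ring_nf
  refine ⟨hint, ?_⟩
  set u : ℝ → ℂ := fun t => klWeight H ((-σ : ℝ) + t * Complex.I) with hu
  have huc : Continuous u := continuous_klWeight_line hH hσ'
  have hui : Integrable u := integrable_klWeight_line hH hσ'
  have hdual : ∀ v : ℝ, klDual H v * Complex.exp (σ * v) = 𝓕⁻ u (v / (2 * π)) := by
    intro v
    rw [klDual_eq hH hσ' v, Real.fourierInv_eq', mul_right_comm, ← Complex.exp_add]
    have : ((-σ : ℝ) : ℂ) * v + σ * v = 0 := by push_cast; ring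
    rw [this, Complex.exp_zero, one_mul]
    refine integral_congr_ae (ae_of_all _ fun t => ?_)
    simp only [hu, smul_eq_mul]
    rw [mul_comm]
    congr 2
    have hpi : (π : ℂ) ≠ 0 := by exact_mod_cast Real.pi_ne_zero
    simp only [RCLike.inner_apply, conj_trivial]
    push_cast
    field_simp
  have hint2 : Integrable (𝓕⁻ u) := by
    have h2π : (2 * π) ≠ 0 := by positivity
    have := hint.comp_mul_right' h2π
    simp only [hdual, mul_div_cancel_right₀ _ h2π] at this
    exact this
  have hint3 : Integrable (𝓕 u) := by
    have := hint2.comp_neg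
    refine this.congr (ae_of_all _ fun w => ?_)
    simp only
    rw [Real.fourierInv_eq_fourier_neg, neg_neg]
  have hinv := hui.fourier_fourierInv_eq hint3 (v := 0) huc.continuousAt
  rw [Real.fourier_eq'] at hinv
  simp only [inner_zero_right, mul_zero, Complex.ofReal_zero, zero_mul, Complex.exp_zero,
    one_smul] at hinv
  simp only [hdual]
  rw [Measure.integral_comp_div (𝓕⁻ u), hinv, abs_of_pos (by positivity), hu]
  simp

/-- The zeros of `sin(πμ)`: these are responsible for the decay of `H^♭(y)` at `y = 0`. -/
theorem klWeight_intCast (H : ℂ → ℂ) (n : ℤ) : klWeight H n = 0 := by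
  rw [klWeight, mul_comm (π : ℂ), Complex.sin_int_mul_pi, mul_zero, mul_zero]

/-- `cosh^j` is a combination of `exp(mv)` with integers `|m| ≤ j`, and the corresponding moments
vanish with the density. -/
theorem integral_klDual_mul_cosh_pow {η : ℝ} {H : ℂ → ℂ} (hH : IsTestFunction η H) (hη : 40 < η)
    {j : ℕ} (hj : j < 16) :
    Integrable (fun v : ℝ => klDual H v * (Real.cosh v : ℂ) ^ j) ∧
    ∫ v : ℝ, klDual H v * (Real.cosh v : ℂ) ^ j = 0 := by
  have hexp : ∀ v : ℝ, klDual H v * (Real.cosh v : ℂ) ^ j = ∑ m ∈ Finset.range (j + 1),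
      klDual H v * Complex.exp (((2 * m - j : ℤ) : ℝ) * v) * ((1 / 2) ^ j * (j.choose m : ℂ)) := by
    intro v
    rw [Complex.ofReal_cosh, Complex.cosh, div_pow, add_pow, Finset.sum_div, Finset.mul_sum]
    refine Finset.sum_congr rfl fun m hm => ?_
    have hmj : m ≤ j := Nat.lt_succ_iff.1 (Finset.mem_range.1 hm)
    rw [← Complex.exp_nat_mul, ← Complex.exp_nat_mul, ← Complex.exp_add, Nat.cast_sub hmj,
      show (m : ℂ) * v + ((j : ℂ) - m) * -v = (((2 * m - j : ℤ) : ℝ) : ℂ) * v by push_cast; ring,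
      one_div_pow]
    ring
  have hs : ∀ m ∈ Finset.range (j + 1), |((2 * m - j : ℤ) : ℝ)| < 16 := by
    intro m hm
    have := Finset.mem_range.1 hm
    have h1 : |(2 * m - j : ℤ)| < 16 := by rw [abs_lt]; constructor <;> omega
    exact_mod_cast h1
  have hi := fun m hm => (integral_klDual_mul_exp hH hη (hs m hm)).1.mul_const
    ((1 / 2 : ℂ) ^ j * (j.choose m : ℂ))
  simp only [hexp]
  refine ⟨integrable_finsetSum _ hi, ?_⟩
  rw [integral_finsetSum _ hi]
  refine Finset.sum_eq_zero fun m hm => ?_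
  rw [integral_mul_const, (integral_klDual_mul_exp hH hη (hs m hm)).2]
  have := klWeight_intCast H (-(2 * m - j : ℤ))
  push_cast at this ⊢
  rw [this]
  simp

/-- Taylor's theorem for `exp(-x)`, uniformly on the half-line. -/
theorem exists_abs_exp_neg_sub_le (N : ℕ) : ∃ C : ℝ, 0 ≤ C ∧ ∀ x : ℝ, 0 ≤ x →
    |Real.exp (-x) - ∑ m ∈ Finset.range N, (-x) ^ m / m.factorial| ≤ C * x ^ N := by
  refine ⟨Real.exp 1 + (1 + N), by positivity, fun x hx => ?_⟩
  have hxN : 0 ≤ x ^ N := by positivity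
  rcases le_total x 1 with h | h
  · have h1 := Complex.norm_exp_sub_sum_le_norm_mul_exp (-x : ℝ) N
    have h2 : Complex.exp ((-x : ℝ) : ℂ) - ∑ m ∈ Finset.range N, ((-x : ℝ) : ℂ) ^ m / m.factorial =
        ((Real.exp (-x) - ∑ m ∈ Finset.range N, (-x) ^ m / m.factorial : ℝ) : ℂ) := by
      push_cast; rfl
    rw [h2, Complex.norm_real, Complex.norm_real, Real.norm_eq_abs, Real.norm_eq_abs, abs_neg,
      abs_of_nonneg hx] at h1
    refine h1.trans ?_
    rw [mul_comm]
    gcongr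
    have : Real.exp x ≤ Real.exp 1 := Real.exp_le_exp.2 h
    have : (0 : ℝ) ≤ N := N.cast_nonneg
    linarith
  · have hone : 1 ≤ x ^ N := one_le_pow₀ h
    have h1 : |∑ m ∈ Finset.range N, (-x) ^ m / m.factorial| ≤ N * x ^ N := by
      refine (Finset.abs_sum_le_sum_abs _ _).trans ?_
      have : ∀ m ∈ Finset.range N, |(-x) ^ m / (m.factorial : ℝ)| ≤ x ^ N := by
        intro m hm
        rw [abs_div, abs_pow, abs_neg, abs_of_nonneg hx, Nat.abs_cast]
        have hf : (1 : ℝ) ≤ m.factorial := by exact_mod_cast m.factorial_pos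
        exact (div_le_self (by positivity) hf).trans
          (pow_le_pow_right₀ h (Finset.mem_range.1 hm).le)
      simpa using Finset.sum_le_sum this
    have h2 : |Real.exp (-x)| ≤ 1 := by
      rw [abs_of_pos (Real.exp_pos _)]
      exact Real.exp_le_one_iff.2 (by linarith)
    have h3 := abs_sub (Real.exp (-x)) (∑ m ∈ Finset.range N, (-x) ^ m / (m.factorial : ℝ))
    have h4 : 0 ≤ Real.exp 1 * x ^ N := by positivity
    nlinarith

/-- `H^♭(y)` vanishes to high order at `y = 0`: the first terms of the expansion of
`exp(-2πy cosh v)` do not contribute, since the density vanishes at the integers. -/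
theorem exists_norm_invKL_le {η : ℝ} {H : ℂ → ℂ} (hH : IsTestFunction η H) (hη : 40 < η) :
    ∃ C : ℝ, 0 ≤ C ∧ ∀ y : ℝ, 0 < y → ‖invKL H y‖ ≤ C * √y ∧ ‖invKL H y‖ ≤ C * √y * y ^ 15 := by
  obtain ⟨C, hC0, hC⟩ := exists_norm_klDual_le hH hη
  obtain ⟨D, hD0, hD⟩ := exists_abs_exp_neg_sub_le 15
  have hmeas := (stronglyMeasurable_klDual hH hη).aestronglyMeasurable (μ := volume)
  have hI0 : Integrable fun v : ℝ => ‖klDual H v‖ := by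
    have := (integral_klDual_mul_cosh_pow hH hη (j := 0) (by norm_num)).1
    simpa using this.norm
  have hI15 : Integrable fun v : ℝ => ‖klDual H v * (Real.cosh v : ℂ) ^ 15‖ :=
    (integral_klDual_mul_cosh_pow hH hη (j := 15) (by norm_num)).1.norm
  set J0 := ∫ v : ℝ, ‖klDual H v‖ with hJ0
  set J15 := ∫ v : ℝ, ‖klDual H v * (Real.cosh v : ℂ) ^ 15‖ with hJ15
  have hJ0' : 0 ≤ J0 := by positivity
  have hJ15' : 0 ≤ J15 := by positivity
  refine ⟨J0 + D * (2 * π) ^ 15 * J15, by positivity, fun y hy => ?_⟩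
  have hpre : ‖(-(√y / (4 * π ^ 2) : ℝ) : ℂ)‖ ≤ √y := by
    rw [norm_neg, Complex.norm_real, Real.norm_of_nonneg (by positivity)]
    refine div_le_self (by positivity) ?_
    nlinarith [Real.pi_gt_three]
  rw [invKL_eq hH hη hy, norm_mul]
  have hx : 0 < 2 * π * y := by positivity
  constructor
  · have h1 : ‖∫ v : ℝ, (Real.exp (-(2 * π * y) * Real.cosh v) : ℂ) * klDual H v‖ ≤ J0 := by
      refine norm_integral_le_of_norm_le hI0 (ae_of_all _ fun v => ?_)
      rw [norm_mul, Complex.norm_real, Real.norm_of_nonneg (by positivity)]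
      refine mul_le_of_le_one_left (norm_nonneg _) (Real.exp_le_one_iff.2 ?_)
      have := Real.cosh_pos v
      nlinarith
    calc _ ≤ √y * J0 := by gcongr
      _ ≤ √y * (J0 + D * (2 * π) ^ 15 * J15) := by
        gcongr
        have : 0 ≤ D * (2 * π) ^ 15 * J15 := by positivity
        linarith
      _ = _ := by ring
  -- The Taylor polynomial of degree `14` in `y cosh v` integrates to zero, and the remainder is
  -- `O((y cosh v)^15)`.
  · have hsum : ∫ v : ℝ, ∑ m ∈ Finset.range 15, klDual H v * (Real.cosh v : ℂ) ^ m *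
        ((-(2 * π * y)) ^ m / m.factorial : ℂ) = 0 := by
      rw [integral_finsetSum _ fun m hm => ((integral_klDual_mul_cosh_pow hH hη
        ((Finset.mem_range.1 hm).trans (by norm_num))).1.mul_const _)]
      refine Finset.sum_eq_zero fun m hm => ?_
      rw [integral_mul_const, (integral_klDual_mul_cosh_pow hH hη
        ((Finset.mem_range.1 hm).trans (by norm_num))).2, zero_mul]
    have hsi : Integrable fun v : ℝ => ∑ m ∈ Finset.range 15, klDual H v * (Real.cosh v : ℂ) ^ m *
        ((-(2 * π * y)) ^ m / m.factorial : ℂ) :=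
      integrable_finsetSum _ fun m hm => ((integral_klDual_mul_cosh_pow hH hη
        ((Finset.mem_range.1 hm).trans (by norm_num))).1.mul_const _)
    have hei : Integrable fun v : ℝ =>
        (Real.exp (-(2 * π * y) * Real.cosh v) : ℂ) * klDual H v := by
      refine hI0.mono' (AEStronglyMeasurable.mul (by fun_prop) hmeas) (ae_of_all _ fun v => ?_)
      rw [norm_mul, Complex.norm_real, Real.norm_of_nonneg (by positivity)]
      refine mul_le_of_le_one_left (norm_nonneg _) (Real.exp_le_one_iff.2 ?_)
      have := Real.cosh_pos v
      nlinarith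
    have h1 : ‖∫ v : ℝ, (Real.exp (-(2 * π * y) * Real.cosh v) : ℂ) * klDual H v‖ ≤
        D * (2 * π * y) ^ 15 * J15 := by
      rw [← sub_zero (∫ v : ℝ, (Real.exp (-(2 * π * y) * Real.cosh v) : ℂ) * klDual H v), ← hsum,
        ← integral_sub hei hsi, hJ15, ← integral_const_mul]
      refine norm_integral_le_of_norm_le (hI15.const_mul _) (ae_of_all _ fun v => ?_)
      have hc := Real.cosh_pos v
      have h2 := hD (2 * π * y * Real.cosh v) (by positivity)
      have h3 : (Real.exp (-(2 * π * y) * Real.cosh v) : ℂ) * klDual H v -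
          ∑ m ∈ Finset.range 15, klDual H v * (Real.cosh v : ℂ) ^ m *
            ((-(2 * π * y)) ^ m / m.factorial : ℂ) =
          klDual H v * ((Real.exp (-(2 * π * y * Real.cosh v)) -
            ∑ m ∈ Finset.range 15, (-(2 * π * y * Real.cosh v)) ^ m / m.factorial : ℝ) : ℂ) := by
        rw [Complex.ofReal_sub, mul_sub, Complex.ofReal_sum, Finset.mul_sum]
        congr 1
        · rw [mul_comm, neg_mul]
        · refine Finset.sum_congr rfl fun m _ => ?_
          push_cast
          rw [show -(2 * (π : ℂ) * y * Complex.cosh v) = -(2 * π * y) * Complex.cosh v by ring,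
            mul_pow]
          ring
      rw [h3, norm_mul, Complex.norm_real, Real.norm_eq_abs, norm_mul, norm_pow,
        Complex.norm_real, Real.norm_of_nonneg hc.le]
      calc _ ≤ ‖klDual H v‖ * (D * (2 * π * y * Real.cosh v) ^ 15) := by gcongr
        _ = _ := by ring
    calc _ ≤ √y * (D * (2 * π * y) ^ 15 * J15) := by gcongr
      _ = (D * (2 * π) ^ 15 * J15) * √y * y ^ 15 := by ring
      _ ≤ _ := by
        gcongr
        linarith

theorem aestronglyMeasurable_invKL {η : ℝ} {H : ℂ → ℂ} (hH : IsTestFunction η H) (hη : 40 < η) :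
    AEStronglyMeasurable (invKL H) (volume.restrict (Ioi 0)) := by
  have h1 : StronglyMeasurable fun p : ℝ × ℝ =>
      (Real.exp (-(2 * π * p.1) * Real.cosh p.2) : ℂ) * klDual H p.2 :=
    (by fun_prop : Continuous fun p : ℝ × ℝ =>
      (Real.exp (-(2 * π * p.1) * Real.cosh p.2) : ℂ)).stronglyMeasurable.mul
      ((stronglyMeasurable_klDual hH hη).comp_measurable measurable_snd)
  have h2 : StronglyMeasurable fun y : ℝ => (-(√y / (4 * π ^ 2) : ℝ) : ℂ) *
      ∫ v : ℝ, (Real.exp (-(2 * π * y) * Real.cosh v) : ℂ) * klDual H v :=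
    (by fun_prop : Continuous fun y : ℝ => (-(√y / (4 * π ^ 2) : ℝ) : ℂ)).stronglyMeasurable.mul
      h1.integral_prod_right
  refine h2.aestronglyMeasurable.congr ?_
  filter_upwards [ae_restrict_mem measurableSet_Ioi] with y hy
  exact (invKL_eq hH hη hy).symm

/-! ### The symmetry of the Fourier coefficients -/

theorem e_add (x y : ℝ) : e (x + y) = e x * e y := by
  rw [e, e, e, ← Complex.exp_add]
  congr 1
  push_cast
  ring

theorem e_intCast (n : ℤ) : e n = 1 := by
  rw [e, ← Complex.exp_int_mul_two_pi_mul_I n]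
  congr 1
  push_cast
  ring

theorem continuous_e : Continuous e := by
  unfold e
  fun_prop

theorem det_unip_mul_torus_ne_zero (x z w : ℝ) {y₀ y₁ : ℝ} (h₀ : 0 < y₀) (h₁ : 0 < y₁) :
    (unip x z w * torus y₀ y₁).det ≠ 0 := by
  have : (unip x z w * torus y₀ y₁).det = y₀ * y₁ * y₀ := by
    rw [Matrix.det_mul, unip, torus]
    simp [Matrix.det_fin_three]
  rw [this]
  positivity

theorem unip_mul_torus (x z w y₀ y₁ : ℝ) : unip x z w * torus y₀ y₁ =
    !![y₀ * y₁, x * y₀, z; 0, y₀, w; 0, 0, 1] := by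
  ext i j
  fin_cases i <;> fin_cases j <;> simp [unip, torus, Matrix.mul_apply, Fin.sum_univ_three]

theorem IsMaassCuspForm.continuous_unip {Φ : Mat3 → ℂ} {α : Fin 3 → ℂ} (hΦ : IsMaassCuspForm Φ α)
    {y₀ y₁ : ℝ} (h₀ : 0 < y₀) (h₁ : 0 < y₁) :
    Continuous fun p : ℝ × ℝ × ℝ => Φ (unip p.1 p.2.1 p.2.2 * torus y₀ y₁) := by
  have hc : Continuous fun p : ℝ × ℝ × ℝ => (fun i j =>
      (unip p.1 p.2.1 p.2.2 * torus y₀ y₁) i j : Fin 3 → Fin 3 → ℝ) := by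
    simp only [unip_mul_torus]
    refine continuous_pi fun i => continuous_pi fun j => ?_
    fin_cases i <;> fin_cases j <;> simp <;> fun_prop
  have := hΦ.smooth.continuousOn.comp_continuous hc fun p =>
    det_unip_mul_torus_ne_zero p.1 p.2.1 p.2.2 h₀ h₁
  exact this

/-- Left invariance under an integral unipotent matrix. -/
theorem IsMaassCuspForm.map_unip_add {Φ : Mat3 → ℂ} {α : Fin 3 → ℂ} (hΦ : IsMaassCuspForm Φ α)
    (a b : ℤ) (x z w : ℝ) {y₀ y₁ : ℝ} (h₀ : 0 < y₀) (h₁ : 0 < y₁) :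
    Φ (unip (x + a) (z + b + a * w) w * torus y₀ y₁) = Φ (unip x z w * torus y₀ y₁) := by
  rw [← hΦ.left_inv ⟨!![1, a, b; 0, 1, 0; 0, 0, 1], by simp [Matrix.det_fin_three]⟩ _
    (det_unip_mul_torus_ne_zero x z w h₀ h₁), ← mul_assoc]
  congr 2
  ext i j
  fin_cases i <;> fin_cases j <;>
    simp [unip, toReal, Matrix.mul_apply, Fin.sum_univ_three]
  ring

/-- Conjugation by `diag(1, -1, -1)`, which lies both in `SL₃(ℤ)` and in `O₃(ℝ)`. -/
theorem IsMaassCuspForm.map_unip_neg {Φ : Mat3 → ℂ} {α : Fin 3 → ℂ} (hΦ : IsMaassCuspForm Φ α)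
    (x z w : ℝ) {y₀ y₁ : ℝ} (h₀ : 0 < y₀) (h₁ : 0 < y₁) :
    Φ (unip (-x) (-z) w * torus y₀ y₁) = Φ (unip x z w * torus y₀ y₁) := by
  have hk : (!![1, 0, 0; 0, -1, 0; 0, 0, -1] : Mat3) ∈ Matrix.orthogonalGroup (Fin 3) ℝ := by
    rw [Matrix.mem_orthogonalGroup_iff]
    ext i j
    fin_cases i <;> fin_cases j <;> simp [Matrix.mul_apply, Fin.sum_univ_three]
  have hdet := det_unip_mul_torus_ne_zero (-x) (-z) w h₀ h₁
  rw [← hΦ.right_orth _ _ hdet hk, ← hΦ.left_inv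
    ⟨!![1, 0, 0; 0, -1, 0; 0, 0, -1], by simp [Matrix.det_fin_three]⟩ (_ * _) ?_]
  · congr 1
    ext i j
    fin_cases i <;> fin_cases j <;>
      simp [unip, torus, toReal, Matrix.mul_apply, Fin.sum_univ_three]
  · rw [Matrix.det_mul]
    exact mul_ne_zero hdet (by simp [Matrix.det_fin_three])

/-- The period is even in its second index: conjugation by `diag(1, -1, -1)` reverses the signs of
`u₁₂` and `u₁₃` and fixes `u₂₃` and the torus. -/
theorem fourierPeriod_neg_right {Φ : Mat3 → ℂ} {α : Fin 3 → ℂ} (hΦ : IsMaassCuspForm Φ α)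
    (m n : ℤ) {y₀ y₁ : ℝ} (h₀ : 0 < y₀) (h₁ : 0 < y₁) :
    fourierPeriod Φ m (-n) y₀ y₁ = fourierPeriod Φ m n y₀ y₁ := by
  set F : ℝ → ℝ → ℝ → ℂ := fun x z w => Φ (unip x z w * torus y₀ y₁) * e (-m * w) with hF
  have hFc : Continuous fun p : ℝ × ℝ × ℝ => F p.1 p.2.1 p.2.2 :=
    (hΦ.continuous_unip h₀ h₁).mul (continuous_e.comp (by fun_prop))
  set P : ℝ → ℂ := fun x => ∫ z in (0 : ℝ)..1, ∫ w in (0 : ℝ)..1, F x z w with hP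
  have hper : ∀ n : ℤ, fourierPeriod Φ m n y₀ y₁ = ∫ x in (0 : ℝ)..1, P x * e (-n * x) := by
    intro n
    simp only [fourierPeriod, hP, hF, ← intervalIntegral.integral_mul_const, mul_assoc, ← e_add,
      sub_eq_add_neg, neg_mul]
  -- Reversing the sign of `x` reverses that of `z`; periodicity in `z` restores the interval `[0, 1]`.
  have hz : ∀ x w, Function.Periodic (fun z => F x z w) 1 := by
    intro x w z
    have := hΦ.map_unip_add 0 1 x z w h₀ h₁
    simp only [Int.cast_zero, Int.cast_one, zero_mul, add_zero] at this
    simp only [hF, this]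
  have hneg : ∀ x, P (-x) = P x := by
    intro x
    have h2 : Function.Periodic (fun z => ∫ w in (0 : ℝ)..1, F x z w) 1 := by
      intro z
      simp only [hz x _ z]
    have h3 := h2.intervalIntegral_add_eq (-1) 0
    norm_num at h3
    rw [hP]
    simp only
    rw [← h3, ← neg_zero, ← intervalIntegral.integral_comp_neg]
    simp only [hF, neg_zero]
    refine intervalIntegral.integral_congr fun z _ => ?_
    refine intervalIntegral.integral_congr fun w _ => ?_
    rw [← hΦ.map_unip_neg x (-z) w h₀ h₁, neg_neg]
  have hswap : ∀ x, P x = ∫ w in (0 : ℝ)..1, ∫ z in (0 : ℝ)..1, F x z w := by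
    intro x
    refine intervalIntegral_intervalIntegral_swap ?_
    have hx : Continuous fun p : ℝ × ℝ => (x, p.1, p.2) := by fun_prop
    have hc : Continuous (Function.uncurry (F x)) := by
      have := hFc.comp hx
      simp only [Function.comp_def] at this
      exact this
    have hcpt : IsCompact (Icc (0 : ℝ) 1 ×ˢ Icc (0 : ℝ) 1) := isCompact_Icc.prod isCompact_Icc
    have hi := hc.continuousOn.integrableOn_compact (μ := volume) hcpt
    refine hi.mono_set ?_
    rw [uIoc_of_le zero_le_one]
    exact prod_mono Ioc_subset_Icc_self Ioc_subset_Icc_self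
  -- The translation `x ↦ x + 1` moves `z` by `w`, which is removed by periodicity in `z` only if the
  -- `z`-integral is the inner one.
  have hPper : Function.Periodic P 1 := by
    intro x
    rw [hswap, hswap]
    refine intervalIntegral.integral_congr fun w _ => ?_
    have h3 := (hz (x + 1) w).intervalIntegral_add_eq w 0
    rw [zero_add] at h3
    have h4 := intervalIntegral.integral_comp_add_right (a := 0) (b := 1)
      (fun z => F (x + 1) z w) w
    rw [zero_add, add_comm (1 : ℝ) w] at h4
    rw [← h3, ← h4]
    refine intervalIntegral.integral_congr fun z _ => ?_
    have := hΦ.map_unip_add 1 0 x z w h₀ h₁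
    simp only [Int.cast_zero, Int.cast_one, one_mul, add_zero] at this
    simp only [hF, this]
  have hQ : Function.Periodic (fun x => P x * e (-n * x)) 1 := by
    intro x
    have h4 : e (-n * (x + 1)) = e (-n * x) := by
      rw [mul_add, e_add, mul_one, ← Int.cast_neg, e_intCast, mul_one]
    simp only [hPper x, h4]
  rw [hper, hper]
  have h3 := hQ.intervalIntegral_add_eq (-1) 0
  rw [neg_add_cancel, zero_add] at h3
  have h4 := intervalIntegral.integral_comp_neg (a := 0) (b := 1) (fun x => P x * e (-n * x))
  rw [neg_zero] at h4
  rw [← h3, ← h4]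
  refine intervalIntegral.integral_congr fun x _ => ?_
  simp [hneg]

/-- The evenness of the periods passes to the coefficients, since the right-hand side of the
defining relation depends on the index only through its absolute value. -/
theorem fourierCoeff_neg_right {Φ : Mat3 → ℂ} {α : Fin 3 → ℂ} (hΦ : IsMaassCuspForm Φ α)
    (m n : ℤ) : fourierCoeff Φ α m (-n) = fourierCoeff Φ α m n := by
  have : IsFourierCoeff Φ α m (-n) = IsFourierCoeff Φ α m n := by
    ext b
    unfold IsFourierCoeff
    refine forall₄_congr fun y₀ y₁ h₀ h₁ => ?_
    rw [fourierPeriod_neg_right hΦ m n h₀ h₁, mul_neg, abs_neg, Int.cast_neg, abs_neg]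
  have hcongr : ∀ p q : ℂ → Prop, p = q → (open Classical in
      (if h : ∃ b, p b then h.choose else 0 : ℂ) = if h : ∃ b, q b then h.choose else 0) := by
    rintro p _ rfl
    rfl
  exact hcongr _ _ this

/-! ### The two integrals over the half-line -/

theorem continuous_Gamma_comp {X : Type*} [TopologicalSpace X] {f : X → ℂ} (hf : Continuous f)
    (h : ∀ x, 0 < (f x).re) : Continuous fun x => Complex.Gamma (f x) := by
  rw [continuous_iff_continuousAt]
  intro x
  refine ContinuousAt.comp (f := f) ?_ hf.continuousAt
  refine (Complex.differentiableAt_Gamma _ fun m hm => ?_).continuousAt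
  have := h x
  rw [hm, Complex.neg_re, Complex.natCast_re] at this
  linarith [(Nat.cast_nonneg m : (0 : ℝ) ≤ m)]

theorem continuous_inv_Gamma_comp {X : Type*} [TopologicalSpace X] {f : X → ℂ}
    (hf : Continuous f) : Continuous fun x => (Complex.Gamma (f x))⁻¹ :=
  Complex.differentiable_one_div_Gamma.continuous.comp hf

/-- The Mellin transform of `H^♭` converges absolutely for `-31/2 < Re w < -1/2`: the lower bound
comes from the order of vanishing at `0`, the upper one from boundedness of `H^♭(y) / √y`. -/
theorem integrableOn_norm_invKL_mul {η : ℝ} {H : ℂ → ℂ} (hH : IsTestFunction η H) (hη : 40 < η)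
    {w : ℝ} (hw₀ : -31 / 2 < w) (hw₁ : w < -1 / 2) :
    IntegrableOn (fun y => ‖invKL H y‖ * Real.exp ((w - 1) * Real.log y)) (Ioi 0) := by
  obtain ⟨C, hC0, hC⟩ := exists_norm_invKL_le hH hη
  have hm : AEStronglyMeasurable (fun y => ‖invKL H y‖ * Real.exp ((w - 1) * Real.log y))
      (volume.restrict (Ioi 0)) :=
    (aestronglyMeasurable_invKL hH hη).norm.mul (by fun_prop)
  have hy : ∀ y : ℝ, 0 < y → ∀ k : ℕ, √y * y ^ k * Real.exp ((w - 1) * Real.log y) =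
      y ^ (w - 1 / 2 + k) := by
    intro y hy k
    rw [mul_comm (w - 1), ← Real.rpow_def_of_pos hy, Real.sqrt_eq_rpow, ← Real.rpow_natCast,
      ← Real.rpow_add hy, ← Real.rpow_add hy]
    congr 1
    ring
  rw [← Ioc_union_Ioi_eq_Ioi zero_le_one]
  refine IntegrableOn.union ?_ ?_
  · have h1 : IntegrableOn (fun y : ℝ => y ^ (w - 1 / 2 + (15 : ℕ))) (Ioc 0 1) :=
      (intervalIntegrable_iff_integrableOn_Ioc_of_le zero_le_one).1
        (intervalIntegral.intervalIntegrable_rpow' (by push_cast; linarith))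
    refine (h1.const_mul C).mono' (hm.mono_measure (Measure.restrict_mono Ioc_subset_Ioi_self le_rfl))
      ((ae_restrict_iff' measurableSet_Ioc).2 (ae_of_all _ fun y hy0 => ?_))
    rw [Real.norm_of_nonneg (by positivity), ← hy y hy0.1]
    calc _ ≤ C * √y * y ^ 15 * Real.exp ((w - 1) * Real.log y) := by
          gcongr; exact (hC y hy0.1).2
      _ = _ := by ring
  · have h1 : IntegrableOn (fun y : ℝ => y ^ (w - 1 / 2 + (0 : ℕ))) (Ioi 1) :=
      integrableOn_Ioi_rpow_of_lt (by push_cast; linarith) zero_lt_one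
    refine (h1.const_mul C).mono' (hm.mono_measure (Measure.restrict_mono
      (Ioi_subset_Ioi zero_le_one) le_rfl))
      ((ae_restrict_iff' measurableSet_Ioi).2 (ae_of_all _ fun y hy1 => ?_))
    have hy0 : 0 < y := zero_lt_one.trans hy1
    rw [Real.norm_of_nonneg (by positivity), ← hy y hy0]
    calc _ ≤ C * √y * Real.exp ((w - 1) * Real.log y) := by
          gcongr; exact (hC y hy0).1
      _ = _ := by ring

theorem integral_invKL_mul_eq_mellinT (H : ℂ → ℂ) (w : ℂ) :
    ∫ y in Ioi (0 : ℝ), invKL H y * Complex.exp ((w - 1) * Real.log y) = mellinT (invKL H) w := by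
  refine setIntegral_congr_fun measurableSet_Ioi fun y hy => ?_
  have hy : (0 : ℝ) < y := hy
  have hexp : Complex.exp (Real.log y : ℂ) = y := by
    rw [← Complex.ofReal_exp, Real.exp_log hy]
  rw [ofReal_cpow_eq_exp hy, sub_mul, one_mul, Complex.exp_sub, hexp, mul_div_assoc]

theorem norm_mellinT_le (H : ℂ → ℂ) (w : ℂ) : ‖mellinT (invKL H) w‖ ≤
    ∫ y in Ioi (0 : ℝ), ‖invKL H y‖ * Real.exp ((w.re - 1) * Real.log y) := by
  rw [← integral_invKL_mul_eq_mellinT]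
  refine (norm_integral_le_integral_norm _).trans (le_of_eq ?_)
  simp only [norm_mul, Complex.norm_exp, Complex.re_mul_ofReal, Complex.sub_re, Complex.one_re]

theorem continuous_mellinT_line {η : ℝ} {H : ℂ → ℂ} (hH : IsTestFunction η H) (hη : 40 < η)
    {w : ℂ} (hw₀ : -31 / 2 < w.re) (hw₁ : w.re < -1 / 2) :
    Continuous fun t : ℝ => mellinT (invKL H) (w - t * Complex.I) := by
  simp only [← integral_invKL_mul_eq_mellinT]
  refine continuous_of_dominated (fun t => ?_) (fun t => ae_of_all _ fun y => ?_)
    (integrableOn_norm_invKL_mul hH hη hw₀ hw₁) (ae_of_all _ fun y => by fun_prop)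
  · exact (aestronglyMeasurable_invKL hH hη).mul
      (by fun_prop : Measurable _).aestronglyMeasurable
  · simp [Complex.norm_exp]

/-- A quotient of gamma functions of beta type is largest on the real axis. -/
theorem norm_beta_le {a b : ℂ} (ha : 0 < a.re) (hb : a.re < b.re) :
    ‖Complex.Gamma a * Complex.Gamma (b - a) / Complex.Gamma b‖ ≤
      ∫ v : ℝ, Real.exp (a.re * v - b.re * Real.log (1 + Real.exp v)) := by
  rw [← (integrable_exp_beta ha hb).2]
  refine (norm_integral_le_integral_norm _).trans (le_of_eq ?_)
  simp only [Complex.norm_exp, Complex.sub_re, Complex.re_mul_ofReal]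

/-- The beta integral in the form `∫ y^{a-1} (1 + y²)^{-b} dy`. -/
theorem integrableOn_beta {a b : ℂ} (ha : 0 < a.re) (hb : (a / 2).re < b.re) :
    IntegrableOn (fun y : ℝ => Complex.exp ((a - 1) * Real.log y - b * Real.log (1 + y ^ 2)))
      (Ioi 0) ∧
    ∫ y in Ioi (0 : ℝ), Complex.exp ((a - 1) * Real.log y - b * Real.log (1 + y ^ 2)) =
      1 / 2 * (Complex.Gamma (a / 2) * Complex.Gamma (b - a / 2) / Complex.Gamma b) := by
  have ha' : 0 < (a / 2).re := by rw [half_re]; linarith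
  have h := integrable_exp_beta ha' hb
  have hv : ∀ v : ℝ, Real.exp v • Complex.exp ((a - 1) * Real.log (Real.exp v) -
      b * Real.log (1 + Real.exp v ^ 2)) =
      Complex.exp (a / 2 * (2 * v : ℝ) - b * Real.log (1 + Real.exp (2 * v))) := by
    intro v
    rw [Real.log_exp, Complex.real_smul, Complex.ofReal_exp, ← Complex.exp_add, ← Real.exp_nat_mul]
    congr 1
    push_cast
    ring
  constructor
  · rw [integrableOn_Ioi_iff_integrable_exp]
    simp only [hv]
    exact h.1.comp_mul_left' two_ne_zero
  · rw [integral_Ioi_eq_integral_exp]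
    simp only [hv]
    rw [Measure.integral_comp_mul_left
      (fun v : ℝ => Complex.exp (a / 2 * v - b * Real.log (1 + Real.exp v))), h.2]
    simp [abs_of_pos]

/-! ### The kernel of the dual transform -/

theorem eps_pos : 0 < eps := by norm_num [eps]

/-- The gamma factor of the Mellin integral for the perturbed exponential. -/
def pertKernel (δ φ : ℝ) (u : ℂ) : ℂ :=
  (2 * π : ℂ) ^ (-u) * Complex.exp (Complex.I * δ * φ * u) * Complex.Gamma u

/-- The quotient of gamma functions that arises from the `y₀`-integral. -/
def betaFactor (s₁ u s₀ s : ℂ) : ℂ :=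
  Complex.Gamma ((u + 1 - 2 * s + s₁ - s₀) / 2) * Complex.Gamma ((2 * s - s₀ - u) / 2) /
      Complex.Gamma ((1 + s₁) / 2 - s₀)

theorem transIntegrand_eq (α : Fin 3 → ℂ) (H : ℂ → ℂ) (δ : ℝ) (s₀ s : ℂ) (φ : ℝ) (s₁ u : ℂ) :
    transIntegrand α H δ s₀ s φ s₁ u = vtKernel α (s₀ - u) s₁ * pertKernel δ φ u *
      (mellinT (invKL H) (s - s₁ - 1 / 2) * betaFactor s₁ u s₀ s) := by
  rw [transIntegrand, bigKernel, pertKernel, betaFactor]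
  ring

theorem pertKernel_line_eq (δ φ t : ℝ) : pertKernel δ φ (eps + t * Complex.I) =
    Complex.exp (-(eps + t * Complex.I) * Real.log (2 * π)) *
      Complex.exp (Complex.I * δ * φ * (eps + t * Complex.I)) *
      Complex.Gamma (eps + t * Complex.I) := by
  rw [pertKernel, ← ofReal_cpow_eq_exp (by positivity)]
  push_cast
  rfl

theorem continuous_pertKernel_line (δ φ : ℝ) :
    Continuous fun t : ℝ => pertKernel δ φ (eps + t * Complex.I) := by
  simp only [pertKernel_line_eq]
  exact Continuous.mul (by fun_prop) (continuous_Gamma_line eps_pos)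

theorem integrable_pertKernel_line {δ φ : ℝ} (hδ : |δ| ≤ 1) (hφ₀ : 0 ≤ φ) (hφ : φ < π / 2) :
    Integrable fun t : ℝ => pertKernel δ φ (eps + t * Complex.I) := by
  refine ((integrable_norm_Gamma_mul_exp eps_pos hφ₀ hφ).const_mul
    (Real.exp (-eps * Real.log (2 * π)))).mono'
    (continuous_pertKernel_line δ φ).aestronglyMeasurable (ae_of_all _ fun t => ?_)
  rw [pertKernel_line_eq, norm_mul, norm_mul, Complex.norm_exp, Complex.norm_exp,
    Complex.re_mul_ofReal]
  have h1 : (-(eps + t * Complex.I : ℂ)).re = -eps := by simp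
  have h2 : (Complex.I * δ * φ * (eps + t * Complex.I)).re ≤ φ * |t| := by
    have : (Complex.I * δ * φ * (eps + t * Complex.I)).re = φ * (-(δ * t)) := by simp; ring
    rw [this]
    refine mul_le_mul_of_nonneg_left ((neg_le_abs _).trans ?_) hφ₀
    rw [abs_mul]
    exact mul_le_of_le_one_left (abs_nonneg t) hδ
  rw [h1]
  calc _ ≤ Real.exp (-eps * Real.log (2 * π)) * Real.exp (φ * |t|) *
        ‖Complex.Gamma (eps + t * Complex.I)‖ := by gcongr
    _ = _ := by ring

/-- The bound only depends on the real parts, so that it is uniform on the lines of integration. -/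
theorem norm_betaFactor_le {s₁ u s₀ s : ℂ} (h₀ : s₀.re + u.re < 2 * s.re)
    (h₁ : 2 * s.re + s₀.re < 1 + u.re + s₁.re) :
    ‖betaFactor s₁ u s₀ s‖ ≤ ∫ v : ℝ, Real.exp ((2 * s.re - s₀.re - u.re) / 2 * v -
      ((1 + s₁.re) / 2 - s₀.re) * Real.log (1 + Real.exp v)) := by
  have e1 : ((2 * s - s₀ - u) / 2).re = (2 * s.re - s₀.re - u.re) / 2 := by
    rw [half_re]; simp
  have e2 : ((1 + s₁) / 2 - s₀).re = (1 + s₁.re) / 2 - s₀.re := by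
    rw [Complex.sub_re, half_re]; simp
  have h := norm_beta_le (a := (2 * s - s₀ - u) / 2) (b := (1 + s₁) / 2 - s₀)
    (by rw [e1]; linarith) (by rw [e1, e2]; linarith)
  rw [e1, e2] at h
  refine le_trans (le_of_eq ?_) h
  rw [betaFactor, mul_comm (Complex.Gamma _),
    show (1 + s₁) / 2 - s₀ - (2 * s - s₀ - u) / 2 = (u + 1 - 2 * s + s₁ - s₀) / 2 by ring]

theorem continuous_betaFactor {X : Type*} [TopologicalSpace X] {s₁ u s₀ : X → ℂ} {s : ℂ}
    (c₁ : Continuous s₁) (cu : Continuous u) (c₀ : Continuous s₀)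
    (h₀ : ∀ x, (s₀ x).re + (u x).re < 2 * s.re)
    (h₁ : ∀ x, 2 * s.re + (s₀ x).re < 1 + (u x).re + (s₁ x).re) :
    Continuous fun x => betaFactor (s₁ x) (u x) (s₀ x) s := by
  unfold betaFactor
  simp only [div_eq_mul_inv _ (Complex.Gamma _)]
  refine ((continuous_Gamma_comp (by fun_prop) fun x => ?_).mul
    (continuous_Gamma_comp (by fun_prop) fun x => ?_)).mul
    (continuous_inv_Gamma_comp (by fun_prop))
  · rw [half_re]; simp; linarith [h₁ x]
  · rw [half_re]; simp; linarith [h₀ x]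

/-- The integrand of the dual transform on the lines of integration, as a function of
`((Im s₁, Im u), Im s₀)`. -/
def transLine (α : Fin 3 → ℂ) (H : ℂ → ℂ) (δ : ℝ) (σ₀ : ℝ) (s : ℂ) (φ : ℝ)
    (q : (ℝ × ℝ) × ℝ) : ℂ :=
  transIntegrand α H δ (σ₀ + q.2 * Complex.I) s φ (15 + q.1.1 * Complex.I)
    (eps + q.1.2 * Complex.I)

section

variable {α : Fin 3 → ℂ} {η : ℝ} {H : ℂ → ℂ} {σ₀ : ℝ} {s : ℂ}

theorem vtKernel_transLine_eq (α : Fin 3 → ℂ) (σ₀ t t₁ t₂ : ℝ) :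
    vtKernel α (σ₀ + t * Complex.I - (eps + t₂ * Complex.I)) (15 + t₁ * Complex.I) =
      vtKernel α ((σ₀ - eps : ℝ) + (t - t₂ : ℝ) * Complex.I)
        ((15 : ℝ) + t₁ * Complex.I) := by
  congr 1
  push_cast
  ring

theorem continuous_transLine (hα : ∀ i, (α i).re = 0) (hH : IsTestFunction η H) (hη : 40 < η)
    (hσ₀ : eps < σ₀) (hs₀ : σ₀ + eps < 2 * s.re) (hs₁ : 2 * s.re + σ₀ < 16 + eps)
    (δ φ : ℝ) : Continuous (transLine α H δ σ₀ s φ) := by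
  have he := eps_pos
  unfold transLine
  simp only [transIntegrand_eq, vtKernel_transLine_eq]
  refine Continuous.mul (Continuous.mul ?_ ?_) (Continuous.mul ?_ ?_)
  · have := (continuous_vtKernel_line hα (sub_pos.2 hσ₀) (by norm_num : (0 : ℝ) < 15)).comp
      (by fun_prop : Continuous fun q : (ℝ × ℝ) × ℝ => (q.2 - q.1.2, q.1.1))
    simp only [Function.comp_def] at this
    exact this
  · have := (continuous_pertKernel_line δ φ).comp
      (by fun_prop : Continuous fun q : (ℝ × ℝ) × ℝ => q.1.2)
    simp only [Function.comp_def] at this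
    exact this
  · have hw : (s - 15 - 1 / 2).re = s.re - 31 / 2 := by
      rw [show s - 15 - 1 / 2 = s - (31 / 2 : ℝ) by push_cast; ring]; simp
    have := (continuous_mellinT_line hH hη (w := s - 15 - 1 / 2) (by rw [hw]; linarith)
      (by rw [hw]; linarith)).comp (by fun_prop : Continuous fun q : (ℝ × ℝ) × ℝ => q.1.1)
    simp only [Function.comp_def] at this
    refine this.congr fun q => ?_
    congr 1
    ring
  · refine continuous_betaFactor (by fun_prop) (by fun_prop) (by fun_prop) (fun q => ?_)
      (fun q => ?_)
    · simp; linarith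
    · simp; linarith

/-- On the lines of integration `mellinT` and `betaFactor` are bounded, so that absolute
convergence rests on the decay of `vtKernel` and `pertKernel` alone. -/
theorem exists_norm_transLine_le (hs₀ : σ₀ + eps < 2 * s.re) (hs₁ : 2 * s.re + σ₀ < 16 + eps)
    (α : Fin 3 → ℂ) (H : ℂ → ℂ) :
    ∃ C : ℝ, ∀ (δ φ : ℝ) (q : (ℝ × ℝ) × ℝ), ‖transLine α H δ σ₀ s φ q‖ ≤
      ‖vtKernel α ((σ₀ - eps : ℝ) + (q.2 - q.1.2 : ℝ) * Complex.I)
        ((15 : ℝ) + q.1.1 * Complex.I)‖ * ‖pertKernel δ φ (eps + q.1.2 * Complex.I)‖ * C := by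
  refine ⟨(∫ y in Ioi (0 : ℝ), ‖invKL H y‖ * Real.exp ((s.re - 31 / 2 - 1) * Real.log y)) *
    ∫ v : ℝ, Real.exp ((2 * s.re - σ₀ - eps) / 2 * v -
      ((1 + 15) / 2 - σ₀) * Real.log (1 + Real.exp v)), fun δ φ q => ?_⟩
  unfold transLine
  rw [transIntegrand_eq, vtKernel_transLine_eq, norm_mul, norm_mul, norm_mul]
  have h1 := norm_mellinT_le H (s - (15 + q.1.1 * Complex.I) - 1 / 2)
  have h2 := norm_betaFactor_le (s₁ := 15 + q.1.1 * Complex.I) (u := eps + q.1.2 * Complex.I)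
    (s₀ := σ₀ + q.2 * Complex.I) (s := s) (by simp; linarith) (by simp; linarith)
  have e1 : (s - (15 + q.1.1 * Complex.I) - 1 / 2).re = s.re - 31 / 2 := by
    rw [show s - (15 + q.1.1 * Complex.I) - 1 / 2 = s - (31 / 2 : ℝ) - q.1.1 * Complex.I by
      push_cast; ring]
    simp
  rw [e1] at h1
  have e2 : (15 + q.1.1 * Complex.I : ℂ).re = 15 := by simp
  have e3 : (eps + q.1.2 * Complex.I : ℂ).re = eps := by simp
  have e4 : (σ₀ + q.2 * Complex.I : ℂ).re = σ₀ := by simp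
  rw [e2, e3, e4] at h2
  gcongr

/-- The passage from `((Im s₁, Im u), Im s₀)` to `((Im s₀, Im s₁), Im u)`. -/
theorem measurePreserving_reorder :
    MeasurePreserving (fun q : (ℝ × ℝ) × ℝ => ((q.2, q.1.1), q.1.2)) := by
  have h1 : MeasurePreserving (Prod.swap : (ℝ × ℝ) × ℝ → ℝ × (ℝ × ℝ)) :=
    Measure.measurePreserving_swap
  have h2 : MeasurePreserving (MeasurableEquiv.prodAssoc.symm : ℝ × (ℝ × ℝ) → (ℝ × ℝ) × ℝ) :=
    volume_preserving_prodAssoc.symm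
  exact h2.comp h1

theorem integrable_vtKernel_mul_pertKernel (hα : ∀ i, (α i).re = 0) {τ δ φ : ℝ} (hτ : 0 < τ)
    (hδ : |δ| ≤ 1) (hφ₀ : 0 ≤ φ) (hφ : φ < π / 2) :
    Integrable fun q : (ℝ × ℝ) × ℝ => vtKernel α (τ + q.2 * Complex.I)
      ((15 : ℝ) + q.1.1 * Complex.I) * pertKernel δ φ (eps + q.1.2 * Complex.I) := by
  have h := (integrable_vtKernel_line hα hτ (by norm_num : (0 : ℝ) < 15)).mul_prod
    (integrable_pertKernel_line hδ hφ₀ hφ)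
  have h2 := measurePreserving_reorder.integrable_comp_of_integrable h
  simp only [Function.comp_def] at h2
  exact h2

/-- The shear that passes from `Im (s₀ - u)` to `Im s₀`. -/
theorem measurePreserving_add_im :
    MeasurePreserving (fun q : (ℝ × ℝ) × ℝ => (q.1, q.2 + q.1.2)) :=
  measurePreserving_shear (μ := (volume : Measure (ℝ × ℝ))) measurable_snd

/-- Absolute convergence of the dual transform jointly with the `s₀`-integral: in the variable
`s₀ - u` the majorant is a product. -/
theorem integrable_transLine (hα : ∀ i, (α i).re = 0) (hH : IsTestFunction η H) (hη : 40 < η)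
    (hσ₀ : eps < σ₀) (hs₀ : σ₀ + eps < 2 * s.re) (hs₁ : 2 * s.re + σ₀ < 16 + eps)
    {δ φ : ℝ} (hδ : |δ| ≤ 1) (hφ₀ : 0 ≤ φ) (hφ : φ < π / 2) :
    Integrable (transLine α H δ σ₀ s φ) := by
  have hc := continuous_transLine hα hH hη hσ₀ hs₀ hs₁ δ φ
  rw [← measurePreserving_add_im.integrable_comp hc.aestronglyMeasurable]
  obtain ⟨C, hC⟩ := exists_norm_transLine_le hs₀ hs₁ α H
  refine ((integrable_vtKernel_mul_pertKernel hα (sub_pos.2 hσ₀) hδ hφ₀ hφ).norm.mul_const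
    C).mono' (hc.comp (by fun_prop)).aestronglyMeasurable (ae_of_all _ fun q => ?_)
  have := hC δ φ (q.1, q.2 + q.1.2)
  rw [norm_mul]
  simp only [add_sub_cancel_right] at this
  exact this

theorem exists_norm_Gammaℝ_line_le {σ : ℝ} (hσ : 0 < σ) {β : ℂ} (hβ : β.re = 0) :
    ∃ C : ℝ, ∀ t : ℝ, ‖Complex.Gammaℝ (σ + t * Complex.I + β)‖ ≤ C := by
  refine ⟨Real.exp (-(σ / 2) * Real.log π) * Real.Gamma (σ / 2), fun t => ?_⟩
  have hre : ((σ + t * Complex.I + β) / 2).re = σ / 2 := by rw [half_re]; simp [hβ]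
  have h := norm_Gamma_le_Gamma_re (s := (σ + t * Complex.I + β) / 2) (by rw [hre]; linarith)
  rw [hre] at h
  rw [Gammaℝ_eq_exp, norm_mul, Complex.norm_exp, Complex.re_mul_ofReal, Complex.neg_re, hre]
  gcongr

/-- For a fixed `s₀`, the decay in `Im u` comes from `pertKernel` and that in `Im s₁` from one gamma
factor of `vtKernel`. -/
theorem transConverges (hα : ∀ i, (α i).re = 0) (hH : IsTestFunction η H) (hη : 40 < η)
    (hσ₀ : eps < σ₀) (hs₀ : σ₀ + eps < 2 * s.re) (hs₁ : 2 * s.re + σ₀ < 16 + eps)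
    {δ φ : ℝ} (hδ : |δ| ≤ 1) (hφ₀ : 0 ≤ φ) (hφ : φ < π / 2) {s₀ : ℂ} (hre : s₀.re = σ₀) :
    TransConverges α H δ s₀ s φ := by
  have hs : s₀ = σ₀ + s₀.im * Complex.I := by rw [← hre, Complex.re_add_im]
  have hα0 : (-α 0).re = 0 := by simp [hα]
  obtain ⟨C, hC⟩ := exists_norm_transLine_le hs₀ hs₁ α H
  obtain ⟨D, hD⟩ := exists_norm_vtKernel_line_le hα (sub_pos.2 hσ₀) (by norm_num : (0 : ℝ) < 15)
  obtain ⟨G, hG⟩ := exists_norm_Gammaℝ_line_le (sub_pos.2 hσ₀) (hα 2)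
  have hc := (continuous_transLine hα hH hη hσ₀ hs₀ hs₁ δ φ).comp
    (by fun_prop : Continuous fun p : ℝ × ℝ => (p, s₀.im))
  unfold TransConverges
  rw [hs]
  have hi := ((integrable_Gammaℝ_line (by norm_num : (0 : ℝ) < 15) hα0).norm.mul_prod
    (integrable_pertKernel_line hδ hφ₀ hφ).norm).const_mul (|D| * G * |C|)
  refine hi.mono' hc.aestronglyMeasurable (ae_of_all _ fun p => ((hC δ φ (p, s₀.im)).trans
    (mul_le_mul_of_nonneg_left (le_abs_self C) (by positivity))).trans ?_)
  have h1 : ‖vtKernel α ((σ₀ - eps : ℝ) + (s₀.im - p.2 : ℝ) * Complex.I)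
      ((15 : ℝ) + p.1 * Complex.I)‖ ≤
      |D| * (G * ‖Complex.Gammaℝ ((15 : ℝ) + p.1 * Complex.I + -α 0)‖) := by
    refine (hD _ _).trans ?_
    gcongr
    · exact le_abs_self D
    · exact hG _
  calc _ ≤ |D| * (G * ‖Complex.Gammaℝ ((15 : ℝ) + p.1 * Complex.I + -α 0)‖) *
        ‖pertKernel δ φ (eps + p.2 * Complex.I)‖ * |C| := by
        gcongr
    _ = _ := by ring

end

/-! ### One term of the perturbed off-diagonal -/

/-- Fubini's theorem for a superposition, with integrable coefficients `K t`, of functions of `x`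
that have a common integrable majorant `m`. -/
theorem integrable_superposition {X T : Type*} [MeasurableSpace X] [MeasurableSpace T]
    {μ : Measure X} {ν : Measure T} [SFinite μ] [SFinite ν] {K : T → ℂ} {M : X → T → ℂ}
    {m : X → ℝ} (hK : Integrable K ν) (hM : AEStronglyMeasurable (Function.uncurry M) (μ.prod ν))
    (hm : Integrable m μ) (hle : ∀ x t, ‖M x t‖ ≤ m x) :
    Integrable (fun x => ∫ t, K t * M x t ∂ν) μ ∧
    (∫ x, ‖∫ t, K t * M x t ∂ν‖ ∂μ ≤ (∫ x, m x ∂μ) * ∫ t, ‖K t‖ ∂ν) ∧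
    ∫ x, ∫ t, K t * M x t ∂ν ∂μ = ∫ t, K t * ∫ x, M x t ∂μ ∂ν := by
  have hi : Integrable (fun p : X × T => K p.2 * M p.1 p.2) (μ.prod ν) := by
    refine (hm.mul_prod hK.norm).mono' (hK.aestronglyMeasurable.comp_snd.mul hM)
      (ae_of_all _ fun p => ?_)
    rw [norm_mul, mul_comm]
    gcongr
    exact hle _ _
  refine ⟨hi.integral_prod_left, ?_, ?_⟩
  · rw [← integral_mul_const]
    refine integral_mono hi.integral_prod_left.norm (hm.mul_const _) fun x => ?_
    simp only
    rw [← integral_const_mul]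
    refine norm_integral_le_of_norm_le (hK.norm.const_mul _) (ae_of_all _ fun t => ?_)
    rw [norm_mul, mul_comm]
    gcongr
    exact hle _ _
  · rw [integral_integral_swap hi]
    simp only [integral_const_mul]

/-- The perturbed exponential in terms of `pertKernel`; the sign of `x` enters through `δ`. -/
theorem ePert_eq {x : ℝ} (hx : x ≠ 0) (φ : ℝ) :
    ePert x φ = 1 / (2 * π) * ∫ t : ℝ, pertKernel (Real.sign x) φ (eps + t * Complex.I) *
      Complex.exp (-(eps + t * Complex.I) * Real.log |x|) := by
  have hx' : 0 < |x| := abs_pos.2 hx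
  rw [ePert, vint]
  congr 1
  refine integral_congr_ae (ae_of_all _ fun t => ?_)
  simp only
  rw [pertKernel_line_eq, abs_mul, abs_of_pos (by positivity : 0 < 2 * π),
    ofReal_cpow_eq_exp (by positivity), Real.log_mul (by positivity) hx'.ne', Complex.ofReal_add,
    mul_add, Complex.exp_add]
  ring_nf

/-- The dependence on `y` of the integrand of the off-diagonal, after the Whittaker function and
the perturbed exponential have been written as Mellin-Barnes integrals. -/
def odPhase (H : ℂ → ℂ) (σ₀ : ℝ) (s : ℂ) (y : ℝ × ℝ) (q : (ℝ × ℝ) × ℝ) : ℂ :=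
  Complex.exp ((2 * s - ((σ₀ - eps : ℝ) + q.2 * Complex.I) - 2 * (eps + q.1.2 * Complex.I) - 1) *
      Real.log y.1 - ((1 + ((15 : ℝ) + q.1.1 * Complex.I)) / 2 -
        ((σ₀ - eps : ℝ) + q.2 * Complex.I) - (eps + q.1.2 * Complex.I)) *
      Real.log (1 + y.1 ^ 2)) *
    (invKL H y.2 * Complex.exp ((s - ((15 : ℝ) + q.1.1 * Complex.I) - 1 / 2 - 1) * Real.log y.2))

/-- The majorant of `odPhase`. -/
def odMajorant (H : ℂ → ℂ) (σ₀ σ : ℝ) (y : ℝ × ℝ) : ℝ :=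
  Real.exp ((2 * σ - σ₀ - eps - 1) * Real.log y.1 - (8 - σ₀) * Real.log (1 + y.1 ^ 2)) *
    (‖invKL H y.2‖ * Real.exp ((σ - 31 / 2 - 1) * Real.log y.2))

/-- The modulus of `odPhase` does not depend on the heights `q` on the lines of integration. This
allows for a majorant that is a product, which is what Fubini's theorem needs. -/
theorem norm_odPhase (H : ℂ → ℂ) (σ₀ : ℝ) (s : ℂ) (y : ℝ × ℝ) (q : (ℝ × ℝ) × ℝ) :
    ‖odPhase H σ₀ s y q‖ = odMajorant H σ₀ s.re y := by
  rw [odPhase, odMajorant, norm_mul, norm_mul, Complex.norm_exp, Complex.norm_exp, Complex.sub_re,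
    Complex.re_mul_ofReal, Complex.re_mul_ofReal, Complex.re_mul_ofReal]
  have e1 : (2 * s - ((σ₀ - eps : ℝ) + q.2 * Complex.I) - 2 * (eps + q.1.2 * Complex.I) - 1).re =
      2 * s.re - σ₀ - eps - 1 := by
    simp
    ring
  have e2 : ((1 + ((15 : ℝ) + q.1.1 * Complex.I)) / 2 -
        ((σ₀ - eps : ℝ) + q.2 * Complex.I) - (eps + q.1.2 * Complex.I)).re = 8 - σ₀ := by
    rw [Complex.sub_re, Complex.sub_re, half_re]
    simp
    ring
  have e3 : (s - ((15 : ℝ) + q.1.1 * Complex.I) - 1 / 2 - 1).re = s.re - 31 / 2 - 1 := by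
    rw [show s - ((15 : ℝ) + q.1.1 * Complex.I) - 1 / 2 - 1 = s - (33 / 2 : ℝ) -
      q.1.1 * Complex.I by push_cast; ring]
    simp
    ring
  rw [e1, e2, e3]

section

variable {α : Fin 3 → ℂ} {η : ℝ} {H : ℂ → ℂ} {σ₀ : ℝ} {s : ℂ}

theorem restrict_quadrant : (volume : Measure (ℝ × ℝ)).restrict quadrant =
    (volume.restrict (Ioi 0)).prod (volume.restrict (Ioi 0)) := by
  rw [Measure.prod_restrict]
  rfl

theorem integrableOn_odMajorant (hH : IsTestFunction η H) (hη : 40 < η) {σ : ℝ}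
    (hσ₀ : eps < σ₀) (hs₀ : σ₀ + eps < 2 * σ) (hs₁ : 2 * σ + σ₀ < 16 + eps) :
    IntegrableOn (odMajorant H σ₀ σ) quadrant := by
  have he := eps_pos
  rw [IntegrableOn, restrict_quadrant]
  have h1 := (integrableOn_beta (a := (2 * σ - σ₀ - eps : ℝ)) (b := (8 - σ₀ : ℝ))
    (by rw [Complex.ofReal_re]; linarith)
    (by rw [half_re, Complex.ofReal_re, Complex.ofReal_re]; linarith)).1.norm
  have h2 := integrableOn_norm_invKL_mul hH hη (w := σ - 31 / 2) (by linarith) (by linarith)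
  simp only [Complex.norm_exp, Complex.sub_re, Complex.re_mul_ofReal, Complex.ofReal_re,
    Complex.one_re] at h1
  have := h1.mul_prod h2
  unfold odMajorant
  exact this

theorem aestronglyMeasurable_odPhase (hH : IsTestFunction η H) (hη : 40 < η) (σ₀ : ℝ) (s : ℂ) :
    AEStronglyMeasurable (Function.uncurry (odPhase H σ₀ s))
      ((volume.restrict quadrant).prod volume) := by
  rw [restrict_quadrant]
  have h := ((aestronglyMeasurable_invKL hH hη).comp_snd
    (μ := (volume : Measure ℝ).restrict (Ioi 0))).comp_fst
    (ν := (volume : Measure ((ℝ × ℝ) × ℝ)))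
  unfold odPhase Function.uncurry
  refine AEStronglyMeasurable.mul (Measurable.aestronglyMeasurable (by fun_prop))
    (AEStronglyMeasurable.mul h (Measurable.aestronglyMeasurable (by fun_prop)))

/-- The `y₁`-integral is the Mellin transform of `H^♭` and the `y₀`-integral a beta integral. The
sum `Im (s₀ - u) + Im u` on the right-hand side is the height of `s₀`. -/
theorem integral_odPhase (hs₀ : σ₀ + eps < 2 * s.re) (hs₁ : 2 * s.re + σ₀ < 16 + eps)
    (H : ℂ → ℂ) (q : (ℝ × ℝ) × ℝ) :
    ∫ y in quadrant, odPhase H σ₀ s y q = 1 / 2 *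
      (mellinT (invKL H) (s - (15 + q.1.1 * Complex.I) - 1 / 2) *
        betaFactor (15 + q.1.1 * Complex.I) (eps + q.1.2 * Complex.I)
          (σ₀ + (q.2 + q.1.2 : ℝ) * Complex.I) s) := by
  rw [restrict_quadrant]
  unfold odPhase
  rw [integral_prod_mul (fun y : ℝ => Complex.exp ((2 * s - ((σ₀ - eps : ℝ) + q.2 * Complex.I) -
      2 * (eps + q.1.2 * Complex.I) - 1) *
      Real.log y - ((1 + ((15 : ℝ) + q.1.1 * Complex.I)) / 2 -
        ((σ₀ - eps : ℝ) + q.2 * Complex.I) - (eps + q.1.2 * Complex.I)) *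
      Real.log (1 + y ^ 2)))
    (fun y : ℝ => invKL H y *
      Complex.exp ((s - ((15 : ℝ) + q.1.1 * Complex.I) - 1 / 2 - 1) * Real.log y)),
    integral_invKL_mul_eq_mellinT, (integrableOn_beta ?_ ?_).2, betaFactor]
  · push_cast
    ring_nf
  · simp
    linarith
  · have e : ((1 + ((15 : ℝ) + q.1.1 * Complex.I)) / 2).re = 8 := by
      rw [half_re]
      simp
      norm_num
    rw [half_re, Complex.sub_re (_ / 2 - _), Complex.sub_re (_ / 2), e]
    simp
    linarith

/-- The product of two Mellin-Barnes integrals as a triple integral. -/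
theorem integral_mul_integral_reorder {f : ℝ × ℝ → ℂ} {g : ℝ → ℂ} (hf : Continuous f)
    (hg : Continuous g) :
    (∫ t, f t) * ∫ t, g t = ∫ q : (ℝ × ℝ) × ℝ, f (q.2, q.1.1) * g q.1.2 := by
  have hc : Continuous fun p : (ℝ × ℝ) × ℝ => f p.1 * g p.2 :=
    (hf.comp continuous_fst).mul (hg.comp continuous_snd)
  have h := integral_comp_measurePreserving measurePreserving_reorder hc.aestronglyMeasurable
  rw [h, show (volume : Measure ((ℝ × ℝ) × ℝ)) = volume.prod volume from rfl,
    integral_prod_mul f g]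

/-- The integrand of the off-diagonal for `x = a₁ / a₀`, with the Mellin-Barnes integrals inserted.
The lines of integration are `Re (s₀ - u) = σ₀ - ε`, `Re s₁ = 15` and `Re u = ε`. -/
theorem odIntegrand_eq (hα : ∀ i, (α i).re = 0) (hsum : α 0 + α 1 + α 2 = 0)
    (hσ₀ : eps < σ₀) {y : ℝ × ℝ} (hy : y ∈ quadrant) {x : ℝ} (hx : x ≠ 0) (φ : ℝ) :
    invKL H y.2 * ((y.1 ^ 2 * y.2 : ℝ) : ℂ) ^ (s - 1 / 2) *
      whittaker₃ (-α) (|x| * (y.1 / (1 + y.1 ^ 2))) (y.2 * √(1 + y.1 ^ 2)) *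
      ePert (x * (y.1 ^ 2 / (1 + y.1 ^ 2))) φ / ((y.1 * y.2 ^ 2 : ℝ) : ℂ) =
    1 / 4 * (1 / (2 * π)) ^ 3 * ∫ q : (ℝ × ℝ) × ℝ,
      vtKernel α ((σ₀ - eps : ℝ) + q.2 * Complex.I) ((15 : ℝ) + q.1.1 * Complex.I) *
        pertKernel (Real.sign x) φ (eps + q.1.2 * Complex.I) *
        Complex.exp ((1 - (σ₀ + (q.2 + q.1.2 : ℝ) * Complex.I)) * Real.log |x|) *
        odPhase H σ₀ s y q := by
  obtain ⟨y₀, y₁⟩ := y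
  obtain ⟨h₀, h₁⟩ : 0 < y₀ ∧ 0 < y₁ := hy
  have hx' : 0 < |x| := abs_pos.2 hx
  have hz : 0 < 1 + y₀ ^ 2 := by positivity
  simp only
  have hsgn : Real.sign (x * (y₀ ^ 2 / (1 + y₀ ^ 2))) = Real.sign x := by
    have h : 0 < y₀ ^ 2 / (1 + y₀ ^ 2) := by positivity
    rcases lt_or_gt_of_ne hx with h' | h'
    · rw [Real.sign_of_neg h', Real.sign_of_neg (mul_neg_of_neg_of_pos h' h)]
    · rw [Real.sign_of_pos h', Real.sign_of_pos (mul_pos h' h)]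
  have hl1 : Real.log (|x| * (y₀ / (1 + y₀ ^ 2))) =
      Real.log |x| + Real.log y₀ - Real.log (1 + y₀ ^ 2) := by
    rw [Real.log_mul hx'.ne' (by positivity), Real.log_div h₀.ne' hz.ne']
    ring
  have hl2 : Real.log (y₁ * √(1 + y₀ ^ 2)) = Real.log y₁ + Real.log (1 + y₀ ^ 2) / 2 := by
    rw [Real.log_mul h₁.ne' (by positivity), Real.log_sqrt hz.le]
  have hl3 : Real.log |x * (y₀ ^ 2 / (1 + y₀ ^ 2))| =
      Real.log |x| + 2 * Real.log y₀ - Real.log (1 + y₀ ^ 2) := by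
    rw [abs_mul, abs_of_pos (by positivity : 0 < y₀ ^ 2 / (1 + y₀ ^ 2)),
      Real.log_mul hx'.ne' (by positivity), Real.log_div (by positivity) hz.ne', Real.log_pow]
    push_cast
    ring
  have hl4 : ((y₀ ^ 2 * y₁ : ℝ) : ℂ) ^ (s - 1 / 2) =
      Complex.exp ((s - 1 / 2) * (2 * Real.log y₀ + Real.log y₁)) := by
    rw [ofReal_cpow_eq_exp (by positivity), Real.log_mul (by positivity) h₁.ne', Real.log_pow]
    push_cast
    rfl
  have hl5 : ((y₀ * y₁ ^ 2 : ℝ) : ℂ) = Complex.exp (Real.log y₀ + 2 * Real.log y₁) := by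
    rw [← Real.exp_log (by positivity : 0 < y₀ * y₁ ^ 2), Real.log_mul h₀.ne' (by positivity),
      Real.log_pow]
    push_cast
    rfl
  have hneg : (-α) 0 + (-α) 1 + (-α) 2 = 0 := by
    simp only [Pi.neg_apply]
    linear_combination -hsum
  rw [whittaker₃_eq hneg (by positivity) (by positivity),
    vtWhittaker_neg_eq hα (sub_pos.2 hσ₀) (by norm_num : (0 : ℝ) < 15) (by positivity)
      (by positivity), ePert_eq (by positivity), hsgn, hl1, hl2, hl3, hl4, hl5]
  have hpi : (π : ℂ) ≠ 0 := by exact_mod_cast Real.pi_ne_zero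
  have hprod := integral_mul_integral_reorder
    (f := fun t => vtKernel α ((σ₀ - eps : ℝ) + t.1 * Complex.I) ((15 : ℝ) + t.2 * Complex.I) *
      (Complex.exp ((1 - ((σ₀ - eps : ℝ) + t.1 * Complex.I)) *
          (Real.log |x| + Real.log y₀ - Real.log (1 + y₀ ^ 2) : ℝ)) *
        Complex.exp ((1 - ((15 : ℝ) + t.2 * Complex.I)) *
          (Real.log y₁ + Real.log (1 + y₀ ^ 2) / 2 : ℝ))))
    (g := fun t => pertKernel (Real.sign x) φ (eps + t * Complex.I) *
      Complex.exp (-(eps + t * Complex.I) *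
        (Real.log |x| + 2 * Real.log y₀ - Real.log (1 + y₀ ^ 2) : ℝ)))
    ((continuous_vtKernel_line hα (sub_pos.2 hσ₀) (by norm_num)).mul (by fun_prop))
    ((continuous_pertKernel_line _ _).mul (by fun_prop))
  generalize (∫ t : ℝ × ℝ, (_ : ℂ)) = U at hprod ⊢
  generalize (∫ t : ℝ, (_ : ℂ)) = V at hprod ⊢
  calc _ = 1 / 4 * (1 / (2 * π)) ^ 3 * (invKL H y₁ *
        (Complex.exp ((s - 1 / 2) * (2 * Real.log y₀ + Real.log y₁)) /
          Complex.exp (Real.log y₀ + 2 * Real.log y₁))) * (U * V) := by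
        field_simp
        ring
    _ = _ := by
      rw [hprod, mul_assoc, ← integral_const_mul]
      congr 1
      refine integral_congr_ae (ae_of_all _ fun q => ?_)
      simp only [odPhase]
      rw [← Complex.exp_sub]
      have hexp : Complex.exp ((s - 1 / 2) * (2 * Real.log y₀ + Real.log y₁) -
            (Real.log y₀ + 2 * Real.log y₁)) *
          (Complex.exp ((1 - ((σ₀ - eps : ℝ) + q.2 * Complex.I)) *
              (Real.log |x| + Real.log y₀ - Real.log (1 + y₀ ^ 2) : ℝ)) *
            Complex.exp ((1 - ((15 : ℝ) + q.1.1 * Complex.I)) *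
              (Real.log y₁ + Real.log (1 + y₀ ^ 2) / 2 : ℝ))) *
          Complex.exp (-(eps + q.1.2 * Complex.I) *
            (Real.log |x| + 2 * Real.log y₀ - Real.log (1 + y₀ ^ 2) : ℝ)) =
          Complex.exp ((1 - (σ₀ + (q.2 + q.1.2 : ℝ) * Complex.I)) * Real.log |x|) *
          (Complex.exp ((2 * s - ((σ₀ - eps : ℝ) + q.2 * Complex.I) -
              2 * (eps + q.1.2 * Complex.I) - 1) *
            Real.log y₀ - ((1 + ((15 : ℝ) + q.1.1 * Complex.I)) / 2 -
              ((σ₀ - eps : ℝ) + q.2 * Complex.I) - (eps + q.1.2 * Complex.I)) *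
            Real.log (1 + y₀ ^ 2)) *
          Complex.exp ((s - ((15 : ℝ) + q.1.1 * Complex.I) - 1 / 2 - 1) * Real.log y₁)) := by
        simp only [← Complex.exp_add]
        congr 1
        push_cast
        ring
      linear_combination (invKL H y₁ * vtKernel α ((σ₀ - eps : ℝ) + q.2 * Complex.I)
        ((15 : ℝ) + q.1.1 * Complex.I) *
        pertKernel (Real.sign x) φ (eps + q.1.2 * Complex.I)) * hexp

end

section

variable {α : Fin 3 → ℂ} {η : ℝ} {H : ℂ → ℂ} {σ₀ : ℝ} {s : ℂ}

/-- The iterated integral in the dual transform as an integral over the plane. -/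
theorem transF_line_eq (hα : ∀ i, (α i).re = 0) (hH : IsTestFunction η H) (hη : 40 < η)
    (hσ₀ : eps < σ₀) (hs₀ : σ₀ + eps < 2 * s.re) (hs₁ : 2 * s.re + σ₀ < 16 + eps)
    {δ φ : ℝ} (hδ : |δ| ≤ 1) (hφ₀ : 0 ≤ φ) (hφ : φ < π / 2) (t : ℝ) :
    transF α H δ (σ₀ + t * Complex.I) s φ =
      (1 / (2 * π)) ^ 2 * ∫ p : ℝ × ℝ, transLine α H δ σ₀ s φ (p, t) := by
  have hT := transConverges hα hH hη hσ₀ hs₀ hs₁ hδ hφ₀ hφ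
    (s₀ := σ₀ + t * Complex.I) (by simp)
  unfold TransConverges at hT
  unfold transLine
  rw [show (volume : Measure (ℝ × ℝ)) = volume.prod volume from rfl, integral_prod _ hT, transF,
    vint]
  simp only [vint, integral_const_mul, Complex.ofReal_ofNat]
  ring

theorem integrable_transF_line (hα : ∀ i, (α i).re = 0) (hH : IsTestFunction η H) (hη : 40 < η)
    (hσ₀ : eps < σ₀) (hs₀ : σ₀ + eps < 2 * s.re) (hs₁ : 2 * s.re + σ₀ < 16 + eps)
    {δ φ : ℝ} (hδ : |δ| ≤ 1) (hφ₀ : 0 ≤ φ) (hφ : φ < π / 2) :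
    Integrable fun t : ℝ => transF α H δ (σ₀ + t * Complex.I) s φ := by
  simp only [transF_line_eq hα hH hη hσ₀ hs₀ hs₁ hδ hφ₀ hφ]
  exact (integrable_transLine hα hH hη hσ₀ hs₀ hs₁ hδ hφ₀ hφ).integral_prod_right.const_mul _

/-- After the `y`-integration, the substitution of `s₀` for `s₀ - u` produces the dual transform.
Here `r` stands for `log |a₁ / a₀|`. -/
theorem integral_odPhase_superposition (hα : ∀ i, (α i).re = 0) (hH : IsTestFunction η H)
    (hη : 40 < η) (hσ₀ : eps < σ₀) (hs₀ : σ₀ + eps < 2 * s.re) (hs₁ : 2 * s.re + σ₀ < 16 + eps)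
    {δ φ : ℝ} (hδ : |δ| ≤ 1) (hφ₀ : 0 ≤ φ) (hφ : φ < π / 2) (r : ℝ) :
    ∫ q : (ℝ × ℝ) × ℝ,
      vtKernel α ((σ₀ - eps : ℝ) + q.2 * Complex.I) ((15 : ℝ) + q.1.1 * Complex.I) *
        pertKernel δ φ (eps + q.1.2 * Complex.I) *
        Complex.exp ((1 - (σ₀ + (q.2 + q.1.2 : ℝ) * Complex.I)) * r) *
        ∫ y in quadrant, odPhase H σ₀ s y q =
    1 / 2 * (2 * π) ^ 2 * ∫ t : ℝ, Complex.exp ((1 - (σ₀ + t * Complex.I)) * r) *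
      transF α H δ (σ₀ + t * Complex.I) s φ := by
  have hi := integrable_transLine hα hH hη hσ₀ hs₀ hs₁ hδ hφ₀ hφ
  have hpi : (π : ℂ) ≠ 0 := by exact_mod_cast Real.pi_ne_zero
  set F : (ℝ × ℝ) × ℝ → ℂ := fun q =>
    Complex.exp ((1 - (σ₀ + q.2 * Complex.I)) * r) * transLine α H δ σ₀ s φ q with hF
  have hFi : Integrable F := by
    refine hi.bdd_mul (c := Real.exp ((1 - σ₀) * r))
      (by fun_prop : Continuous _).aestronglyMeasurable (ae_of_all _ fun q => ?_)
    simp [Complex.norm_exp]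
  calc _ = ∫ q : (ℝ × ℝ) × ℝ, 1 / 2 * F (q.1, q.2 + q.1.2) := by
        refine integral_congr_ae (ae_of_all _ fun q => ?_)
        simp only [hF, transLine]
        rw [integral_odPhase hs₀ hs₁, transIntegrand_eq, vtKernel_transLine_eq,
          add_sub_cancel_right]
        ring
    _ = 1 / 2 * ∫ q, F q := by
        rw [integral_const_mul, integral_comp_measurePreserving measurePreserving_add_im
          hFi.aestronglyMeasurable]
    _ = 1 / 2 * ∫ t : ℝ, ∫ p : ℝ × ℝ, F (p, t) := by
        congr 1
        exact integral_prod_symm F hFi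
    _ = _ := by
        rw [mul_assoc, ← integral_const_mul ((2 * π : ℂ) ^ 2)]
        congr 1
        refine integral_congr_ae (ae_of_all _ fun t => ?_)
        simp only [hF]
        rw [integral_const_mul, transF_line_eq hα hH hη hσ₀ hs₀ hs₁ hδ hφ₀ hφ]
        field_simp

theorem sign_div_intCast {a₀ a₁ : ℤ} (h₀ : a₀ ≠ 0) (h₁ : a₁ ≠ 0) :
    Real.sign ((a₁ : ℝ) / a₀) = 1 ∨ Real.sign ((a₁ : ℝ) / a₀) = -1 :=
  (Real.sign_apply_eq_of_ne_zero _ (div_ne_zero (Int.cast_ne_zero.2 h₁)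
    (Int.cast_ne_zero.2 h₀))).symm

/-- A single term of the off-diagonal: it converges absolutely, its `L¹` norm is bounded by a term
of a convergent double series, with a constant independent of `a₀` and `a₁`, and it is an integral
over the line `Re s₀ = σ₀`. -/
theorem exists_odIntegrand_bound (hα : ∀ i, (α i).re = 0) (hsum : α 0 + α 1 + α 2 = 0)
    (hH : IsTestFunction η H) (hη : 40 < η) (hσ₀ : eps < σ₀) (hs₀ : σ₀ + eps < 2 * s.re)
    (hs₁ : 2 * s.re + σ₀ < 16 + eps) {φ : ℝ} (hφ₀ : 0 ≤ φ) (hφ : φ < π / 2) (Φ : Mat3 → ℂ) :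
    ∃ C : ℝ, ∀ a₀ a₁ : ℤ, a₀ ≠ 0 → a₁ ≠ 0 →
      IntegrableOn (odIntegrand Φ α H s φ a₀ a₁) quadrant ∧
      (∫ y in quadrant, ‖odIntegrand Φ α H s φ a₀ a₁ y‖ ≤
        ‖fourierCoeff Φ α 1 a₁‖ * |(a₁ : ℝ)| ^ (-σ₀) * |(a₀ : ℝ)| ^ (σ₀ - 2 * s.re) * C) ∧
      ∫ y in quadrant, odIntegrand Φ α H s φ a₀ a₁ y = 1 / 8 * vint σ₀ fun s₀ =>
        fourierCoeff Φ α 1 a₁ * ((|(a₁ : ℝ)| : ℝ) : ℂ) ^ (-s₀) *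
          ((|(a₀ : ℝ)| : ℝ) : ℂ) ^ (s₀ - 2 * s) *
          transF α H (Real.sign ((a₁ : ℝ) / a₀)) s₀ s φ := by
  -- The `L¹` norm of the kernel depends on `x = a₁ / a₀` only through its sign and a power of `|x|`.
  set N : ℝ → ℝ := fun δ => ∫ q : (ℝ × ℝ) × ℝ,
      ‖vtKernel α ((σ₀ - eps : ℝ) + q.2 * Complex.I) ((15 : ℝ) + q.1.1 * Complex.I) *
        pertKernel δ φ (eps + q.1.2 * Complex.I)‖ with hN
  have hN0 : ∀ δ, 0 ≤ N δ := fun δ => by positivity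
  refine ⟨1 / 4 * (1 / (2 * π)) ^ 3 * ((∫ y in quadrant, odMajorant H σ₀ s.re y) *
    (N 1 + N (-1))), fun a₀ a₁ h₀ h₁ => ?_⟩
  set x : ℝ := (a₁ : ℝ) / a₀ with hx
  have hδ := sign_div_intCast h₀ h₁
  rw [← hx] at hδ
  set δ := Real.sign x with hδdef
  have hδ1 : |δ| ≤ 1 := by rcases hδ with h | h <;> simp [h]
  have hNδ : N δ ≤ N 1 + N (-1) := by
    rcases hδ with h | h <;> rw [h]
    · linarith [hN0 (-1)]
    · linarith [hN0 1]
  have h₀' : 0 < |(a₀ : ℝ)| := abs_pos.2 (Int.cast_ne_zero.2 h₀)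
  have h₁' : 0 < |(a₁ : ℝ)| := abs_pos.2 (Int.cast_ne_zero.2 h₁)
  have hx0 : x ≠ 0 := div_ne_zero (Int.cast_ne_zero.2 h₁) (Int.cast_ne_zero.2 h₀)
  have hlog : Real.log |x| = Real.log |(a₁ : ℝ)| - Real.log |(a₀ : ℝ)| := by
    rw [hx, abs_div, Real.log_div h₁'.ne' h₀'.ne']
  set B := fourierCoeff Φ α 1 a₁ with hB
  set c : ℂ := B / (((|(a₀ : ℝ)| : ℝ) : ℂ) ^ (2 * s - 1) * ((|(a₁ : ℝ)| : ℝ) : ℂ)) with hc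
  have hceq : c = B * Complex.exp (-(2 * s - 1) * Real.log |(a₀ : ℝ)| -
      Real.log |(a₁ : ℝ)|) := by
    rw [hc, ofReal_cpow_eq_exp h₀', neg_mul, Complex.exp_sub, Complex.exp_neg,
      ← Complex.ofReal_exp (Real.log |(a₁ : ℝ)|), Real.exp_log h₁']
    field_simp
  set K : (ℝ × ℝ) × ℝ → ℂ := fun q =>
      vtKernel α ((σ₀ - eps : ℝ) + q.2 * Complex.I) ((15 : ℝ) + q.1.1 * Complex.I) *
        pertKernel δ φ (eps + q.1.2 * Complex.I) *
        Complex.exp ((1 - (σ₀ + (q.2 + q.1.2 : ℝ) * Complex.I)) * Real.log |x|) with hK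
  have hnorm : ∀ t : ℝ, ‖Complex.exp ((1 - (σ₀ + t * Complex.I)) * Real.log |x|)‖ =
      Real.exp ((1 - σ₀) * Real.log |x|) := fun t => by simp [Complex.norm_exp]
  have hKi : Integrable K := by
    refine (integrable_vtKernel_mul_pertKernel hα (sub_pos.2 hσ₀) hδ1 hφ₀ hφ).mul_bdd
      (c := Real.exp ((1 - σ₀) * Real.log |x|))
      (by fun_prop : Continuous _).aestronglyMeasurable (ae_of_all _ fun q => (hnorm _).le)
  have hKn : ∫ q, ‖K q‖ = N δ * Real.exp ((1 - σ₀) * Real.log |x|) := by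
    simp only [hK, hN]
    rw [← integral_mul_const]
    refine integral_congr_ae (ae_of_all _ fun q => ?_)
    simp only
    rw [norm_mul, hnorm]
  have hmeas : MeasurableSet quadrant := measurableSet_Ioi.prod measurableSet_Ioi
  have hod : ∀ y ∈ quadrant, odIntegrand Φ α H s φ a₀ a₁ y =
      c * (1 / 4 * (1 / (2 * π)) ^ 3) * ∫ q, K q * odPhase H σ₀ s y q := by
    intro y hy
    rw [odIntegrand, odIntegrand_eq hα hsum hσ₀ hy hx0 φ, ← mul_assoc]
  have hsup := integrable_superposition (μ := volume.restrict quadrant) hKi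
    (aestronglyMeasurable_odPhase hH hη σ₀ s) (integrableOn_odMajorant hH hη hσ₀ hs₀ hs₁)
    (fun y q => (norm_odPhase H σ₀ s y q).le)
  refine ⟨?_, ?_, ?_⟩
  · exact (hsup.1.const_mul (c * (1 / 4 * (1 / (2 * π)) ^ 3))).congr
      ((ae_restrict_iff' hmeas).2 (ae_of_all _ fun y hy => (hod y hy).symm))
  · rw [setIntegral_congr_fun hmeas fun y hy => by rw [hod y hy, norm_mul]]
    rw [integral_const_mul]
    have hcn : ‖c * (1 / 4 * (1 / (2 * π)) ^ 3)‖ * Real.exp ((1 - σ₀) * Real.log |x|) =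
        ‖B‖ * |(a₁ : ℝ)| ^ (-σ₀) * |(a₀ : ℝ)| ^ (σ₀ - 2 * s.re) *
          (1 / 4 * (1 / (2 * π)) ^ 3) := by
      have h5 : ‖(1 / 4 * (1 / (2 * π)) ^ 3 : ℂ)‖ = 1 / 4 * (1 / (2 * π)) ^ 3 := by
        rw [show (1 / 4 * (1 / (2 * π)) ^ 3 : ℂ) = ((1 / 4 * (1 / (2 * π)) ^ 3 : ℝ) : ℂ) by
          push_cast; rfl, Complex.norm_real, Real.norm_of_nonneg (by positivity)]
      have h6 : Real.exp (-(2 * s.re - 1) * Real.log |(a₀ : ℝ)| - Real.log |(a₁ : ℝ)|) *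
          Real.exp ((1 - σ₀) * Real.log |x|) =
          |(a₁ : ℝ)| ^ (-σ₀) * |(a₀ : ℝ)| ^ (σ₀ - 2 * s.re) := by
        rw [Real.rpow_def_of_pos h₁', Real.rpow_def_of_pos h₀', ← Real.exp_add, ← Real.exp_add,
          hlog]
        congr 1
        ring
      have h7 : (-(2 * s - 1) * Real.log |(a₀ : ℝ)| - Real.log |(a₁ : ℝ)|).re =
          -(2 * s.re - 1) * Real.log |(a₀ : ℝ)| - Real.log |(a₁ : ℝ)| := by
        rw [Complex.sub_re, Complex.re_mul_ofReal, Complex.ofReal_re]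
        simp
      rw [norm_mul, h5, hceq, norm_mul, Complex.norm_exp, h7]
      linear_combination (‖B‖ * (1 / 4 * (1 / (2 * π)) ^ 3)) * h6
    have hm0 : 0 ≤ ∫ y in quadrant, odMajorant H σ₀ s.re y :=
      integral_nonneg fun y => by unfold odMajorant; positivity
    calc _ ≤ ‖c * (1 / 4 * (1 / (2 * π)) ^ 3)‖ * ((∫ y in quadrant, odMajorant H σ₀ s.re y) *
          ∫ q, ‖K q‖) := by
          gcongr
          exact hsup.2.1
      _ = ‖c * (1 / 4 * (1 / (2 * π)) ^ 3)‖ * Real.exp ((1 - σ₀) * Real.log |x|) *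
          ((∫ y in quadrant, odMajorant H σ₀ s.re y) * N δ) := by
          rw [hKn]
          ring
      _ ≤ ‖c * (1 / 4 * (1 / (2 * π)) ^ 3)‖ * Real.exp ((1 - σ₀) * Real.log |x|) *
          ((∫ y in quadrant, odMajorant H σ₀ s.re y) * (N 1 + N (-1))) := by
          gcongr
      _ = _ := by
          rw [hcn]
          ring
  · rw [setIntegral_congr_fun hmeas fun y hy => hod y hy, integral_const_mul, hsup.2.2,
      integral_odPhase_superposition hα hH hη hσ₀ hs₀ hs₁ hδ1 hφ₀ hφ, vint]
    have hpi : (π : ℂ) ≠ 0 := by exact_mod_cast Real.pi_ne_zero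
    have hconst : ∀ J : ℂ, c * (1 / 4 * (1 / (2 * (π : ℂ))) ^ 3) * (1 / 2 * (2 * π) ^ 2 * J) =
        1 / 8 * (1 / (2 * π) * (c * J)) := by
      intro J
      field_simp
      ring
    rw [hconst, ← integral_const_mul]
    congr 2
    refine integral_congr_ae (ae_of_all _ fun t => ?_)
    simp only
    have h8 : Complex.exp (-(2 * s - 1) * Real.log |(a₀ : ℝ)| - Real.log |(a₁ : ℝ)|) *
        Complex.exp ((1 - (σ₀ + t * Complex.I)) * Real.log |x|) =
        ((|(a₁ : ℝ)| : ℝ) : ℂ) ^ (-(σ₀ + t * Complex.I)) *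
          ((|(a₀ : ℝ)| : ℝ) : ℂ) ^ (σ₀ + t * Complex.I - 2 * s) := by
      rw [ofReal_cpow_eq_exp h₁', ofReal_cpow_eq_exp h₀', ← Complex.exp_add, ← Complex.exp_add,
        hlog]
      congr 1
      push_cast
      ring
    rw [hceq]
    linear_combination (B * transF α H δ (σ₀ + t * Complex.I) s φ) * h8

end

/-! ### Summation over nonzero integers -/

/-- A sum over nonzero integers as the sum over positive `n` of the terms at `n` and at `-n`; `p` and
`q` are these terms, extended by `0` to `n = 0`. -/
theorem tsum_nonzero_int {f : ℤ → ℂ} {p q : ℕ → ℂ} (hp : Summable p) (hq : Summable q)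
    (hp₀ : p 0 = 0) (hq₀ : q 0 = 0) (hfp : ∀ n : ℕ, n ≠ 0 → f n = p n)
    (hfq : ∀ n : ℕ, n ≠ 0 → f (-n) = q n) :
    ∑' a : NZ, f a = ∑' n, p n + ∑' n, q n := by
  have h1 : ∀ n : ℕ, indicator {a : ℤ | a ≠ 0} f n = p n := by
    intro n
    rcases eq_or_ne n 0 with rfl | hn
    · simp [hp₀]
    · rw [indicator_of_mem (by simpa using hn), hfp n hn]
  have h2 : ∀ n : ℕ, indicator {a : ℤ | a ≠ 0} f (-(n + 1 : ℤ)) = q (n + 1) := by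
    intro n
    rw [indicator_of_mem (by show (-(n + 1 : ℤ)) ≠ 0; omega), ← hfq (n + 1) (by omega)]
    simp
  have h3 := tsum_subtype {a : ℤ | a ≠ 0} f
  refine h3.trans ?_
  rw [tsum_of_nat_of_neg_add_one (by simpa only [h1] using hp)
    (by simpa only [h2] using (summable_nat_add_iff 1).2 hq), hq.tsum_eq_zero_add, hq₀, zero_add]
  simp only [h1, h2]

theorem summable_nonzero_int_rpow {x : ℝ} (hx : 1 < x) :
    Summable fun a : NZ => |(a.1 : ℝ)| ^ (-x) :=
  (Real.summable_abs_int_rpow hx).comp_injective Subtype.val_injective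

theorem term_eq_mul_abs_cpow (f : ℕ → ℂ) (s : ℂ) {n : ℕ} (hn : n ≠ 0) :
    LSeries.term f s n = f n * ((|(n : ℝ)| : ℝ) : ℂ) ^ (-s) := by
  rw [LSeries.term_of_ne_zero hn, Nat.abs_cast, Complex.ofReal_natCast, Complex.cpow_neg,
    div_eq_mul_inv]

/-- A Dirichlet series is continuous and bounded on a vertical line of absolute convergence. -/
theorem continuous_LSeries_comp {f : ℕ → ℂ} {σ : ℝ} (hf : LSeriesSummable f σ) {g : ℝ → ℂ}
    (hg : Continuous g) (hre : ∀ t, (g t).re = σ) :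
    Continuous (fun t => LSeries f (g t)) ∧
      ∀ t, ‖LSeries f (g t)‖ ≤ ∑' n, ‖LSeries.term f σ n‖ := by
  have hn : ∀ n t, ‖LSeries.term f (g t) n‖ = ‖LSeries.term f σ n‖ := by
    intro n t
    rw [LSeries.norm_term_eq, LSeries.norm_term_eq, hre, Complex.ofReal_re]
  refine ⟨continuous_tsum (fun n => ?_) hf.norm fun n t => (hn n t).le,
    fun t => tsum_of_norm_bounded hf.norm.hasSum fun n => (hn n t).le⟩
  rcases eq_or_ne n 0 with rfl | h
  · simpa using continuous_const
  · have h0 : (0 : ℝ) < n := by positivity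
    simp only [LSeries.term_of_ne_zero h, ← Complex.ofReal_natCast n, ofReal_cpow_eq_exp h0,
      div_eq_mul_inv, ← Complex.exp_neg]
    fun_prop

/-- The sum over `a₀` and `a₁`: only the sign of `a₁ / a₀` couples the two variables. -/
theorem tsum_dual_eq {b : ℤ → ℂ} (hb : ∀ a, b (-a) = b a) {s s₀ : ℂ} (hs : 1 < (2 * s - s₀).re)
    (hL : LSeriesSummable (fun n : ℕ => b n) s₀) (R : ℝ → ℂ)
    (hsum : Summable fun a : NZ × NZ => b a.2 * ((|(a.2.1 : ℝ)| : ℝ) : ℂ) ^ (-s₀) *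
      ((|(a.1.1 : ℝ)| : ℝ) : ℂ) ^ (s₀ - 2 * s) * R (Real.sign ((a.2.1 : ℝ) / a.1.1))) :
    ∑' a : NZ × NZ, b a.2 * ((|(a.2.1 : ℝ)| : ℝ) : ℂ) ^ (-s₀) *
      ((|(a.1.1 : ℝ)| : ℝ) : ℂ) ^ (s₀ - 2 * s) * R (Real.sign ((a.2.1 : ℝ) / a.1.1)) =
    2 * (riemannZeta (2 * s - s₀) * LSeries (fun n : ℕ => b n) s₀ * (R 1 + R (-1))) := by
  rw [hsum.tsum_prod]
  have hinner : ∀ a₀ : NZ, ∑' a₁ : NZ, b a₁ * ((|(a₁.1 : ℝ)| : ℝ) : ℂ) ^ (-s₀) *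
      ((|(a₀.1 : ℝ)| : ℝ) : ℂ) ^ (s₀ - 2 * s) * R (Real.sign ((a₁.1 : ℝ) / a₀.1)) =
      LSeries (fun n : ℕ => b n) s₀ * (((|(a₀.1 : ℝ)| : ℝ) : ℂ) ^ (s₀ - 2 * s) *
        (R 1 + R (-1))) := by
    intro a₀
    set c := ((|(a₀.1 : ℝ)| : ℝ) : ℂ) ^ (s₀ - 2 * s) with hc
    have ha₀ : (a₀.1 : ℝ) ≠ 0 := Int.cast_ne_zero.2 a₀.2
    -- For each `a₀`, the signs of `a₁ / a₀` for `a₁ = ±n` are `1` and `-1` in some order.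
    have hR : R (Real.sign (1 / (a₀.1 : ℝ))) + R (Real.sign (-1 / (a₀.1 : ℝ))) =
        R 1 + R (-1) := by
      rcases lt_or_gt_of_ne ha₀ with h | h
      · rw [Real.sign_of_neg (div_neg_of_pos_of_neg one_pos h),
          Real.sign_of_pos (div_pos_of_neg_of_neg (by norm_num) h), add_comm]
      · rw [Real.sign_of_pos (div_pos one_pos h),
          Real.sign_of_neg (div_neg_of_neg_of_pos (by norm_num) h)]
    have hsg : ∀ (n : ℕ) (ε : ℝ), n ≠ 0 →
        Real.sign (ε * n / (a₀.1 : ℝ)) = Real.sign (ε / (a₀.1 : ℝ)) := by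
      intro n ε hn
      have h0 : (0 : ℝ) < n := by positivity
      rw [mul_div_right_comm]
      rcases lt_trichotomy (ε / (a₀.1 : ℝ)) 0 with h | h | h
      · rw [Real.sign_of_neg h, Real.sign_of_neg (mul_neg_of_neg_of_pos h h0)]
      · rw [h, zero_mul]
      · rw [Real.sign_of_pos h, Real.sign_of_pos (mul_pos h h0)]
    have h := tsum_nonzero_int (f := fun a => b a * ((|(a : ℝ)| : ℝ) : ℂ) ^ (-s₀) * c *
        R (Real.sign ((a : ℝ) / a₀.1)))
      (p := fun n => LSeries.term (fun n : ℕ => b n) s₀ n *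
        (c * R (Real.sign (1 / (a₀.1 : ℝ)))))
      (q := fun n => LSeries.term (fun n : ℕ => b n) s₀ n *
        (c * R (Real.sign (-1 / (a₀.1 : ℝ)))))
      (Summable.mul_right _ hL) (Summable.mul_right _ hL) (by simp) (by simp)
      (fun n hn => by
        rw [term_eq_mul_abs_cpow _ _ hn, ← hsg n 1 hn]
        push_cast
        rw [one_mul, mul_assoc])
      (fun n hn => by
        rw [term_eq_mul_abs_cpow _ _ hn, ← hsg n (-1) hn, hb]
        push_cast
        rw [neg_one_mul, abs_neg, mul_assoc])
    refine h.trans ?_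
    rw [tsum_mul_right, tsum_mul_right, ← hR, LSeries]
    ring
  simp only [hinner]
  have hz : LSeriesSummable 1 (2 * s - s₀) := LSeriesSummable_one_iff.2 hs
  have h := tsum_nonzero_int (f := fun a => LSeries (fun n : ℕ => b n) s₀ *
      (((|(a : ℝ)| : ℝ) : ℂ) ^ (s₀ - 2 * s) * (R 1 + R (-1))))
    (p := fun n => LSeries.term 1 (2 * s - s₀) n *
      (LSeries (fun n : ℕ => b n) s₀ * (R 1 + R (-1))))
    (q := fun n => LSeries.term 1 (2 * s - s₀) n *
      (LSeries (fun n : ℕ => b n) s₀ * (R 1 + R (-1))))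
    (Summable.mul_right _ hz) (Summable.mul_right _ hz) (by simp) (by simp)
    (fun n hn => by
      rw [term_eq_mul_abs_cpow _ _ hn, neg_sub]
      push_cast
      simp only [Pi.one_apply]
      ring)
    (fun n hn => by
      rw [term_eq_mul_abs_cpow _ _ hn, neg_sub]
      push_cast
      rw [abs_neg]
      simp only [Pi.one_apply]
      ring)
  refine h.trans ?_
  have h1 : ∑' n, LSeries.term 1 (2 * s - s₀) n = riemannZeta (2 * s - s₀) :=
    LSeries_one_eq_riemannZeta hs
  rw [tsum_mul_right, h1]
  ring

/-- The bound for positive indices extends to negative ones by `fourierCoeff_neg_right`. -/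
theorem IsRamanujanExponent.norm_fourierCoeff_le {Φ : Mat3 → ℂ} {α : Fin 3 → ℂ} {θ : ℝ}
    (hθ : IsRamanujanExponent Φ α θ) (hΦ : IsMaassCuspForm Φ α) {κ : ℝ} (hκ : 0 < κ) :
    ∃ C : ℝ, ∀ a : ℤ, a ≠ 0 → ‖fourierCoeff Φ α 1 a‖ ≤ C * |(a : ℝ)| ^ (θ + κ) := by
  obtain ⟨C, hC⟩ := hθ.2 κ hκ
  refine ⟨C, fun a ha => ?_⟩
  have hn : 1 ≤ a.natAbs := Int.natAbs_pos.2 ha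
  have h := hC a.natAbs hn
  have hcast : ((a.natAbs : ℕ) : ℝ) = |(a : ℝ)| := by
    rw [Nat.cast_natAbs, Int.cast_abs]
  rw [hcast] at h
  rcases Int.natAbs_eq a with h' | h'
  · rwa [← h'] at h
  · rw [← fourierCoeff_neg_right hΦ, ← h'] at h
    exact h

/-- Absolute convergence of the double Dirichlet series `∑ B(1, a₁) |a₁|^{-s₀} |a₀|^{s₀-2s}`. -/
theorem IsRamanujanExponent.summable_fourierCoeff {Φ : Mat3 → ℂ} {α : Fin 3 → ℂ} {θ : ℝ}
    (hθ : IsRamanujanExponent Φ α θ) (hΦ : IsMaassCuspForm Φ α) {σ σ₀ : ℝ} (h : 1 + θ < σ₀)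
    (hσ : 1 + σ₀ < 2 * σ) :
    Summable fun a : NZ × NZ => ‖fourierCoeff Φ α 1 a.2‖ * |(a.2.1 : ℝ)| ^ (-σ₀) *
      |(a.1.1 : ℝ)| ^ (σ₀ - 2 * σ) := by
  obtain ⟨D, hD⟩ := hθ.norm_fourierCoeff_le hΦ (κ := (σ₀ - (1 + θ)) / 2) (by linarith)
  have h1 := summable_nonzero_int_rpow (x := 2 * σ - σ₀) (by linarith)
  have h2 := (summable_nonzero_int_rpow (x := 1 + (σ₀ - (1 + θ)) / 2)
    (by linarith)).mul_left |D|
  have h3 : Summable fun a : NZ × NZ => |D| * |(a.2.1 : ℝ)| ^ (-(1 + (σ₀ - (1 + θ)) / 2)) *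
      |(a.1.1 : ℝ)| ^ (-(2 * σ - σ₀)) :=
    ((h1.mul_of_nonneg h2 (fun _ => by positivity) (fun _ => by positivity)).congr
      fun a => mul_comm _ _)
  refine h3.of_nonneg_of_le (fun a => by positivity) fun a => ?_
  have ha : 0 < |(a.2.1 : ℝ)| := abs_pos.2 (Int.cast_ne_zero.2 a.2.2)
  rw [neg_sub]
  refine mul_le_mul_of_nonneg_right ?_ (by positivity)
  calc _ ≤ D * |(a.2.1 : ℝ)| ^ (θ + (σ₀ - (1 + θ)) / 2) * |(a.2.1 : ℝ)| ^ (-σ₀) :=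
        mul_le_mul_of_nonneg_right (hD _ a.2.2) (by positivity)
    _ = D * |(a.2.1 : ℝ)| ^ (-(1 + (σ₀ - (1 + θ)) / 2)) := by
        rw [mul_assoc, ← Real.rpow_add ha]
        congr 2
        ring
    _ ≤ _ := mul_le_mul_of_nonneg_right (le_abs_self D) (by positivity)

theorem IsRamanujanExponent.lSeriesSummable {Φ : Mat3 → ℂ} {α : Fin 3 → ℂ} {θ : ℝ}
    (hθ : IsRamanujanExponent Φ α θ) {s : ℂ} (hs : 1 + θ < s.re) :
    LSeriesSummable (fun n : ℕ => fourierCoeff Φ α 1 n) s := by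
  obtain ⟨C, hC⟩ := hθ.2 ((s.re - (1 + θ)) / 2) (by linarith)
  refine LSeriesSummable_of_le_const_mul_rpow (x := 1 + θ + (s.re - (1 + θ)) / 2) (by linarith)
    ⟨C, fun n hn => ?_⟩
  rw [show 1 + θ + (s.re - (1 + θ)) / 2 - 1 = θ + (s.re - (1 + θ)) / 2 by ring]
  exact hC n (Nat.one_le_iff_ne_zero.2 hn)

end

end DualMoment

/-! ### The dual moment formula -/

theorem mainTheorem4
    (Φ : DualMoment.Mat3 → ℂ) (α : Fin 3 → ℂ) (hΦ : DualMoment.IsMaassCuspForm Φ α)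
    (hα : ∀ i, (α i).re = 0)
    (θ : ℝ) (hθ : DualMoment.IsRamanujanExponent Φ α θ)
    (η : ℝ) (hη : 40 < η) (H : ℂ → ℂ) (hH : DualMoment.IsTestFunction η H)
    (φ : ℝ) (hφ₀ : 0 < φ) (hφ₁ : φ < Real.pi / 2)
    (s : ℂ) (hs₀ : 1 + θ / 2 + DualMoment.eps < s.re) (hs₁ : s.re < 4) :
    DualMoment.OffDiagConverges Φ α H s φ ∧
    (∀ δ : ℝ, δ = 1 ∨ δ = -1 → ∀ s₀ : ℂ, s₀.re = 1 + θ + 2 * DualMoment.eps →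
      DualMoment.TransConverges α H δ s₀ s φ) ∧
    MeasureTheory.Integrable (fun t : ℝ => DualMoment.dualIntegrand Φ α H s φ
      ((1 + θ + 2 * DualMoment.eps : ℝ) + t * Complex.I)) ∧
    DualMoment.offDiag Φ α H s φ =
      (1 / 4) * DualMoment.vint (1 + θ + 2 * DualMoment.eps)
        (DualMoment.dualIntegrand Φ α H s φ) := by
  open DualMoment in
  have he : eps = 1 / 100 := rfl
  have hθ0 := hθ.1
  set σ₀ : ℝ := 1 + θ + 2 * eps with hσ₀def
  have hσ₀ : eps < σ₀ := by linarith
  have h₀ : σ₀ + eps < 2 * s.re := by linarith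
  have h₁ : 2 * s.re + σ₀ < 16 + eps := by linarith
  have hδ : ∀ δ : ℝ, δ = 1 ∨ δ = -1 → |δ| ≤ 1 := by rintro δ (rfl | rfl) <;> simp
  obtain ⟨C, hC⟩ := exists_odIntegrand_bound hα hΦ.sum_param hH hη hσ₀ h₀ h₁ hφ₀.le hφ₁ Φ
  set N : NZ × NZ → ℝ := fun a => ‖fourierCoeff Φ α 1 a.2‖ * |(a.2.1 : ℝ)| ^ (-σ₀) *
    |(a.1.1 : ℝ)| ^ (σ₀ - 2 * s.re) with hN
  -- The sum over `a₁` converges since `σ₀ > 1 + θ`, and that over `a₀` since `2 Re s > 1 + σ₀`; the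
  -- latter is the lower bound for `Re s`.
  have hNs : Summable N := hθ.summable_fourierCoeff hΦ (by linarith) (by linarith)
  set R : ℝ → ℝ → ℂ := fun δ t => transF α H δ (σ₀ + t * Complex.I) s φ with hR
  have hRi : ∀ δ : ℝ, δ = 1 ∨ δ = -1 → Integrable (R δ) := fun δ h =>
    integrable_transF_line hα hH hη hσ₀ h₀ h₁ (hδ δ h) hφ₀.le hφ₁
  have hR₁ := hRi 1 (Or.inl rfl)
  have hR₂ := hRi (-1) (Or.inr rfl)
  set c : NZ × NZ → ℝ → ℂ := fun a t => fourierCoeff Φ α 1 a.2 *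
    ((|(a.2.1 : ℝ)| : ℝ) : ℂ) ^ (-(σ₀ + t * Complex.I)) *
    ((|(a.1.1 : ℝ)| : ℝ) : ℂ) ^ (σ₀ + t * Complex.I - 2 * s) with hc
  set F : NZ × NZ → ℝ → ℂ := fun a t => c a t * R (Real.sign ((a.2.1 : ℝ) / a.1.1)) t with hF
  have hpos : ∀ a : NZ, 0 < |(a.1 : ℝ)| := fun a => abs_pos.2 (Int.cast_ne_zero.2 a.2)
  have hcn : ∀ a t, ‖c a t‖ = N a := by
    intro a t
    simp only [hc, hN]
    rw [norm_mul, norm_mul, Complex.norm_cpow_eq_rpow_re_of_pos (hpos _),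
      Complex.norm_cpow_eq_rpow_re_of_pos (hpos _)]
    simp
  have hcc : ∀ a, Continuous (c a) := by
    intro a
    simp only [hc, ofReal_cpow_eq_exp (hpos _)]
    fun_prop
  have hsgn : ∀ a : NZ × NZ, Real.sign ((a.2.1 : ℝ) / a.1.1) = 1 ∨
      Real.sign ((a.2.1 : ℝ) / a.1.1) = -1 := fun a => sign_div_intCast a.1.2 a.2.2
  have hFi : ∀ a, Integrable (F a) := fun a =>
    (hRi _ (hsgn a)).bdd_mul (c := N a) (hcc a).aestronglyMeasurable
      (ae_of_all _ fun t => (hcn a t).le)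
  have hRn : ∀ (a : NZ × NZ) t, ‖R (Real.sign ((a.2.1 : ℝ) / a.1.1)) t‖ ≤
      ‖R 1 t‖ + ‖R (-1) t‖ := by
    intro a t
    rcases hsgn a with h | h <;> rw [h] <;> simp
  have hFn : ∀ a t, ‖F a t‖ ≤ N a * (‖R 1 t‖ + ‖R (-1) t‖) := by
    intro a t
    rw [hF]
    simp only
    rw [norm_mul, hcn]
    exact mul_le_mul_of_nonneg_left (hRn a t) (by positivity)
  have hFs : Summable fun a => ∫ t, ‖F a t‖ := by
    refine (hNs.mul_right (∫ t, (‖R 1 t‖ + ‖R (-1) t‖))).of_nonneg_of_le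
      (fun a => by positivity) fun a => ?_
    rw [← integral_const_mul]
    exact integral_mono (hFi a).norm ((hR₁.norm.add hR₂.norm).const_mul _) (hFn a)
  have hL : ∀ t : ℝ, LSeriesSummable (fun n : ℕ => fourierCoeff Φ α 1 n)
      (σ₀ + t * Complex.I) := fun t => hθ.lSeriesSummable (by simp; linarith)
  have hre : ∀ t : ℝ, (2 * s - (σ₀ + t * Complex.I)).re = 2 * s.re - σ₀ := fun t => by simp
  have htsum : ∀ t : ℝ, ∑' a, F a t =
      2 * dualIntegrand Φ α H s φ (σ₀ + t * Complex.I) := fun t =>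
    tsum_dual_eq (b := fun a => fourierCoeff Φ α 1 a) (fourierCoeff_neg_right hΦ 1)
      (by rw [hre]; linarith) (hL t) (fun δ => R δ t)
      (Summable.of_norm_bounded (hNs.mul_right _) fun a => hFn a t)
  -- Summation under the `s₀`-integral sign.
  have hmain := hasSum_integral_of_summable_integral_norm hFi hFs
  refine ⟨⟨fun a => (hC _ _ a.1.2 a.2.2).1, ?_⟩, fun δ h s₀ hs =>
    transConverges hα hH hη hσ₀ h₀ h₁ (hδ δ h) hφ₀.le hφ₁ hs, ?_, ?_⟩
  · exact (hNs.mul_right C).of_nonneg_of_le (fun a => by positivity)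
      fun a => (hC _ _ a.1.2 a.2.2).2.1
  · have hz : LSeriesSummable 1 ((2 * s.re - σ₀ : ℝ) : ℂ) :=
      LSeriesSummable_one_iff.2 (by rw [Complex.ofReal_re]; linarith)
    have hzl := continuous_LSeries_comp hz
      (by fun_prop : Continuous fun t : ℝ => 2 * s - (σ₀ + t * Complex.I)) hre
    have hll := continuous_LSeries_comp (f := fun n : ℕ => fourierCoeff Φ α 1 n) (σ := σ₀)
      (by simpa using hL 0) (by fun_prop : Continuous fun t : ℝ => (σ₀ + t * Complex.I : ℂ))
      (fun t => by simp)
    have hζ : ∀ t : ℝ, LSeries 1 (2 * s - (σ₀ + t * Complex.I)) =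
        riemannZeta (2 * s - (σ₀ + t * Complex.I)) := fun t =>
      LSeries_one_eq_riemannZeta (by rw [hre]; linarith)
    simp only [hζ] at hzl
    -- `ζ(2s - s₀) L(s₀, Φ)` is continuous and bounded on the line, and the transforms are integrable.
    refine (hR₁.add hR₂).bdd_mul (hzl.1.mul hll.1).aestronglyMeasurable (ae_of_all _ fun t => ?_)
      (c := (∑' n, ‖LSeries.term 1 ((2 * s.re - σ₀ : ℝ) : ℂ) n‖) *
        ∑' n, ‖LSeries.term (fun n : ℕ => fourierCoeff Φ α 1 n) σ₀ n‖)
    rw [norm_mul]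
    gcongr
    · exact hzl.2 t
    · exact hll.2 t
  · have hterm : ∀ a : NZ × NZ, ∫ y in quadrant, odIntegrand Φ α H s φ a.1 a.2 y =
        1 / 8 * (1 / (2 * π)) * ∫ t, F a t := fun a => by
      rw [(hC _ _ a.1.2 a.2.2).2.2, vint, mul_assoc]
    rw [DualMoment.offDiag]
    simp only [hterm]
    -- The constant `1 / 8` of each term and the factor `2` from the sum over `a₀ = ±n` give `1 / 4`.
    rw [tsum_mul_left, hmain.tsum_eq]
    simp only [htsum]
    rw [integral_const_mul, vint]
    ring
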